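/- **Theorem ($RS_{1.1}^-$ completeness).** Every closed $S_1^-$ function $f:\gamma_1\to\gamma_0$ that has polynomial cost under dynamic-programming (DP) evaluation is computed by a closed $RS_{1.1}^-$ term $f'$ of the same type $\gamma_1\to\gamma_0$: for every value $v$ of type $\gamma_1$, the DP evaluations of $f(v)$ and of $f'(v)$ terminate with bisimilar values. Here: *$S_1^-$.* Normal base types are $N::=\mathsf{unit}\mid\mu P$, where $P::=\mathrm{Id}\mid \mathsf C_N\mid P+P\mid P\times P$ and $\mu P$ is the least fixed point of $P$; empty data types $\mu P$ are excluded. Ground types are $\gamma::=N\mid\gamma+\gamma\mid\gamma\times\gamma$. $S_1^-$ is the simply typed call-by-value $\lambda$-calculus with types $\gamma$ and $\gamma\to\gamma$, all variables being of ground type, with $()$, pairs, projections, injections, case, constructors $\mathsf c_{\mu P}:P(\mu P)\to\mu P$, destructors $\mathsf d_{\mu P}:\mu P\to P(\mu P)$, and structural recursion: $\mathsf{fold}_{\mu P}\,(\lambda x.e_0)\,e_1:\gamma$ when $\lambda x.e_0:P(\gamma)\to\gamma$ and $e_1:\mu P$. *Values.* A value is a finite rooted directed acyclic graph (sharing is allowed),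 with vertices for $()$, pairs, injections and constructors $\mathsf c_{\mu P}$. Two values are bisimilar if they unfold to the same tree. The size $\mathrm{size}(v)$ is the number of constructor vertices $\mathsf c_{\mu P}$ of $v$, and $\mathrm{cs}(v)=\min\{\mathrm{size}(v') : v'\sim v\}$ is the compressed size. *DP cost.* Evaluation is by the usual call-by-value big-step rules, each construct allocating a new vertex, except that each evaluation of a fold $\mathsf{fold}_{\mu P}(\lambda x.e_0)\,e_1$ keeps a memo table indexed by the vertices of the graph of $e_1$'s value: at a $\mu P$-vertex reached by the recursion, the result is first determined for its recursive successors, then $\lambda x.e_0$ is applied once and the result saved; each further recursive call at that vertex is a look-up. The cost is the number of nodes of the derivation tree, and $f$ has polynomial DP cost if there is a polynomial $q$ such that for every value $v$ of type $\gamma_1$ the evaluation of $f(v)$ has cost at most $q(\mathrm{size}(v))$. *$RS_{1.1}^-$.* The ground types are generated, by $+$ and $\times$, from each normal base type $N$ and a safe copy $N^{\mathsf S}$; $\gamma^{\mathsf S}$ (respectively $\gamma^{\mathsf N}$) replaces every base type in $\gamma$ by its safe (respectively normal) version, and $\gamma$ is normal (safe) if all its base types are. Data types $\mu P$ have normal constants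 only. The terms and typing rules are those of $S_1^-$ (with $\mathsf c_\delta,\mathsf d_\delta$ for normal $\delta=\mu P$), with these changes: case on $\gamma_1+\gamma_2$ with result type $\gamma$ requires that $\gamma_1+\gamma_2$ is normal or $\gamma$ is safe; fold requires $\lambda x.e_0:P(\gamma^{\mathsf S})\to\gamma^{\mathsf S}$ and $e_1:\mu P$ (normal) and has type $\gamma^{\mathsf S}$; there are safe constructors $(P\delta)^{\mathsf S}\to\delta^{\mathsf S}$ and destructors $\delta^{\mathsf S}\to(P\delta)^{\mathsf S}$; $\mathsf{toSafe}\,e:\gamma^{\mathsf S}$ for $e:\gamma$; $\mathsf{toNorm}\,e:\gamma^{\mathsf N}$ for $e:\gamma$ provided every free variable of $e$ has normal type; and $\mathsf{cs}_\delta\,e:\mathsf{nat}$ for $e:\delta$ normal, where $\mathsf{nat}=\mu(\mathsf C_{\mathsf{unit}}+\mathrm{Id})$. Evaluation ignores the normal/safe distinction ($\mathsf{toSafe}$ and $\mathsf{toNorm}$ return their argument), and $\mathsf{cs}_\delta\,e$ evaluates to the numeral of $\mathrm{cs}(v)$ for the value $v$ of $e$. The types $\gamma_1,\gamma_0$ of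 $f'$ are the normal types. -/

import Mathlib

namespace StructRec

/-! ### Types -/

mutual
/-- Normal base types: `unit` and the inductive data types `μP`. -/
inductive Base : Type
  | unit : Base
  | mu (P : Poly) : Base
/-- Polynomial functors whose constants are normal base types. -/
inductive Poly : Type
  | id : Poly
  | const (N : Base) : Poly
  | sum (P Q : Poly) : Poly
  | prod (P Q : Poly) : Poly
end

/-- `P.Base0` : the set `P ∅` is nonempty, when all constants of `P` are nonempty. -/
def Poly.Base0 : Poly → Prop
  | .id => False
  | .const _ => True
  | .sum P Q => P.Base0 ∨ Q.Base0
  | .prod P Q => P.Base0 ∧ Q.Base0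

mutual
/-- All data types occurring in a base type (itself included) are inhabited:
`μP` is inhabited iff `P ∅` is nonempty. -/
def Base.Inhab : Base → Prop
  | .unit => True
  | .mu P => P.Inhab ∧ P.Base0
/-- All data types occurring in a polynomial functor are inhabited. -/
def Poly.Inhab : Poly → Prop
  | .id => True
  | .const N => N.Inhab
  | .sum P Q => P.Inhab ∧ Q.Inhab
  | .prod P Q => P.Inhab ∧ Q.Inhab
end

/-- Ground types over a set `B` of base types. -/
inductive Ground (B : Type) : Type
  | base (b : B) : Ground B
  | sum (γ₁ γ₂ : Ground B) : Ground B
  | prod (γ₁ γ₂ : Ground B) : Ground B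

/-- Every base type occurring in the ground type satisfies `p`. -/
def Ground.All {B : Type} (p : B → Prop) : Ground B → Prop
  | .base b => p b
  | .sum γ₁ γ₂ => γ₁.All p ∧ γ₂.All p
  | .prod γ₁ γ₂ => γ₁.All p ∧ γ₂.All p

def Ground.map {B C : Type} (k : B → C) : Ground B → Ground C
  | .base b => .base (k b)
  | .sum γ₁ γ₂ => .sum (γ₁.map k) (γ₂.map k)
  | .prod γ₁ γ₂ => .prod (γ₁.map k) (γ₂.map k)

/-- The type `P(γ)`; the map `k` places the constants of `P` among the base types. -/
def Poly.app {B : Type} (k : Base → B) : Poly → Ground B → Ground B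
  | .id, γ => γ
  | .const N, _ => .base (k N)
  | .sum P Q, γ => .sum (P.app k γ) (Q.app k γ)
  | .prod P Q, γ => .prod (P.app k γ) (Q.app k γ)

/-- Level-0 and level-1 types. -/
inductive Ty (B : Type) : Type
  | ground (γ : Ground B) : Ty B
  | arr (γ₁ γ₀ : Ground B) : Ty B

/-- Base types of the ramified calculus: each normal base type and its safe version. -/
inductive RBase : Type
  | norm (N : Base) : RBase
  | safe (N : Base) : RBase

def RBase.under : RBase → Base
  | .norm N => N
  | .safe N => N

def RBase.IsNorm : RBase → Prop
  | .norm _ => True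
  | .safe _ => False

def RBase.IsSafe : RBase → Prop
  | .norm _ => False
  | .safe _ => True

/-- Ground types of `S₁⁻`. -/
abbrev SGround : Type := Ground Base
/-- Ground types of `RS₁⁻` and `RS₁.₁⁻`. -/
abbrev RGround : Type := Ground RBase

def SGround.Ok (γ : SGround) : Prop := γ.All Base.Inhab
def RGround.Ok (γ : RGround) : Prop := γ.All fun b => b.under.Inhab
def RGround.IsNormal (γ : RGround) : Prop := γ.All RBase.IsNorm
def RGround.IsSafe (γ : RGround) : Prop := γ.All RBase.IsSafe
/-- The safe version of a ramified ground type. -/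
def RGround.toSafe (γ : RGround) : RGround := γ.map fun b => .safe b.under
/-- The normal version of a ramified ground type. -/
def RGround.toNorm (γ : RGround) : RGround := γ.map fun b => .norm b.under
/-- `S₁⁻` ground types are the normal ground types of the ramified calculus. -/
def SGround.toR (γ : SGround) : RGround := γ.map RBase.norm

/-- The data type `μP` as an `S₁⁻` ground type. -/
def sMu (P : Poly) : SGround := .base (.mu P)
/-- The normal data type `μP` as a ramified ground type. -/
def rMu (P : Poly) : RGround := .base (.norm (.mu P))
/-- `P(γ)` in `S₁⁻`. -/
def Poly.sApp (P : Poly) (γ : SGround) : SGround := P.app (fun N => N) γ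
/-- `P(γ)` in the ramified calculus: the constants of `P` are normal. -/
def Poly.rApp (P : Poly) (γ : RGround) : RGround := P.app RBase.norm γ

/-- `nat = μ(C_unit + Id)`. -/
def natP : Poly := .sum (.const .unit) .id

/-! ### Raw syntax, with de Bruijn indices -/

/-- Raw terms of `RS₁.₁⁻`. Those of `S₁⁻` are the ones without
`conS`, `desS`, `toSafe`, `toNorm`, `cs`. -/
inductive Tm : Type
  | var (i : ℕ) : Tm
  | lam (e : Tm) : Tm
  | app (e₀ e₁ : Tm) : Tm
  | unit : Tm
  | pair (e₁ e₂ : Tm) : Tm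
  | fst (e : Tm) : Tm
  | snd (e : Tm) : Tm
  | inl (e : Tm) : Tm
  | inr (e : Tm) : Tm
  /-- `e₁` and `e₂` each bind one variable. -/
  | case (e₀ e₁ e₂ : Tm) : Tm
  | con (P : Poly) (e : Tm) : Tm
  | des (P : Poly) (e : Tm) : Tm
  | fold (P : Poly) (e₀ e₁ : Tm) : Tm
  | conS (P : Poly) (e : Tm) : Tm
  | desS (P : Poly) (e : Tm) : Tm
  | toSafe (e : Tm) : Tm
  | toNorm (e : Tm) : Tm
  | cs (P : Poly) (e : Tm) : Tm

/-- `e.FV i` : the variable with index `i` is free in `e`. -/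
def Tm.FV : Tm → ℕ → Prop
  | .var i, k => i = k
  | .lam e, k => e.FV (k + 1)
  | .app e₀ e₁, k => e₀.FV k ∨ e₁.FV k
  | .unit, _ => False
  | .pair e₁ e₂, k => e₁.FV k ∨ e₂.FV k
  | .fst e, k => e.FV k
  | .snd e, k => e.FV k
  | .inl e, k => e.FV k
  | .inr e, k => e.FV k
  | .case e₀ e₁ e₂, k => e₀.FV k ∨ e₁.FV (k + 1) ∨ e₂.FV (k + 1)
  | .con _ e, k => e.FV k
  | .des _ e, k => e.FV k
  | .fold _ e₀ e₁, k => e₀.FV k ∨ e₁.FV k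
  | .conS _ e, k => e.FV k
  | .desS _ e, k => e.FV k
  | .toSafe e, k => e.FV k
  | .toNorm e, k => e.FV k
  | .cs _ e, k => e.FV k

/-! ### Typing -/

/-- The typing judgments `Γ ⊢ e : τ` of `S₁⁻`. The `Ok` premises exclude empty data types. -/
inductive STyping : List SGround → Tm → Ty Base → Prop
  | var {Γ i γ} : Γ[i]? = some γ → STyping Γ (.var i) (.ground γ)
  | lam {Γ e γ₁ γ₀} : SGround.Ok γ₁ → STyping (γ₁ :: Γ) e (.ground γ₀) → STyping Γ (.lam e) (.arr γ₁ γ₀)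
  | app {Γ e₀ e₁ γ₁ γ₀} : STyping Γ e₀ (.arr γ₁ γ₀) → STyping Γ e₁ (.ground γ₁) →
      STyping Γ (.app e₀ e₁) (.ground γ₀)
  | unit {Γ} : STyping Γ .unit (.ground (.base .unit))
  | pair {Γ e₁ e₂ γ₁ γ₂} : STyping Γ e₁ (.ground γ₁) → STyping Γ e₂ (.ground γ₂) →
      STyping Γ (.pair e₁ e₂) (.ground (.prod γ₁ γ₂))
  | fst {Γ e γ₁ γ₂} : STyping Γ e (.ground (.prod γ₁ γ₂)) → STyping Γ (.fst e) (.ground γ₁)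
  | snd {Γ e γ₁ γ₂} : STyping Γ e (.ground (.prod γ₁ γ₂)) → STyping Γ (.snd e) (.ground γ₂)
  | inl {Γ e γ₁ γ₂} : SGround.Ok γ₂ → STyping Γ e (.ground γ₁) →
      STyping Γ (.inl e) (.ground (.sum γ₁ γ₂))
  | inr {Γ e γ₁ γ₂} : SGround.Ok γ₁ → STyping Γ e (.ground γ₂) →
      STyping Γ (.inr e) (.ground (.sum γ₁ γ₂))
  | case {Γ e₀ e₁ e₂ γ₁ γ₂ γ} : STyping Γ e₀ (.ground (.sum γ₁ γ₂)) →
      STyping (γ₁ :: Γ) e₁ (.ground γ) → STyping (γ₂ :: Γ) e₂ (.ground γ) →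
      STyping Γ (.case e₀ e₁ e₂) (.ground γ)
  | con {Γ P e} : SGround.Ok (sMu P) → STyping Γ e (.ground (P.sApp (sMu P))) →
      STyping Γ (.con P e) (.ground (sMu P))
  | des {Γ P e} : STyping Γ e (.ground (sMu P)) →
      STyping Γ (.des P e) (.ground (P.sApp (sMu P)))
  | fold {Γ P e₀ e₁ γ} : STyping Γ (.lam e₀) (.arr (P.sApp γ) γ) →
      STyping Γ e₁ (.ground (sMu P)) → STyping Γ (.fold P (.lam e₀) e₁) (.ground γ)

/-- The typing judgments `Γ ⊢ e : τ` of `RS₁.₁⁻`, that is, of the normal/safe calculus `RS₁⁻`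
together with the compressed-size primitives `cs`. -/
inductive RTyping : List RGround → Tm → Ty RBase → Prop
  | var {Γ i γ} : Γ[i]? = some γ → RTyping Γ (.var i) (.ground γ)
  | lam {Γ e γ₁ γ₀} : RGround.Ok γ₁ → RTyping (γ₁ :: Γ) e (.ground γ₀) → RTyping Γ (.lam e) (.arr γ₁ γ₀)
  | app {Γ e₀ e₁ γ₁ γ₀} : RTyping Γ e₀ (.arr γ₁ γ₀) → RTyping Γ e₁ (.ground γ₁) →
      RTyping Γ (.app e₀ e₁) (.ground γ₀)
  | unit {Γ} : RTyping Γ .unit (.ground (.base (.norm .unit)))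
  | pair {Γ e₁ e₂ γ₁ γ₂} : RTyping Γ e₁ (.ground γ₁) → RTyping Γ e₂ (.ground γ₂) →
      RTyping Γ (.pair e₁ e₂) (.ground (.prod γ₁ γ₂))
  | fst {Γ e γ₁ γ₂} : RTyping Γ e (.ground (.prod γ₁ γ₂)) → RTyping Γ (.fst e) (.ground γ₁)
  | snd {Γ e γ₁ γ₂} : RTyping Γ e (.ground (.prod γ₁ γ₂)) → RTyping Γ (.snd e) (.ground γ₂)
  | inl {Γ e γ₁ γ₂} : RGround.Ok γ₂ → RTyping Γ e (.ground γ₁) →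
      RTyping Γ (.inl e) (.ground (.sum γ₁ γ₂))
  | inr {Γ e γ₁ γ₂} : RGround.Ok γ₁ → RTyping Γ e (.ground γ₂) →
      RTyping Γ (.inr e) (.ground (.sum γ₁ γ₂))
  | case {Γ e₀ e₁ e₂ γ₁ γ₂ γ} : RGround.IsNormal (.sum γ₁ γ₂) ∨ RGround.IsSafe γ →
      RTyping Γ e₀ (.ground (.sum γ₁ γ₂)) →
      RTyping (γ₁ :: Γ) e₁ (.ground γ) → RTyping (γ₂ :: Γ) e₂ (.ground γ) →
      RTyping Γ (.case e₀ e₁ e₂) (.ground γ)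
  | con {Γ P e} : RGround.Ok (rMu P) → RTyping Γ e (.ground (P.rApp (rMu P))) →
      RTyping Γ (.con P e) (.ground (rMu P))
  | des {Γ P e} : RTyping Γ e (.ground (rMu P)) →
      RTyping Γ (.des P e) (.ground (P.rApp (rMu P)))
  | conS {Γ P e} : RGround.Ok (rMu P) → RTyping Γ e (.ground (P.rApp (rMu P)).toSafe) →
      RTyping Γ (.conS P e) (.ground (rMu P).toSafe)
  | desS {Γ P e} : RTyping Γ e (.ground (rMu P).toSafe) →
      RTyping Γ (.desS P e) (.ground (P.rApp (rMu P)).toSafe)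
  | fold {Γ P e₀ e₁} {γ : RGround} :
      RTyping Γ (.lam e₀) (.arr (P.rApp γ.toSafe) γ.toSafe) →
      RTyping Γ e₁ (.ground (rMu P)) → RTyping Γ (.fold P (.lam e₀) e₁) (.ground γ.toSafe)
  | toSafe {Γ e} {γ : RGround} : RTyping Γ e (.ground γ) →
      RTyping Γ (.toSafe e) (.ground γ.toSafe)
  | toNorm {Γ e} {γ : RGround} : (∀ i γ', e.FV i → Γ[i]? = some γ' → RGround.IsNormal γ') →
      RTyping Γ e (.ground γ) → RTyping Γ (.toNorm e) (.ground γ.toNorm)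
  | cs {Γ P e} : RTyping Γ e (.ground (rMu P)) → RTyping Γ (.cs P e) (.ground (rMu natP))

/-! ### Value term graphs -/

/-- A labelled vertex with the addresses of its successors; `con P` is labelled by `μP`. -/
inductive Node : Type
  | unit : Node
  | pair (a b : ℕ) : Node
  | inl (a : ℕ) : Node
  | inr (a : ℕ) : Node
  | con (P : Poly) (a : ℕ) : Node

/-- A finite set of vertices; the vertices are the list positions. A pair of a heap and an
address is a rooted graph, made of what is reachable from the address. -/
abbrev Heap : Type := List Node

/-- The graph with root `a` in `H` is a value of type `γ`. Derivations being finite,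
such a graph is acyclic. -/
inductive HasType (H : Heap) : ℕ → SGround → Prop
  | unit {a} : H[a]? = some .unit → HasType H a (.base .unit)
  | pair {a b c γ₁ γ₂} : H[a]? = some (.pair b c) → HasType H b γ₁ → HasType H c γ₂ →
      HasType H a (.prod γ₁ γ₂)
  | inl {a b γ₁ γ₂} : H[a]? = some (.inl b) → HasType H b γ₁ → HasType H a (.sum γ₁ γ₂)
  | inr {a b γ₁ γ₂} : H[a]? = some (.inr b) → HasType H b γ₂ → HasType H a (.sum γ₁ γ₂)
  | con {a b P} : H[a]? = some (.con P b) → HasType H b (P.sApp (sMu P)) → HasType H a (sMu P)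

/-- Bisimilarity of two values. -/
inductive Bisim (H H' : Heap) : ℕ → ℕ → Prop
  | unit {a a'} : H[a]? = some .unit → H'[a']? = some .unit → Bisim H H' a a'
  | pair {a a' b b' c c'} : H[a]? = some (.pair b c) → H'[a']? = some (.pair b' c') →
      Bisim H H' b b' → Bisim H H' c c' → Bisim H H' a a'
  | inl {a a' b b'} : H[a]? = some (.inl b) → H'[a']? = some (.inl b') →
      Bisim H H' b b' → Bisim H H' a a'
  | inr {a a' b b'} : H[a]? = some (.inr b) → H'[a']? = some (.inr b') →
      Bisim H H' b b' → Bisim H H' a a'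
  | con {a a' P b b'} : H[a]? = some (.con P b) → H'[a']? = some (.con P b') →
      Bisim H H' b b' → Bisim H H' a a'

/-- `Reach H a b` : the vertex `b` belongs to the graph with root `a`. -/
inductive Reach (H : Heap) : ℕ → ℕ → Prop
  | refl (a) : Reach H a a
  | fst {a b c d} : H[a]? = some (.pair b c) → Reach H b d → Reach H a d
  | snd {a b c d} : H[a]? = some (.pair b c) → Reach H c d → Reach H a d
  | inl {a b d} : H[a]? = some (.inl b) → Reach H b d → Reach H a d
  | inr {a b d} : H[a]? = some (.inr b) → Reach H b d → Reach H a d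
  | con {a P b d} : H[a]? = some (.con P b) → Reach H b d → Reach H a d

/-- The number of data-type constructor vertices of the graph with root `a`. -/
noncomputable def size (H : Heap) (a : ℕ) : ℕ :=
  Set.ncard {b : ℕ | Reach H a b ∧ ∃ P c, H[b]? = some (.con P c)}

/-- The compressed size: the least size of a bisimilar value. -/
noncomputable def compressedSize (H : Heap) (a : ℕ) : ℕ :=
  sInf {k : ℕ | ∃ (H' : Heap) (a' : ℕ), Bisim H H' a a' ∧ size H' a' = k}

/-- Add the graph of the `nat`-value `m` to the heap; returns the new heap and its root. -/
def addNat (H : Heap) : ℕ → Heap × ℕ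
  | 0 => (H ++ [.unit, .inl H.length, .con natP (H.length + 1)], H.length + 2)
  | m + 1 =>
    let r := addNat H m
    (r.1 ++ [.inr r.2, .con natP r.1.length], r.1.length + 1)

/-! ### Dynamic-programming evaluation, and its cost -/

/-- Environments: the addresses of the values of the variables. -/
abbrev Env : Type := List ℕ

/-- Memo table of one evaluation of a fold: vertices to the addresses of the results there. -/
abbrev Memo : Type := ℕ → Option ℕ

mutual
/-- `Eval H θ e H' a n` : in the heap `H`, the closure `eθ` evaluates to the value with root `a`
in the extended heap `H'`, by a derivation with `n` nodes. -/
inductive Eval : Heap → Env → Tm → Heap → ℕ → ℕ → Prop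
  | var {H θ i a} : θ[i]? = some a → Eval H θ (.var i) H a 1
  | app {H θ e₀ e₁ H₁ a₁ n₁ H₂ a n₂} :
      Eval H θ e₁ H₁ a₁ n₁ → Eval H₁ (a₁ :: θ) e₀ H₂ a n₂ →
      Eval H θ (.app (.lam e₀) e₁) H₂ a (n₁ + n₂ + 1)
  | unit {H θ} : Eval H θ .unit (H ++ [.unit]) H.length 1
  | pair {H θ e₁ e₂ H₁ a₁ n₁ H₂ a₂ n₂} :
      Eval H θ e₁ H₁ a₁ n₁ → Eval H₁ θ e₂ H₂ a₂ n₂ →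
      Eval H θ (.pair e₁ e₂) (H₂ ++ [.pair a₁ a₂]) H₂.length (n₁ + n₂ + 1)
  | fst {H θ e H₁ a n b c} : Eval H θ e H₁ a n → H₁[a]? = some (.pair b c) →
      Eval H θ (.fst e) H₁ b (n + 1)
  | snd {H θ e H₁ a n b c} : Eval H θ e H₁ a n → H₁[a]? = some (.pair b c) →
      Eval H θ (.snd e) H₁ c (n + 1)
  | inl {H θ e H₁ a n} : Eval H θ e H₁ a n →
      Eval H θ (.inl e) (H₁ ++ [.inl a]) H₁.length (n + 1)
  | inr {H θ e H₁ a n} : Eval H θ e H₁ a n →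
      Eval H θ (.inr e) (H₁ ++ [.inr a]) H₁.length (n + 1)
  | caseL {H θ e₀ e₁ e₂ H₁ a n₁ b H₂ v n₂} :
      Eval H θ e₀ H₁ a n₁ → H₁[a]? = some (.inl b) → Eval H₁ (b :: θ) e₁ H₂ v n₂ →
      Eval H θ (.case e₀ e₁ e₂) H₂ v (n₁ + n₂ + 1)
  | caseR {H θ e₀ e₁ e₂ H₁ a n₁ b H₂ v n₂} :
      Eval H θ e₀ H₁ a n₁ → H₁[a]? = some (.inr b) → Eval H₁ (b :: θ) e₂ H₂ v n₂ →
      Eval H θ (.case e₀ e₁ e₂) H₂ v (n₁ + n₂ + 1)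
  | con {H θ P e H₁ a n} : Eval H θ e H₁ a n →
      Eval H θ (.con P e) (H₁ ++ [.con P a]) H₁.length (n + 1)
  | des {H θ P e H₁ a n b} : Eval H θ e H₁ a n → H₁[a]? = some (.con P b) →
      Eval H θ (.des P e) H₁ b (n + 1)
  | fold {H θ P e₀ e₁ H₁ u n₁ H₂ M r n₂} :
      Eval H θ e₁ H₁ u n₁ → FoldAt P e₀ θ H₁ (fun _ => none) u H₂ M r n₂ →
      Eval H θ (.fold P (.lam e₀) e₁) H₂ r (n₁ + n₂ + 1)
  | conS {H θ P e H₁ a n} : Eval H θ e H₁ a n →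
      Eval H θ (.conS P e) (H₁ ++ [.con P a]) H₁.length (n + 1)
  | desS {H θ P e H₁ a n b} : Eval H θ e H₁ a n → H₁[a]? = some (.con P b) →
      Eval H θ (.desS P e) H₁ b (n + 1)
  | toSafe {H θ e H₁ a n} : Eval H θ e H₁ a n → Eval H θ (.toSafe e) H₁ a (n + 1)
  | toNorm {H θ e H₁ a n} : Eval H θ e H₁ a n → Eval H θ (.toNorm e) H₁ a (n + 1)
  | cs {H θ P e H₁ a n} : Eval H θ e H₁ a n →
      Eval H θ (.cs P e) (addNat H₁ (compressedSize H₁ a)).1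
        (addNat H₁ (compressedSize H₁ a)).2 (n + 1)

/-- `FoldAt P e₀ θ H M u H' M' r n` : with memo table `M`, the fold over `μP` with step function
`λx.e₀` has the result `r` at the vertex `u`. If `M` has an entry for `u`, it is looked up;
otherwise the results at the recursive successors of `u` are determined first,
the step function is applied, and the result is saved. -/
inductive FoldAt : Poly → Tm → Env → Heap → Memo → ℕ → Heap → Memo → ℕ → ℕ → Prop
  | lookup {P e₀ θ H M u r} : M u = some r → FoldAt P e₀ θ H M u H M r 1
  | step {P e₀ θ H M u c H₁ M₁ c' n₁ H₂ r n₂} :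
      M u = none → H[u]? = some (.con P c) →
      MapAt P P e₀ θ H M c H₁ M₁ c' n₁ → Eval H₁ (c' :: θ) e₀ H₂ r n₂ →
      FoldAt P e₀ θ H M u H₂ (Function.update M₁ u (some r)) r (n₁ + n₂ + 1)

/-- `MapAt Q P e₀ θ H M c H' M' c' n` : applying `Q (fold_{μP} (λx.e₀))` to the value `c`
yields the value `c'`. -/
inductive MapAt : Poly → Poly → Tm → Env → Heap → Memo → ℕ → Heap → Memo → ℕ → ℕ → Prop
  | id {P e₀ θ H M c H' M' r n} : FoldAt P e₀ θ H M c H' M' r n →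
      MapAt .id P e₀ θ H M c H' M' r (n + 1)
  | const {N P e₀ θ H M c} : MapAt (.const N) P e₀ θ H M c H M c 1
  | inl {Q₁ Q₂ P e₀ θ H M c d H' M' d' n} : H[c]? = some (.inl d) →
      MapAt Q₁ P e₀ θ H M d H' M' d' n →
      MapAt (.sum Q₁ Q₂) P e₀ θ H M c (H' ++ [.inl d']) M' H'.length (n + 1)
  | inr {Q₁ Q₂ P e₀ θ H M c d H' M' d' n} : H[c]? = some (.inr d) →
      MapAt Q₂ P e₀ θ H M d H' M' d' n →
      MapAt (.sum Q₁ Q₂) P e₀ θ H M c (H' ++ [.inr d']) M' H'.length (n + 1)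
  | pair {Q₁ Q₂ P e₀ θ H M c d₁ d₂ H₁ M₁ d₁' n₁ H₂ M₂ d₂' n₂} :
      H[c]? = some (.pair d₁ d₂) →
      MapAt Q₁ P e₀ θ H M d₁ H₁ M₁ d₁' n₁ → MapAt Q₂ P e₀ θ H₁ M₁ d₂ H₂ M₂ d₂' n₂ →
      MapAt (.prod Q₁ Q₂) P e₀ θ H M c (H₂ ++ [.pair d₁' d₂']) M₂ H₂.length (n₁ + n₂ + 1)
end

/-- The closed function `f` with argument type `γ₁` is DP-polynomial-cost. -/
def DPPolyCost (γ₁ : SGround) (f : Tm) : Prop :=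
  ∃ q : Polynomial ℕ, ∀ (H : Heap) (a : ℕ), HasType H a γ₁ →
    ∃ (H' : Heap) (v n : ℕ), Eval H [a] (.app f (.var 0)) H' v n ∧ n ≤ q.eval (size H a)

/-- The closed `S₁⁻` function `f : γ₁ → γ₀` is computed by some closed `RS₁.₁⁻` function of the
same type: on each value of type `γ₁` the two have bisimilar values. -/
def RS11Computable (γ₁ γ₀ : SGround) (f : Tm) : Prop :=
  ∃ f' : Tm, RTyping [] f' (.arr γ₁.toR γ₀.toR) ∧
    ∀ (H : Heap) (a : ℕ), HasType H a γ₁ →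
      ∃ (H₁ : Heap) (v₁ n₁ : ℕ) (H₂ : Heap) (v₂ n₂ : ℕ),
        Eval H [a] (.app f (.var 0)) H₁ v₁ n₁ ∧
        Eval H [a] (.app f' (.var 0)) H₂ v₂ n₂ ∧ Bisim H₁ H₂ v₁ v₂

end StructRec

-- The ramified calculus can run an interpreter for the dynamic-programming evaluation of `f`. The
-- argument is encoded by a fold as a binary tree `d : Cell`, and `toNorm` makes `d` normal. From
-- then on one works with functions `f d s` of the normal `d` and one safe state `s` (`SDef`). They
-- are closed under composition, case distinction and recursion over `d`. Since `cs d` is a normal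
-- numeral, a definable state transformer can be iterated as many times as any polynomial in the
-- compressed size of `d` prescribes (`Clock.csize`, `Clock.eval`). Such iteration is enough to run
-- a machine with a time bound.
--
-- The cost of dynamic programming is measured on graphs, while a recursion over `d` only sees a
-- tree, so sharing has to be rebuilt inside the calculus. Hash-consing (`table_spec`) numbers the
-- distinct nonempty subtrees of `d` and attaches the numbers to `d`. The numbers are the addresses
-- of a heap `heapOf S` that represents the argument and has at most as many vertices as `d` has
-- distinct subtrees. By `Cell.card_subs_le_csize` this number is at most the compressed size `k` of
-- `d`. The cost hypothesis, applied to this heap, gives a derivation with at most `q(k)` nodes.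
--
-- A stack machine whose values carry identifiers follows this derivation (`Eval.steps`).
-- Identifiers are addresses, the counter of the machine is the length of the heap, and memo tables
-- are association lists keyed by identifiers. Each derivation node costs a bounded number of steps,
-- so a clock linear in `k` and `q(k)` suffices. The final value is a tree with identifiers; a last
-- fold reads it back, at all component types of `γ₀` at once (`readRes_spec`).
--
-- Graphs are related to terms through the trees they unfold to: evaluation is sound for a
-- denotation on trees (`Eval.sound`), ramified terms terminate (`RTyping.tyTerminates`), and
-- bisimilarity amounts to equality of trees. Correctness of `f'` thus becomes an equation between
-- denotations.

namespace StructRec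

/-! ### Trees: values up to bisimilarity -/

/-- The tree to which a value unfolds. -/
inductive Tree : Type
  | unit : Tree
  | pair (a b : Tree) : Tree
  | inl (a : Tree) : Tree
  | inr (a : Tree) : Tree
  | con (P : Poly) (a : Tree) : Tree

/-- The graph with root `a` in `H` unfolds to the tree `t`. -/
inductive Rep (H : Heap) : ℕ → Tree → Prop
  | unit {a} : H[a]? = some .unit → Rep H a .unit
  | pair {a b c t u} : H[a]? = some (.pair b c) → Rep H b t → Rep H c u → Rep H a (.pair t u)
  | inl {a b t} : H[a]? = some (.inl b) → Rep H b t → Rep H a (.inl t)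
  | inr {a b t} : H[a]? = some (.inr b) → Rep H b t → Rep H a (.inr t)
  | con {a P b t} : H[a]? = some (.con P b) → Rep H b t → Rep H a (.con P t)

/-- Well-typed trees. -/
inductive TreeTy : Tree → SGround → Prop
  | unit : TreeTy .unit (.base .unit)
  | pair {t u γ₁ γ₂} : TreeTy t γ₁ → TreeTy u γ₂ → TreeTy (.pair t u) (.prod γ₁ γ₂)
  | inl {t γ₁ γ₂} : TreeTy t γ₁ → TreeTy (.inl t) (.sum γ₁ γ₂)
  | inr {t γ₁ γ₂} : TreeTy t γ₂ → TreeTy (.inr t) (.sum γ₁ γ₂)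
  | con {t P} : TreeTy t (P.app (fun N => N) (.base (.mu P))) → TreeTy (.con P t) (.base (.mu P))

theorem getElem?_of_prefix {H H' : Heap} (h : H <+: H') {a : ℕ} {x : Node}
    (hx : H[a]? = some x) : H'[a]? = some x := by
  obtain ⟨l, rfl⟩ := h
  rw [List.getElem?_append_left (List.getElem?_eq_some_iff.1 hx).1, hx]

theorem Rep.mono {H H' : Heap} (h : H <+: H') {a t} (r : Rep H a t) : Rep H' a t := by
  induction r with
  | unit e => exact .unit (getElem?_of_prefix h e)
  | pair e _ _ i j => exact .pair (getElem?_of_prefix h e) i j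
  | inl e _ i => exact .inl (getElem?_of_prefix h e) i
  | inr e _ i => exact .inr (getElem?_of_prefix h e) i
  | con e _ i => exact .con (getElem?_of_prefix h e) i

theorem Rep.unit_inv {H : Heap} {a t} (e : H[a]? = some .unit) (r : Rep H a t) : t = .unit := by
  cases r <;> simp_all

theorem Rep.pair_inv {H : Heap} {a b c t} (e : H[a]? = some (.pair b c)) (r : Rep H a t) :
    ∃ t₁ t₂, t = .pair t₁ t₂ ∧ Rep H b t₁ ∧ Rep H c t₂ := by
  cases r <;> simp_all

theorem Rep.inl_inv {H : Heap} {a b t} (e : H[a]? = some (.inl b)) (r : Rep H a t) :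
    ∃ t₁, t = .inl t₁ ∧ Rep H b t₁ := by
  cases r <;> simp_all

theorem Rep.inr_inv {H : Heap} {a b t} (e : H[a]? = some (.inr b)) (r : Rep H a t) :
    ∃ t₁, t = .inr t₁ ∧ Rep H b t₁ := by
  cases r <;> simp_all

theorem Rep.con_inv {H : Heap} {a P b t} (e : H[a]? = some (.con P b)) (r : Rep H a t) :
    ∃ t₁, t = .con P t₁ ∧ Rep H b t₁ := by
  cases r <;> simp_all

theorem Rep.unique {H : Heap} {a t u} (r : Rep H a t) (s : Rep H a u) : t = u := by
  induction r generalizing u with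
  | unit e => exact (s.unit_inv e).symm
  | pair e _ _ i j =>
    obtain ⟨_, _, rfl, h₁, h₂⟩ := s.pair_inv e
    rw [i h₁, j h₂]
  | inl e _ i => obtain ⟨_, rfl, h⟩ := s.inl_inv e; rw [i h]
  | inr e _ i => obtain ⟨_, rfl, h⟩ := s.inr_inv e; rw [i h]
  | con e _ i => obtain ⟨_, rfl, h⟩ := s.con_inv e; rw [i h]

/-- With its converse `rep_of_bisim`, this reduces comparing two evaluations to comparing the trees
they represent. -/
theorem bisim_of_rep {H H' : Heap} {a a' t} (r : Rep H a t) (s : Rep H' a' t) :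
    Bisim H H' a a' := by
  induction r generalizing a' with
  | unit e => cases s with | unit e' => exact .unit e e'
  | pair e _ _ i j => cases s with | pair e' s₁ s₂ => exact .pair e e' (i s₁) (j s₂)
  | inl e _ i => cases s with | inl e' s => exact .inl e e' (i s)
  | inr e _ i => cases s with | inr e' s => exact .inr e e' (i s)
  | con e _ i => cases s with | con e' s => exact .con e e' (i s)

theorem rep_of_bisim {H H' : Heap} {a a' t} (b : Bisim H H' a a') (r : Rep H a t) :
    Rep H' a' t := by
  induction b generalizing t with
  | unit e e' => cases r.unit_inv e; exact .unit e'
  | pair e e' _ _ i j => obtain ⟨_, _, rfl, h₁, h₂⟩ := r.pair_inv e; exact .pair e' (i h₁) (j h₂)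
  | inl e e' _ i => obtain ⟨_, rfl, h⟩ := r.inl_inv e; exact .inl e' (i h)
  | inr e e' _ i => obtain ⟨_, rfl, h⟩ := r.inr_inv e; exact .inr e' (i h)
  | con e e' _ i => obtain ⟨_, rfl, h⟩ := r.con_inv e; exact .con e' (i h)

theorem HasType.exists_rep {H : Heap} {a γ} (h : HasType H a γ) :
    ∃ t, Rep H a t ∧ TreeTy t γ := by
  induction h with
  | unit e => exact ⟨_, .unit e, .unit⟩
  | pair e _ _ i j =>
    obtain ⟨t, ht, ht'⟩ := i
    obtain ⟨u, hu, hu'⟩ := j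
    exact ⟨_, .pair e ht hu, .pair ht' hu'⟩
  | inl e _ i => obtain ⟨t, ht, ht'⟩ := i; exact ⟨_, .inl e ht, .inl ht'⟩
  | inr e _ i => obtain ⟨t, ht, ht'⟩ := i; exact ⟨_, .inr e ht, .inr ht'⟩
  | con e _ i => obtain ⟨t, ht, ht'⟩ := i; exact ⟨_, .con e ht, .con ht'⟩

theorem Rep.hasType {H : Heap} {a t γ} (r : Rep H a t) (h : TreeTy t γ) : HasType H a γ := by
  induction h generalizing a with
  | unit => cases r with | unit e => exact .unit e
  | pair _ _ i j => cases r with | pair e r₁ r₂ => exact .pair e (i r₁) (j r₂)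
  | inl _ i => cases r with | inl e r => exact .inl e (i r)
  | inr _ i => cases r with | inr e r => exact .inr e (i r)
  | con _ i => cases r with | con e r => exact .con e (i r)

/-- The compressed size of the values unfolding to `t`. -/
noncomputable def Tree.csize (t : Tree) : ℕ :=
  sInf {k : ℕ | ∃ (H : Heap) (a : ℕ), Rep H a t ∧ size H a = k}

/-- Bisimilar graphs are those with the same unfolding, so the compressed size is a function of the
tree. This is what gives the primitive `cs` a denotation. -/
theorem Rep.compressedSize_eq {H : Heap} {a t} (r : Rep H a t) :
    compressedSize H a = t.csize := by
  unfold compressedSize Tree.csize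
  congr 1
  ext k
  constructor
  · rintro ⟨H', a', b, h⟩; exact ⟨H', a', rep_of_bisim b r, h⟩
  · rintro ⟨H', a', b, h⟩; exact ⟨H', a', bisim_of_rep r b, h⟩

/-- The tree of a numeral. -/
def Tree.nat : ℕ → Tree
  | 0 => .con natP (.inl .unit)
  | n + 1 => .con natP (.inr (Tree.nat n))

theorem addNat_spec (H : Heap) (m : ℕ) :
    H <+: (addNat H m).1 ∧ Rep (addNat H m).1 (addNat H m).2 (Tree.nat m) := by
  induction m with
  | zero =>
    refine ⟨⟨_, rfl⟩, ?_⟩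
    simp only [addNat, Tree.nat]
    refine .con (b := H.length + 1) ?_ (.inl (b := H.length) ?_ (.unit ?_)) <;>
      simp
  | succ m ih =>
    obtain ⟨h, r⟩ := ih
    have hp : (addNat H m).1 <+: (addNat H (m + 1)).1 := ⟨_, rfl⟩
    refine ⟨h.trans hp, ?_⟩
    simp only [Tree.nat]
    refine .con (b := (addNat H m).1.length) ?_ (.inr (b := (addNat H m).2) ?_ (r.mono hp)) <;>
      simp [addNat]

/-! ### Denotations -/

/-- The tree `Q (fold_{μP} g) t`. -/
def Tree.mapFold (P : Poly) (g : Tree → Tree) : Tree → Poly → Tree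
  | .con _ c, .id => g (mapFold P g c P)
  | t, .const _ => t
  | .inl d, .sum Q₁ _ => .inl (mapFold P g d Q₁)
  | .inr d, .sum _ Q₂ => .inr (mapFold P g d Q₂)
  | .pair a b, .prod Q₁ Q₂ => .pair (mapFold P g a Q₁) (mapFold P g b Q₂)
  | _, _ => .unit

def Tree.fst : Tree → Tree
  | .pair a _ => a
  | _ => .unit

def Tree.snd : Tree → Tree
  | .pair _ b => b
  | _ => .unit

def Tree.des : Tree → Tree
  | .con _ a => a
  | _ => .unit

def Tree.cases (f g : Tree → Tree) : Tree → Tree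
  | .inl a => f a
  | .inr a => g a
  | _ => .unit

/-- The denotation of a term; that of `lam e` takes its argument at the head of the environment. -/
noncomputable def Tm.den : Tm → List Tree → Tree
  | .var i, ρ => ρ.getD i .unit
  | .lam e, ρ => e.den ρ
  | .app e₀ e₁, ρ => e₀.den (e₁.den ρ :: ρ)
  | .unit, _ => .unit
  | .pair e₁ e₂, ρ => .pair (e₁.den ρ) (e₂.den ρ)
  | .fst e, ρ => (e.den ρ).fst
  | .snd e, ρ => (e.den ρ).snd
  | .inl e, ρ => .inl (e.den ρ)
  | .inr e, ρ => .inr (e.den ρ)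
  | .case e₀ e₁ e₂, ρ => (e₀.den ρ).cases (fun t => e₁.den (t :: ρ)) (fun t => e₂.den (t :: ρ))
  | .con P e, ρ => .con P (e.den ρ)
  | .des _ e, ρ => (e.den ρ).des
  | .fold P e₀ e₁, ρ => (e₁.den ρ).mapFold P (fun t => e₀.den (t :: ρ)) .id
  | .conS P e, ρ => .con P (e.den ρ)
  | .desS _ e, ρ => (e.den ρ).des
  | .toSafe e, ρ => e.den ρ
  | .toNorm e, ρ => e.den ρ
  | .cs _ e, ρ => Tree.nat (e.den ρ).csize

/-- The environments `θ` in `H` and `ρ` correspond. -/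
abbrev EnvRep (H : Heap) (θ : Env) (ρ : List Tree) : Prop := List.Forall₂ (Rep H) θ ρ

theorem EnvRep.mono {H H' : Heap} (h : H <+: H') {θ ρ} (r : EnvRep H θ ρ) : EnvRep H' θ ρ :=
  List.Forall₂.imp (fun _ _ => Rep.mono h) r

theorem EnvRep.get {H : Heap} {θ : Env} {ρ : List Tree} (r : EnvRep H θ ρ) {i a}
    (h : θ[i]? = some a) : Rep H a (ρ.getD i .unit) := by
  induction r generalizing i with
  | nil => simp at h
  | cons hr _ ih =>
    cases i with
    | zero => simp at h; subst h; simpa using hr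
    | succ i => simp at h; simpa using ih h

/-- The entries of the memo table are results of the fold. -/
def MemoOk (P : Poly) (g : Tree → Tree) (H : Heap) (M : Memo) : Prop :=
  ∀ u r, M u = some r → ∃ t, Rep H u t ∧ Rep H r (t.mapFold P g .id)

theorem MemoOk.mono {P g H H'} {M : Memo} (h : H <+: H') (m : MemoOk P g H M) : MemoOk P g H' M :=
  fun u r e => let ⟨t, h₁, h₂⟩ := m u r e; ⟨t, h₁.mono h, h₂.mono h⟩

theorem rep_append_pair {H H' : Heap} {a b t u} (h : Rep H a t) (h' : Rep H b u) (hp : H <+: H') :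
    Rep (H' ++ [.pair a b]) H'.length (.pair t u) :=
  .pair (by simp) (h.mono (hp.trans (List.prefix_append _ _)))
    (h'.mono (hp.trans (List.prefix_append _ _)))

mutual
-- Heaps are only ever extended, so what an address represents never changes. Memo entries stay
-- correct for the same reason, and a look-up returns what recomputation would, because a vertex
-- unfolds to a single tree.
theorem Eval.sound {H θ e H' a n} : Eval H θ e H' a n → ∀ {ρ}, EnvRep H θ ρ →
    H <+: H' ∧ Rep H' a (e.den ρ)
  | .var h, ρ, hρ => ⟨List.prefix_rfl, hρ.get h⟩
  | .app h₁ h₀, ρ, hρ => by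
    obtain ⟨p₁, r₁⟩ := h₁.sound hρ
    obtain ⟨p₀, r₀⟩ := h₀.sound (.cons r₁ (hρ.mono p₁))
    exact ⟨p₁.trans p₀, r₀⟩
  | .unit, ρ, hρ => ⟨List.prefix_append _ _, .unit (by simp)⟩
  | .pair h₁ h₂, ρ, hρ => by
    obtain ⟨p₁, r₁⟩ := h₁.sound hρ
    obtain ⟨p₂, r₂⟩ := h₂.sound (hρ.mono p₁)
    exact ⟨(p₁.trans p₂).trans (List.prefix_append _ _),
      rep_append_pair (r₁.mono p₂) r₂ List.prefix_rfl⟩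
  | .fst h e, ρ, hρ => by
    obtain ⟨p, r⟩ := h.sound hρ
    refine ⟨p, ?_⟩
    simp only [Tm.den]
    generalize Tm.den _ ρ = t at r
    cases r <;> simp_all [Tree.fst]
  | .snd h e, ρ, hρ => by
    obtain ⟨p, r⟩ := h.sound hρ
    refine ⟨p, ?_⟩
    simp only [Tm.den]
    generalize Tm.den _ ρ = t at r
    cases r <;> simp_all [Tree.snd]
  | .inl h, ρ, hρ => by
    obtain ⟨p, r⟩ := h.sound hρ
    exact ⟨p.trans (List.prefix_append _ _), .inl (by simp) (r.mono (List.prefix_append _ _))⟩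
  | .inr h, ρ, hρ => by
    obtain ⟨p, r⟩ := h.sound hρ
    exact ⟨p.trans (List.prefix_append _ _), .inr (by simp) (r.mono (List.prefix_append _ _))⟩
  | .caseL h₀ e h₁, ρ, hρ => by
    obtain ⟨p, r⟩ := h₀.sound hρ
    simp only [Tm.den]
    obtain ⟨_, ht, r⟩ := r.inl_inv e
    rw [ht]
    obtain ⟨p₁, r₁⟩ := h₁.sound (.cons r (hρ.mono p))
    exact ⟨p.trans p₁, r₁⟩
  | .caseR h₀ e h₁, ρ, hρ => by
    obtain ⟨p, r⟩ := h₀.sound hρ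
    simp only [Tm.den]
    obtain ⟨_, ht, r⟩ := r.inr_inv e
    rw [ht]
    obtain ⟨p₁, r₁⟩ := h₁.sound (.cons r (hρ.mono p))
    exact ⟨p.trans p₁, r₁⟩
  | .con h, ρ, hρ => by
    obtain ⟨p, r⟩ := h.sound hρ
    exact ⟨p.trans (List.prefix_append _ _), .con (by simp) (r.mono (List.prefix_append _ _))⟩
  | .des h e, ρ, hρ => by
    obtain ⟨p, r⟩ := h.sound hρ
    refine ⟨p, ?_⟩
    simp only [Tm.den]
    generalize Tm.den _ ρ = t at r
    cases r <;> simp_all [Tree.des]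
  | .fold h₁ h₀, ρ, hρ => by
    obtain ⟨p, r⟩ := h₁.sound hρ
    obtain ⟨p₁, -, r₁⟩ := h₀.sound (hρ.mono p) r (fun _ _ h => by simp at h)
    exact ⟨p.trans p₁, r₁⟩
  | .conS h, ρ, hρ => by
    obtain ⟨p, r⟩ := h.sound hρ
    exact ⟨p.trans (List.prefix_append _ _), .con (by simp) (r.mono (List.prefix_append _ _))⟩
  | .desS h e, ρ, hρ => by
    obtain ⟨p, r⟩ := h.sound hρ
    refine ⟨p, ?_⟩
    simp only [Tm.den]
    generalize Tm.den _ ρ = t at r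
    cases r <;> simp_all [Tree.des]
  | .toSafe h, ρ, hρ => h.sound hρ
  | .toNorm h, ρ, hρ => h.sound hρ
  | .cs h, ρ, hρ => by
    obtain ⟨p, r⟩ := h.sound hρ
    obtain ⟨p₁, r₁⟩ := addNat_spec _ (Tm.den _ ρ).csize
    simp only [Tm.den, r.compressedSize_eq]
    exact ⟨p.trans p₁, r₁⟩
theorem FoldAt.sound {P e₀ θ H M u H' M' r n} : FoldAt P e₀ θ H M u H' M' r n →
    ∀ {ρ t}, EnvRep H θ ρ → Rep H u t → MemoOk P (fun t => e₀.den (t :: ρ)) H M →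
    H <+: H' ∧ MemoOk P (fun t => e₀.den (t :: ρ)) H' M' ∧
      Rep H' r (t.mapFold P (fun t => e₀.den (t :: ρ)) .id)
  | .lookup h, ρ, t, hρ, hu, hM => by
    obtain ⟨t', h₁, h₂⟩ := hM _ _ h
    cases hu.unique h₁
    exact ⟨List.prefix_rfl, hM, h₂⟩
  | .step h e h₁ h₂, ρ, t, hρ, hu, hM => by
    cases hu with
    | con e' hc =>
      simp only [e, Option.some.injEq, Node.con.injEq] at e'
      obtain ⟨rfl, rfl⟩ := e'
      obtain ⟨p₁, m₁, r₁⟩ := h₁.sound hρ hc hM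
      obtain ⟨p₂, r₂⟩ := h₂.sound (.cons r₁ (hρ.mono p₁))
      refine ⟨p₁.trans p₂, ?_, by simpa [Tree.mapFold] using r₂⟩
      intro u' r' h'
      by_cases hu' : u' = u
      · subst hu'
        simp only [Function.update_self, Option.some.injEq] at h'
        subst h'
        exact ⟨_, (Rep.con e hc).mono (p₁.trans p₂), by simpa [Tree.mapFold] using r₂⟩
      · rw [Function.update_of_ne hu'] at h'
        exact m₁.mono p₂ _ _ h'
    | _ => simp_all
theorem MapAt.sound {Q P e₀ θ H M c H' M' c' n} : MapAt Q P e₀ θ H M c H' M' c' n →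
    ∀ {ρ t}, EnvRep H θ ρ → Rep H c t → MemoOk P (fun t => e₀.den (t :: ρ)) H M →
    H <+: H' ∧ MemoOk P (fun t => e₀.den (t :: ρ)) H' M' ∧
      Rep H' c' (t.mapFold P (fun t => e₀.den (t :: ρ)) Q)
  | .id h, ρ, t, hρ, hc, hM => h.sound hρ hc hM
  | .const, ρ, t, hρ, hc, hM => by
    refine ⟨List.prefix_rfl, hM, ?_⟩
    cases hc <;> simp only [Tree.mapFold] <;> constructor <;> assumption
  | .inl e h, ρ, t, hρ, hc, hM => by
    cases hc with
    | inl e' hd =>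
      simp only [e, Option.some.injEq, Node.inl.injEq] at e'
      subst e'
      obtain ⟨p, m, r⟩ := h.sound hρ hd hM
      exact ⟨p.trans (List.prefix_append _ _), m.mono (List.prefix_append _ _),
        by simpa only [Tree.mapFold] using .inl (by simp) (r.mono (List.prefix_append _ _))⟩
    | _ => simp_all
  | .inr e h, ρ, t, hρ, hc, hM => by
    cases hc with
    | inr e' hd =>
      simp only [e, Option.some.injEq, Node.inr.injEq] at e'
      subst e'
      obtain ⟨p, m, r⟩ := h.sound hρ hd hM
      exact ⟨p.trans (List.prefix_append _ _), m.mono (List.prefix_append _ _),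
        by simpa only [Tree.mapFold] using .inr (by simp) (r.mono (List.prefix_append _ _))⟩
    | _ => simp_all
  | .pair e h₁ h₂, ρ, t, hρ, hc, hM => by
    cases hc with
    | pair e' hd₁ hd₂ =>
      simp only [e, Option.some.injEq, Node.pair.injEq] at e'
      obtain ⟨rfl, rfl⟩ := e'
      obtain ⟨p₁, m₁, r₁⟩ := h₁.sound hρ hd₁ hM
      obtain ⟨p₂, m₂, r₂⟩ := h₂.sound (hρ.mono p₁) (hd₂.mono p₁) m₁
      refine ⟨(p₁.trans p₂).trans (List.prefix_append _ _), m₂.mono (List.prefix_append _ _), ?_⟩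
      simp only [Tree.mapFold]
      exact rep_append_pair (r₁.mono p₂) r₂ List.prefix_rfl
    | _ => simp_all
end

/-! ### Type preservation and termination -/

/-- The `S₁⁻` type underlying a ramified type. -/
def RGround.under (γ : RGround) : SGround := γ.map RBase.under

@[simp] theorem RGround.under_base (b : RBase) :
    RGround.under (.base b) = .base b.under := rfl
@[simp] theorem RGround.under_sum (γ₁ γ₂ : RGround) :
    RGround.under (.sum γ₁ γ₂) = .sum γ₁.under γ₂.under := rfl
@[simp] theorem RGround.under_prod (γ₁ γ₂ : RGround) :
    RGround.under (.prod γ₁ γ₂) = .prod γ₁.under γ₂.under := rfl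

@[simp] theorem RGround.under_toSafe (γ : RGround) : γ.toSafe.under = γ.under := by
  induction γ <;> simp_all [RGround.toSafe, RGround.under, Ground.map, RBase.under]

@[simp] theorem RGround.under_toNorm (γ : RGround) : γ.toNorm.under = γ.under := by
  induction γ <;> simp_all [RGround.toNorm, RGround.under, Ground.map, RBase.under]

@[simp] theorem SGround.under_toR (γ : SGround) : γ.toR.under = γ := by
  induction γ <;> simp_all [SGround.toR, RGround.under, Ground.map, RBase.under]

@[simp] theorem under_rMu (P : Poly) : (rMu P).under = .base (.mu P) := rfl

@[simp] theorem Poly.under_rApp (P : Poly) (γ : RGround) :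
    (P.rApp γ).under = P.app (fun N => N) γ.under := by
  induction P using Poly.rec (motive_1 := fun _ => True) <;>
    simp_all [Poly.rApp, Poly.app, RBase.under]

abbrev EnvTy (Γ : List RGround) (ρ : List Tree) : Prop :=
  List.Forall₂ (fun γ t => TreeTy t γ.under) Γ ρ

theorem EnvTy.get {Γ ρ} (h : EnvTy Γ ρ) {i : ℕ} {γ} (e : Γ[i]? = some γ) :
    TreeTy (ρ.getD i .unit) γ.under := by
  induction h generalizing i with
  | nil => simp at e
  | cons hr _ ih =>
    cases i with
    | zero => simp at e; subst e; simpa using hr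
    | succ i => simp at e; simpa using ih e

/-- The induction on `t` is for all `Q` at once: `Q` is the part of `P` still to be traversed, and a
constructor met at `Q = Id` starts again with `Q = P`. -/
theorem TreeTy.mapFold {P : Poly} {g : Tree → Tree} {γ : SGround}
    (hg : ∀ t, TreeTy t (P.app (fun N => N) γ) → TreeTy (g t) γ) {t : Tree} :
    ∀ {Q : Poly}, TreeTy t (Q.app (fun N => N) (.base (.mu P))) →
      TreeTy (t.mapFold P g Q) (Q.app (fun N => N) γ) := by
  induction t with
  | unit =>
    intro Q h
    cases Q <;> simp only [Poly.app] at h ⊢ <;> cases h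
    exact .unit
  | pair a b iha ihb =>
    intro Q h
    cases Q <;> simp only [Poly.app] at h ⊢ <;> cases h
    rename_i h₁ h₂
    exact .pair (iha h₁) (ihb h₂)
  | inl a ih =>
    intro Q h
    cases Q <;> simp only [Poly.app] at h ⊢ <;> cases h
    rename_i h
    exact .inl (ih h)
  | inr a ih =>
    intro Q h
    cases Q <;> simp only [Poly.app] at h ⊢ <;> cases h
    rename_i h
    exact .inr (ih h)
  | con P' a ih =>
    intro Q h
    cases Q <;> simp only [Poly.app] at h ⊢
    · cases h
      rename_i h
      exact hg _ (ih h)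
    · cases h
      rename_i h
      exact .con h
    · cases h
    · cases h

theorem TreeTy.natTree (n : ℕ) : TreeTy (Tree.nat n) (.base (.mu natP)) := by
  induction n with
  | zero => exact .con (.inl .unit)
  | succ n ih => exact .con (.inr ih)

/-- Type preservation for denotations. -/
def DenTy (Γ : List RGround) (e : Tm) : Ty RBase → Prop
  | .ground γ => ∀ ρ, EnvTy Γ ρ → TreeTy (e.den ρ) (RGround.under γ)
  | .arr γ₁ γ₀ => ∀ ρ, EnvTy Γ ρ → ∀ t, TreeTy t (RGround.under γ₁) →
      TreeTy (e.den (t :: ρ)) (RGround.under γ₀)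

theorem RTyping.denTy {Γ e τ} (h : RTyping Γ e τ) : DenTy Γ e τ := by
  induction h with
  | var e => exact fun ρ hρ => hρ.get e
  | lam _ _ ih => exact fun ρ hρ t ht => ih (t :: ρ) (.cons ht hρ)
  | app _ _ ih₀ ih₁ => exact fun ρ hρ => ih₀ ρ hρ _ (ih₁ ρ hρ)
  | unit => exact fun ρ hρ => .unit
  | pair _ _ ih₁ ih₂ => exact fun ρ hρ => .pair (ih₁ ρ hρ) (ih₂ ρ hρ)
  | fst _ ih =>
    intro ρ hρ
    have := ih ρ hρ
    simp only [Tm.den]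
    generalize Tm.den _ ρ = t at this
    cases this; assumption
  | snd _ ih =>
    intro ρ hρ
    have := ih ρ hρ
    simp only [Tm.den]
    generalize Tm.den _ ρ = t at this
    cases this; assumption
  | inl _ _ ih => exact fun ρ hρ => .inl (ih ρ hρ)
  | inr _ _ ih => exact fun ρ hρ => .inr (ih ρ hρ)
  | case _ _ _ _ ih₀ ih₁ ih₂ =>
    intro ρ hρ
    have := ih₀ ρ hρ
    simp only [Tm.den]
    generalize Tm.den _ ρ = t at this
    cases this with
    | inl h => exact ih₁ _ (.cons h hρ)
    | inr h => exact ih₂ _ (.cons h hρ)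
  | con _ _ ih =>
    intro ρ hρ
    exact .con (by simpa using ih ρ hρ)
  | des _ ih =>
    intro ρ hρ
    have := ih ρ hρ
    simp only [Tm.den, Poly.under_rApp, under_rMu] at this ⊢
    generalize Tm.den _ ρ = t at this
    cases this; assumption
  | conS _ _ ih =>
    intro ρ hρ
    simp only [RGround.under_toSafe, under_rMu]
    exact .con (by simpa using ih ρ hρ)
  | desS _ ih =>
    intro ρ hρ
    have := ih ρ hρ
    simp only [Tm.den, Poly.under_rApp, under_rMu, RGround.under_toSafe] at this ⊢
    generalize Tm.den _ ρ = t at this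
    cases this; assumption
  | fold _ _ ih₀ ih₁ =>
    intro ρ hρ
    have := ih₀ ρ hρ
    simp only [Poly.under_rApp, RGround.under_toSafe] at this ⊢
    exact TreeTy.mapFold (Q := .id) this (ih₁ ρ hρ)
  | toSafe _ ih => exact fun ρ hρ => by simpa [Tm.den] using ih ρ hρ
  | toNorm _ _ ih => exact fun ρ hρ => by simpa [Tm.den] using ih ρ hρ
  | cs _ _ => exact fun ρ hρ => TreeTy.natTree _

/-- Termination in the environments of the context `Γ`. -/
def Terminates (Γ : List RGround) (e : Tm) : Prop :=
  ∀ H θ ρ, EnvTy Γ ρ → EnvRep H θ ρ → ∃ H' a n, Eval H θ e H' a n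

def TyTerminates (Γ : List RGround) (e : Tm) : Ty RBase → Prop
  | .ground _ => Terminates Γ e
  | .arr γ₁ _ => ∃ e', e = .lam e' ∧ Terminates (γ₁ :: Γ) e'

/-- The recursion is on the tree below the vertex, so sharing plays no role; a memo hit only ends it
earlier. Correctness of the memo table is carried along because the step function has to be applied
to values of the right type. -/
theorem foldAt_terminates {P e₀ θ ρ} {γ : SGround}
    (hty : ∀ t, TreeTy t (P.app (fun N => N) γ) → TreeTy (e₀.den (t :: ρ)) γ)
    (hev : ∀ H c t, EnvRep H θ ρ → Rep H c t → TreeTy t (P.app (fun N => N) γ) →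
      ∃ H' a n, Eval H (c :: θ) e₀ H' a n) (t : Tree) :
    ∀ (Q : Poly) (H : Heap) (M : Memo) (c : ℕ), EnvRep H θ ρ → Rep H c t →
      TreeTy t (Q.app (fun N => N) (.base (.mu P))) →
      MemoOk P (fun t => e₀.den (t :: ρ)) H M →
      ∃ H' M' r n, MapAt Q P e₀ θ H M c H' M' r n := by
  induction t with
  | unit =>
    intro Q H M c hρ hc ht hM
    cases Q <;> simp only [Poly.app] at ht <;> cases ht
    exact ⟨_, _, _, _, .const⟩
  | pair a b iha ihb =>
    intro Q H M c hρ hc ht hM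
    cases Q <;> simp only [Poly.app] at ht <;> cases ht
    rename_i h₁ h₂
    cases hc with
    | pair e ha hb =>
      obtain ⟨H₁, M₁, r₁, n₁, d₁⟩ := iha _ _ _ _ hρ ha h₁ hM
      obtain ⟨p, m, -⟩ := d₁.sound hρ ha hM
      obtain ⟨H₂, M₂, r₂, n₂, d₂⟩ := ihb _ _ _ _ (hρ.mono p) (hb.mono p) h₂ m
      exact ⟨_, _, _, _, .pair e d₁ d₂⟩
  | inl a ih =>
    intro Q H M c hρ hc ht hM
    cases Q <;> simp only [Poly.app] at ht <;> cases ht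
    rename_i h₁
    cases hc with
    | inl e ha =>
      obtain ⟨H₁, M₁, r₁, n₁, d₁⟩ := ih _ _ _ _ hρ ha h₁ hM
      exact ⟨_, _, _, _, .inl e d₁⟩
  | inr a ih =>
    intro Q H M c hρ hc ht hM
    cases Q <;> simp only [Poly.app] at ht <;> cases ht
    rename_i h₁
    cases hc with
    | inr e ha =>
      obtain ⟨H₁, M₁, r₁, n₁, d₁⟩ := ih _ _ _ _ hρ ha h₁ hM
      exact ⟨_, _, _, _, .inr e d₁⟩
  | con P' a ih =>
    intro Q H M c hρ hc ht hM
    cases Q <;> simp only [Poly.app] at ht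
    · cases ht
      rename_i h₁
      cases hM' : M c with
      | some r => exact ⟨_, _, _, _, .id (.lookup hM')⟩
      | none =>
        cases hc with
        | con e ha =>
          obtain ⟨H₁, M₁, r₁, n₁, d₁⟩ := ih _ _ _ _ hρ ha h₁ hM
          obtain ⟨p, m, r⟩ := d₁.sound hρ ha hM
          obtain ⟨H₂, r₂, n₂, d₂⟩ := hev _ _ _ (hρ.mono p) r (TreeTy.mapFold hty h₁)
          exact ⟨_, _, _, _, .id (.step hM' e d₁ d₂)⟩
    · exact ⟨_, _, _, _, .const⟩
    · cases ht
    · cases ht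

/-- Terms of arrow type can only be abstractions, so plain induction on typing works without
reducibility predicates. It serves for the constructed term; for the given `f` termination is part
of the cost hypothesis. -/
theorem RTyping.tyTerminates {Γ e τ} (h : RTyping Γ e τ) : TyTerminates Γ e τ := by
  induction h with
  | var e =>
    intro H θ ρ hρ hθ
    have h₁ := hρ.length_eq
    have h₂ := hθ.length_eq
    obtain ⟨h₃, -⟩ := List.getElem?_eq_some_iff.1 e
    exact ⟨_, _, _, .var (List.getElem?_eq_getElem (by omega))⟩
  | lam _ _ ih => exact ⟨_, rfl, ih⟩
  | app h₀ h₁ ih₀ ih₁ =>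
    intro H θ ρ hρ hθ
    obtain ⟨e', rfl, ih₀⟩ := ih₀
    obtain ⟨H₁, a₁, n₁, d₁⟩ := ih₁ H θ ρ hρ hθ
    obtain ⟨p, r⟩ := d₁.sound hθ
    obtain ⟨H₂, a₂, n₂, d₂⟩ := ih₀ H₁ _ _ (.cons (h₁.denTy ρ hρ) hρ) (.cons r (hθ.mono p))
    exact ⟨_, _, _, .app d₁ d₂⟩
  | unit => exact fun H θ ρ hρ hθ => ⟨_, _, _, .unit⟩
  | pair _ _ ih₁ ih₂ =>
    intro H θ ρ hρ hθ
    obtain ⟨H₁, a₁, n₁, d₁⟩ := ih₁ H θ ρ hρ hθ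
    obtain ⟨p, r⟩ := d₁.sound hθ
    obtain ⟨H₂, a₂, n₂, d₂⟩ := ih₂ H₁ θ ρ hρ (hθ.mono p)
    exact ⟨_, _, _, .pair d₁ d₂⟩
  | fst h ih =>
    intro H θ ρ hρ hθ
    obtain ⟨H₁, a₁, n₁, d₁⟩ := ih H θ ρ hρ hθ
    obtain ⟨p, r⟩ := d₁.sound hθ
    have ht := h.denTy ρ hρ
    generalize Tm.den _ ρ = t at r ht
    cases ht
    cases r with | pair e _ _ => exact ⟨_, _, _, .fst d₁ e⟩
  | snd h ih =>
    intro H θ ρ hρ hθ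
    obtain ⟨H₁, a₁, n₁, d₁⟩ := ih H θ ρ hρ hθ
    obtain ⟨p, r⟩ := d₁.sound hθ
    have ht := h.denTy ρ hρ
    generalize Tm.den _ ρ = t at r ht
    cases ht
    cases r with | pair e _ _ => exact ⟨_, _, _, .snd d₁ e⟩
  | inl _ _ ih =>
    intro H θ ρ hρ hθ
    obtain ⟨H₁, a₁, n₁, d₁⟩ := ih H θ ρ hρ hθ
    exact ⟨_, _, _, .inl d₁⟩
  | inr _ _ ih =>
    intro H θ ρ hρ hθ
    obtain ⟨H₁, a₁, n₁, d₁⟩ := ih H θ ρ hρ hθ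
    exact ⟨_, _, _, .inr d₁⟩
  | case _ h _ _ ih₀ ih₁ ih₂ =>
    intro H θ ρ hρ hθ
    obtain ⟨H₁, a₁, n₁, d₁⟩ := ih₀ H θ ρ hρ hθ
    obtain ⟨p, r⟩ := d₁.sound hθ
    have ht := h.denTy ρ hρ
    generalize Tm.den _ ρ = t at r ht
    cases ht with
    | inl ht =>
      cases r with
      | inl e r =>
        obtain ⟨H₂, a₂, n₂, d₂⟩ := ih₁ H₁ _ _ (.cons ht hρ) (.cons r (hθ.mono p))
        exact ⟨_, _, _, .caseL d₁ e d₂⟩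
    | inr ht =>
      cases r with
      | inr e r =>
        obtain ⟨H₂, a₂, n₂, d₂⟩ := ih₂ H₁ _ _ (.cons ht hρ) (.cons r (hθ.mono p))
        exact ⟨_, _, _, .caseR d₁ e d₂⟩
  | con _ _ ih =>
    intro H θ ρ hρ hθ
    obtain ⟨H₁, a₁, n₁, d₁⟩ := ih H θ ρ hρ hθ
    exact ⟨_, _, _, .con d₁⟩
  | des h ih =>
    intro H θ ρ hρ hθ
    obtain ⟨H₁, a₁, n₁, d₁⟩ := ih H θ ρ hρ hθ
    obtain ⟨p, r⟩ := d₁.sound hθ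
    have ht := h.denTy ρ hρ
    simp only [under_rMu] at ht
    generalize Tm.den _ ρ = t at r ht
    cases ht
    cases r with | con e _ => exact ⟨_, _, _, .des d₁ e⟩
  | conS _ _ ih =>
    intro H θ ρ hρ hθ
    obtain ⟨H₁, a₁, n₁, d₁⟩ := ih H θ ρ hρ hθ
    exact ⟨_, _, _, .conS d₁⟩
  | desS h ih =>
    intro H θ ρ hρ hθ
    obtain ⟨H₁, a₁, n₁, d₁⟩ := ih H θ ρ hρ hθ
    obtain ⟨p, r⟩ := d₁.sound hθ
    have ht := h.denTy ρ hρ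
    simp only [under_rMu, RGround.under_toSafe] at ht
    generalize Tm.den _ ρ = t at r ht
    cases ht
    cases r with | con e _ => exact ⟨_, _, _, .desS d₁ e⟩
  | @fold Γ P e₀ e₁ γ h₀ h₁ ih₀ ih₁ =>
    intro H θ ρ hρ hθ
    obtain ⟨e', he, ih₀⟩ := ih₀
    cases he
    obtain ⟨H₁, a₁, n₁, d₁⟩ := ih₁ H θ ρ hρ hθ
    obtain ⟨p, r⟩ := d₁.sound hθ
    have hty := h₀.denTy ρ hρ
    simp only [Poly.under_rApp, RGround.under_toSafe] at hty
    obtain ⟨H₂, M₂, a₂, n₂, d₂⟩ := foldAt_terminates (e₀ := e₀) hty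
      (fun H c t hH hc ht => ih₀ H _ _ (.cons (by simpa using ht) hρ) (.cons hc hH))
      _ .id H₁ (fun _ => none) a₁ (hθ.mono p) r (h₁.denTy ρ hρ) (fun _ _ h => by simp at h)
    cases d₂ with | id d₂ => exact ⟨_, _, _, .fold d₁ d₂⟩
  | toSafe _ ih =>
    intro H θ ρ hρ hθ
    obtain ⟨H₁, a₁, n₁, d₁⟩ := ih H θ ρ hρ hθ
    exact ⟨_, _, _, .toSafe d₁⟩
  | toNorm _ _ ih =>
    intro H θ ρ hρ hθ
    obtain ⟨H₁, a₁, n₁, d₁⟩ := ih H θ ρ hρ hθ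
    exact ⟨_, _, _, .toNorm d₁⟩
  | cs _ ih =>
    intro H θ ρ hρ hθ
    obtain ⟨H₁, a₁, n₁, d₁⟩ := ih H θ ρ hρ hθ
    exact ⟨_, _, _, .cs d₁⟩

/-- It makes the set in `Tree.csize` nonempty, so that the infimum is attained. The initial heap
`H₀` is arbitrary in order to build two subtrees one after the other. -/
theorem Tree.exists_rep (t : Tree) : ∀ H₀ : Heap, ∃ H a, H₀ <+: H ∧ Rep H a t := by
  induction t with
  | unit => exact fun H => ⟨H ++ [.unit], H.length, List.prefix_append _ _, .unit (by simp)⟩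
  | pair a b iha ihb =>
    intro H
    obtain ⟨H₁, a₁, p₁, r₁⟩ := iha H
    obtain ⟨H₂, a₂, p₂, r₂⟩ := ihb H₁
    exact ⟨_, _, (p₁.trans p₂).trans (List.prefix_append _ _),
      rep_append_pair (r₁.mono p₂) r₂ List.prefix_rfl⟩
  | inl a ih =>
    intro H
    obtain ⟨H₁, a₁, p₁, r₁⟩ := ih H
    exact ⟨H₁ ++ [.inl a₁], H₁.length, p₁.trans (List.prefix_append _ _),
      .inl (by simp) (r₁.mono (List.prefix_append _ _))⟩
  | inr a ih =>
    intro H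
    obtain ⟨H₁, a₁, p₁, r₁⟩ := ih H
    exact ⟨H₁ ++ [.inr a₁], H₁.length, p₁.trans (List.prefix_append _ _),
      .inr (by simp) (r₁.mono (List.prefix_append _ _))⟩
  | con P a ih =>
    intro H
    obtain ⟨H₁, a₁, p₁, r₁⟩ := ih H
    exact ⟨H₁ ++ [.con P a₁], H₁.length, p₁.trans (List.prefix_append _ _),
      .con (by simp) (r₁.mono (List.prefix_append _ _))⟩

theorem size_le_length (H : Heap) (a : ℕ) : size H a ≤ H.length := by
  have : {b : ℕ | Reach H a b ∧ ∃ P c, H[b]? = some (.con P c)} ⊆ ↑(Finset.range H.length) := by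
    rintro b ⟨-, P, c, h⟩
    simpa using (List.getElem?_eq_some_iff.1 h).1
  have := Set.ncard_le_ncard this (Finset.finite_toSet _)
  rwa [Set.ncard_coe_finset, Finset.card_range] at this

/-! ### Binary trees as a data type -/

/-- Binary trees. -/
inductive Cell : Type
  | nil : Cell
  | node (l r : Cell) : Cell

namespace Cell

def car : Cell → Cell
  | nil => nil
  | node l _ => l

def cdr : Cell → Cell
  | nil => nil
  | node _ r => r

/-- `ifnil c a b` is `a` if `c` is `nil`, and `b` otherwise. -/
def ifnil : Cell → Cell → Cell → Cell
  | nil, a, _ => a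
  | node _ _, _, b => b

def fold (b : Cell) (g : Cell → Cell → Cell) : Cell → Cell
  | nil => b
  | node l r => g (fold b g l) (fold b g r)

@[simp] theorem car_node (l r : Cell) : (node l r).car = l := rfl
@[simp] theorem cdr_node (l r : Cell) : (node l r).cdr = r := rfl
@[simp] theorem ifnil_nil (a b : Cell) : ifnil nil a b = a := rfl
@[simp] theorem ifnil_node (l r a b : Cell) : ifnil (node l r) a b = b := rfl

/-- Numerals. -/
def num : ℕ → Cell
  | 0 => nil
  | n + 1 => node nil (num n)

theorem num_injective : Function.Injective num := by
  intro m
  induction m with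
  | zero => intro n h; cases n <;> simp_all [num]
  | succ m ih =>
    intro n h
    cases n with
    | zero => simp [num] at h
    | succ n => simp only [num, node.injEq, true_and] at h; rw [ih h]

open Classical in
/-- The subtrees. -/
noncomputable def subs : Cell → Finset Cell
  | nil => {nil}
  | node l r => insert (node l r) (subs l ∪ subs r)

theorem nil_mem_subs (d : Cell) : nil ∈ d.subs := by
  induction d <;> simp_all [subs]

theorem self_mem_subs (d : Cell) : d ∈ d.subs := by
  cases d <;> simp [subs]

end Cell

/-- The functor of which `Cell` is the least fixed point. -/
def cellP : Poly := .sum (.const .unit) (.prod .id .id)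

def Cell.tree : Cell → Tree
  | .nil => .con cellP (.inl .unit)
  | .node l r => .con cellP (.inr (.pair l.tree r.tree))

theorem Cell.tree_injective : Function.Injective Cell.tree := by
  intro c
  induction c with
  | nil => intro d h; cases d <;> simp_all [Cell.tree]
  | node l r ihl ihr =>
    intro d h
    cases d with
    | nil => simp [Cell.tree] at h
    | node l' r' =>
      simp only [Cell.tree, Tree.con.injEq, Tree.inr.injEq, Tree.pair.injEq, true_and] at h
      rw [ihl h.1, ihr h.2]

theorem Cell.exists_reach {H : Heap} {d c : Cell} (h : c ∈ d.subs) {a} (r : Rep H a d.tree) :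
    ∃ b, Reach H a b ∧ Rep H b c.tree := by
  induction d generalizing a with
  | nil =>
    simp only [subs, Finset.mem_singleton] at h
    subst h
    exact ⟨a, .refl a, r⟩
  | node l m ihl ihm =>
    simp only [subs, Finset.mem_insert, Finset.mem_union] at h
    rcases h with rfl | h
    · exact ⟨a, .refl a, r⟩
    · simp only [Cell.tree] at r
      cases r with
      | con e r =>
        cases r with
        | inr e' r =>
          cases r with
          | pair e'' rl rm =>
            rcases h with h | h
            · obtain ⟨b, hb, hb'⟩ := ihl h rl
              exact ⟨b, .con e (.inr e' (.fst e'' hb)), hb'⟩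
            · obtain ⟨b, hb, hb'⟩ := ihm h rm
              exact ⟨b, .con e (.inr e' (.snd e'' hb)), hb'⟩

/-- In a graph of least size every subtree of `d`, `nil` included, is the unfolding of some
constructor vertex, and different subtrees need different vertices. This lower bound is all that the
simulation needs to know about the compressed size. -/
theorem Cell.card_subs_le_csize (d : Cell) : d.subs.card ≤ d.tree.csize := by
  obtain ⟨H₀, a₀, -, r₀⟩ := d.tree.exists_rep []
  obtain ⟨H, a, r, h⟩ := Nat.sInf_mem
    (s := {k : ℕ | ∃ (H : Heap) (a : ℕ), Rep H a d.tree ∧ size H a = k}) ⟨_, H₀, a₀, r₀, rfl⟩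
  rw [Tree.csize, ← h, size]
  have hfin : {b : ℕ | Reach H a b ∧ ∃ P c, H[b]? = some (.con P c)}.Finite := by
    refine (Finset.range H.length).finite_toSet.subset ?_
    rintro b ⟨-, P, c, h⟩
    simpa using (List.getElem?_eq_some_iff.1 h).1
  choose! b hb hb' using fun c (hc : c ∈ d.subs) => Cell.exists_reach hc r
  rw [Set.ncard_eq_toFinset_card _ hfin]
  refine Finset.card_le_card_of_injOn b ?_ ?_
  · intro c hc
    simp only [Finset.mem_coe, Set.Finite.mem_toFinset, Set.mem_ofPred_eq]
    refine ⟨hb c hc, ?_⟩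
    have := hb' c hc
    cases c <;> simp only [Cell.tree] at this <;> cases this <;> exact ⟨_, _, by assumption⟩
  · intro c hc c' hc' e
    have h₁ := hb' c hc
    have h₂ := hb' c' hc'
    rw [e] at h₁
    exact Cell.tree_injective (h₁.unique h₂)

theorem Cell.mapFold_node (g : Tree → Tree) (l r : Cell) :
    (Cell.node l r).tree.mapFold cellP g .id =
      g (.inr (.pair (l.tree.mapFold cellP g .id) (r.tree.mapFold cellP g .id))) := rfl

theorem Tree.mapFold_nat_succ (g : Tree → Tree) (n : ℕ) :
    (Tree.nat (n + 1)).mapFold natP g .id = g (.inr ((Tree.nat n).mapFold natP g .id)) := rfl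

/-! ### Functions definable with a safe argument -/

/-- The normal type of binary trees. -/
abbrev cellN : RGround := .base (.norm (.mu cellP))
/-- The safe type of binary trees. -/
abbrev cellS : RGround := .base (.safe (.mu cellP))

theorem cellP_inhab : Base.Inhab (.mu cellP) := by
  simp [Base.Inhab, cellP, Poly.Inhab, Poly.Base0]

theorem cellS_ok : RGround.Ok cellS := cellP_inhab

theorem cellN_ok : RGround.Ok (rMu cellP) := cellP_inhab

/-- The term for `nil`. -/
def nilTm : Tm := .conS cellP (.inl (.toSafe .unit))
/-- The term for `node`. -/
def nodeTm (e₁ e₂ : Tm) : Tm := .conS cellP (.inr (.pair e₁ e₂))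

theorem nilTm_typing (Γ : List RGround) : RTyping Γ nilTm (.ground cellS) :=
  .conS cellN_ok (.inl (γ₁ := .base (.safe .unit)) (γ₂ := .prod cellS cellS)
    ⟨cellS_ok, cellS_ok⟩ (.toSafe .unit))

theorem nodeTm_typing {Γ : List RGround} {e₁ e₂ : Tm} (h₁ : RTyping Γ e₁ (.ground cellS))
    (h₂ : RTyping Γ e₂ (.ground cellS)) : RTyping Γ (nodeTm e₁ e₂) (.ground cellS) :=
  .conS cellN_ok (.inr (γ₁ := .base (.safe .unit)) (γ₂ := .prod cellS cellS)
    trivial (.pair h₁ h₂))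

theorem caseCell_typing {Γ : List RGround} {e a b : Tm} {γ : RGround} (hγ : γ.IsSafe)
    (h : RTyping Γ e (.ground cellS))
    (h₁ : RTyping (.base (.safe .unit) :: Γ) a (.ground γ))
    (h₂ : RTyping (.prod cellS cellS :: Γ) b (.ground γ)) :
    RTyping Γ (.case (.desS cellP e) a b) (.ground γ) :=
  .case (γ₁ := .base (.safe .unit)) (γ₂ := .prod cellS cellS) (.inr hγ) (.desS h) h₁ h₂

theorem nodeTm_den (e₁ e₂ : Tm) (ρ : List Tree) :
    (nodeTm e₁ e₂).den ρ = .con cellP (.inr (.pair (e₁.den ρ) (e₂.den ρ))) := rfl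

/-- `SDef f` : the function `f d s` is defined by terms in a normal variable for `d` and
a safe one for `s`, the latter with index `0`, and the former anywhere in the context. -/
def SDef (f : Cell → Cell → Cell) : Prop :=
  ∃ e : ℕ → Tm,
    (∀ (Γ : List RGround) (j : ℕ), Γ[j]? = some cellN →
      RTyping (cellS :: Γ) (e j) (.ground cellS)) ∧
    ∀ (ρ : List Tree) (j : ℕ) (d s : Cell), ρ[j]? = some d.tree →
      (e j).den (s.tree :: ρ) = (f d s).tree

namespace SDef

theorem arg : SDef fun _ s => s :=
  ⟨fun _ => .var 0, fun _ _ _ => .var rfl, fun _ _ _ _ _ => rfl⟩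

theorem const (c : Cell) : SDef fun _ _ => c := by
  induction c with
  | nil => exact ⟨fun _ => nilTm, fun _ _ _ => nilTm_typing _, fun _ _ _ _ _ => rfl⟩
  | node l r ihl ihr =>
    obtain ⟨el, tl, dl⟩ := ihl
    obtain ⟨er, tr, dr⟩ := ihr
    refine ⟨fun j => nodeTm (el j) (er j), fun Γ j h => nodeTm_typing (tl Γ j h) (tr Γ j h), ?_⟩
    intro ρ j d s h
    rw [nodeTm_den, dl ρ j d s h, dr ρ j d s h]
    rfl

variable {f g h : Cell → Cell → Cell}

theorem comp (hg : SDef g) (hf : SDef f) : SDef fun d s => g d (f d s) := by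
  obtain ⟨ef, tf, df⟩ := hf
  obtain ⟨eg, tg, dg⟩ := hg
  -- A redex replaces substitution. The position `j` of `d` being arbitrary, the new binder only
  -- shifts it, and no weakening lemma is needed.
  refine ⟨fun j => .app (.lam (eg (j + 1))) (ef j), fun Γ j h =>
    .app (.lam cellS_ok (tg (cellS :: Γ) (j + 1) (by simpa using h))) (tf Γ j h), ?_⟩
  intro ρ j d s h
  simp only [Tm.den]
  rw [df ρ j d s h, dg (s.tree :: ρ) (j + 1) d _ (by simpa using h)]

theorem node (hf : SDef f) (hg : SDef g) : SDef fun d s => .node (f d s) (g d s) := by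
  obtain ⟨el, tl, dl⟩ := hf
  obtain ⟨er, tr, dr⟩ := hg
  refine ⟨fun j => nodeTm (el j) (er j), fun Γ j h => nodeTm_typing (tl Γ j h) (tr Γ j h), ?_⟩
  intro ρ j d s h
  rw [nodeTm_den, dl ρ j d s h, dr ρ j d s h]
  rfl

theorem car (hf : SDef f) : SDef fun d s => (f d s).car := by
  obtain ⟨e, t, he⟩ := hf
  refine ⟨fun j => .case (.desS cellP (e j)) nilTm (.fst (.var 0)), fun Γ j h =>
    caseCell_typing trivial (t Γ j h) (nilTm_typing _) (.fst (.var rfl)), ?_⟩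
  intro ρ j d s h
  simp only [Tm.den]
  rw [he ρ j d s h]
  cases f d s <;> rfl

theorem cdr (hf : SDef f) : SDef fun d s => (f d s).cdr := by
  obtain ⟨e, t, he⟩ := hf
  refine ⟨fun j => .case (.desS cellP (e j)) nilTm (.snd (.var 0)), fun Γ j h =>
    caseCell_typing trivial (t Γ j h) (nilTm_typing _) (.snd (.var rfl)), ?_⟩
  intro ρ j d s h
  simp only [Tm.den]
  rw [he ρ j d s h]
  cases f d s <;> rfl

theorem ifnil (hf : SDef f) (hg : SDef g) (hh : SDef h) :
    SDef fun d s => (f d s).ifnil (g d s) (h d s) := by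
  obtain ⟨e, t, he⟩ := hf
  obtain ⟨e₁, t₁, he₁⟩ := hg
  obtain ⟨e₂, t₂, he₂⟩ := hh
  -- `var 1` is the safe argument, behind the variable bound by the case; rebinding it puts it at
  -- index `0`, where the branches expect it.
  refine ⟨fun j => .case (.desS cellP (e j)) (.app (.lam (e₁ (j + 2))) (.var 1))
    (.app (.lam (e₂ (j + 2))) (.var 1)), fun Γ j h =>
    caseCell_typing trivial (t Γ j h)
      (.app (.lam cellS_ok (t₁ (_ :: cellS :: Γ) (j + 2) (by simpa using h))) (.var rfl))
      (.app (.lam cellS_ok (t₂ (_ :: cellS :: Γ) (j + 2) (by simpa using h))) (.var rfl)), ?_⟩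
  intro ρ j d s h
  simp only [Tm.den]
  rw [he ρ j d s h]
  cases f d s with
  | nil => exact he₁ (_ :: s.tree :: ρ) (j + 2) d s (by simpa using h)
  | node l r => exact he₂ (_ :: s.tree :: ρ) (j + 2) d s (by simpa using h)

/-- Recursion over the normal argument. -/
theorem fold (hf : SDef f) (hg : SDef g) :
    SDef fun d s => Cell.fold (f d s) (fun u v => g d (.node s (.node u v))) d := by
  obtain ⟨e₁, t₁, he₁⟩ := hf
  obtain ⟨e₂, t₂, he₂⟩ := hg
  -- The step function may use the safe parameter `s` freely. It packs `s` and the two recursive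
  -- results into one cell, as `g` has only one safe argument.
  refine ⟨fun j => .fold cellP (.lam (.case (.var 0) (.app (.lam (e₁ (j + 3))) (.var 2))
    (.app (.lam (e₂ (j + 3))) (nodeTm (.var 2) (nodeTm (.fst (.var 0)) (.snd (.var 0)))))))
    (.var (j + 1)), fun Γ j h => ?_, ?_⟩
  · refine .fold (γ := cellS) (.lam ⟨trivial, cellS_ok, cellS_ok⟩ ?_) (.var (show _ = some cellN by simpa using h))
    -- The scrutinee mixes a normal unit with safe recursive results, so the case is admitted only
    -- because its result is safe.
    refine .case (γ₁ := .base (.norm .unit)) (γ₂ := .prod cellS cellS) (.inr trivial) (.var rfl)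
      (.app (.lam cellS_ok (t₁ (_ :: _ :: cellS :: Γ) (j + 3) (by simpa using h))) (.var rfl))
      (.app (.lam cellS_ok (t₂ (_ :: _ :: cellS :: Γ) (j + 3) (by simpa using h)))
        (nodeTm_typing (.var rfl) (nodeTm_typing (.fst (.var rfl)) (.snd (.var rfl)))))
  · intro ρ j d s h
    simp only [Tm.den, nodeTm_den]
    have h' : (s.tree :: ρ).getD (j + 1) .unit = d.tree := by
      simp [List.getD, h]
    rw [h']
    -- The recursion runs over a cell `c`, while `d` stays fixed as the parameter of `f` and `g`.
    have key : ∀ c : Cell, (c.tree).mapFold cellP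
        (fun t => t.cases (fun u => (e₁ (j + 3)).den (s.tree :: u :: t :: s.tree :: ρ))
          (fun u => (e₂ (j + 3)).den
            (.con cellP (.inr (.pair s.tree (.con cellP (.inr (.pair u.fst u.snd))))) ::
              u :: t :: s.tree :: ρ))) .id =
        (Cell.fold (f d s) (fun u v => g d (.node s (.node u v))) c).tree := by
      intro c
      induction c with
      | nil => exact he₁ (_ :: _ :: s.tree :: ρ) (j + 3) d s (by simpa using h)
      | node l r ihl ihr =>
        rw [Cell.mapFold_node, ihl, ihr]
        exact he₂ (_ :: _ :: s.tree :: ρ) (j + 3) d (.node s (.node _ _)) (by simpa using h)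
    exact key d

end SDef

/-- A clock: functions can be iterated `K d` times. -/
def Clock (K : Cell → ℕ) : Prop := ∀ f, SDef f → SDef fun d s => (f d)^[K d] s

-- Iteration for polynomially many rounds

namespace Clock

/-- The numeral `cs d` is normal, so one can fold over it with the safe state as the recursive
result. The construction uses the primitive `cs` nowhere else. -/
theorem csize : Clock fun d => d.tree.csize := by
  rintro f ⟨e, t, he⟩
  refine ⟨fun j => .fold natP (.lam (.case (.var 0) (.var 2) (e (j + 2))))
    (.cs cellP (.var (j + 1))), fun Γ j h => ?_, ?_⟩
  · refine .fold (γ := cellS) (.lam ⟨trivial, cellS_ok⟩ ?_) (.cs (.var (show _ = some cellN by simpa using h)))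
    exact .case (γ₁ := .base (.norm .unit)) (γ₂ := cellS) (.inr trivial) (.var rfl) (.var rfl)
      (t (_ :: cellS :: Γ) (j + 2) (by simpa using h))
  · intro ρ j d s h
    simp only [Tm.den]
    have h' : (s.tree :: ρ).getD (j + 1) .unit = d.tree := by
      simp [List.getD, h]
    rw [h']
    have key : ∀ n, (Tree.nat n).mapFold natP (fun t => t.cases (fun _ => s.tree)
        (fun u => (e (j + 2)).den (u :: t :: s.tree :: ρ))) .id = ((f d)^[n] s).tree := by
      intro n
      induction n with
      | zero => rfl
      | succ n ih =>
        rw [Tree.mapFold_nat_succ, ih, Function.iterate_succ_apply']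
        exact he (_ :: s.tree :: ρ) (j + 2) d _ (by simpa using h)
    exact key _

theorem zero : Clock fun _ => 0 := fun _ _ => SDef.arg

theorem one : Clock fun _ => 1 := fun _ hf => hf

theorem add {K L : Cell → ℕ} (hK : Clock K) (hL : Clock L) : Clock fun d => K d + L d := by
  intro f hf
  simpa only [Function.iterate_add_apply] using (hK f hf).comp (hL f hf)

/-- Iterating an iterate: the number of inner rounds depends on the normal `d` and not on the safe
state, so the iterate of `f` is again a definable step. -/
theorem mul {K L : Cell → ℕ} (hK : Clock K) (hL : Clock L) : Clock fun d => K d * L d := by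
  intro f hf
  simpa only [Function.iterate_mul] using hL _ (hK f hf)

theorem const (n : ℕ) : Clock fun _ => n := by
  induction n with
  | zero => exact zero
  | succ n ih => exact ih.add one

theorem pow {K : Cell → ℕ} (hK : Clock K) (n : ℕ) : Clock fun d => K d ^ n := by
  induction n with
  | zero => simpa using one
  | succ n ih => simpa only [pow_succ] using ih.mul hK

theorem eval (q : Polynomial ℕ) {K : Cell → ℕ} (hK : Clock K) : Clock fun d => q.eval (K d) := by
  induction q using Polynomial.induction_on' with
  | add p q hp hq => simpa only [Polynomial.eval_add] using hp.add hq
  | monomial n a => simpa only [Polynomial.eval_monomial] using (const a).mul (hK.pow n)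

end Clock

namespace Cell

/-! ### Equality of numerals, and search in lists -/

def one : Cell := node nil nil

def isNil : Cell → Bool
  | nil => true
  | node _ _ => false

def ofList : List Cell → Cell
  | [] => nil
  | c :: l => node c (ofList l)

def eqStep (s : Cell) : Cell :=
  s.car.ifnil s (s.cdr.ifnil s (node s.car.cdr s.cdr.cdr))

def eqEnd (s : Cell) : Cell := s.car.ifnil (s.cdr.ifnil nil one) one

/-- Equality test for numerals; `nil` stands for truth. -/
def eqNum (K : ℕ) (a b : Cell) : Cell := eqEnd (eqStep^[K] (node a b))

theorem eqStep_iterate (K m n : ℕ) :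
    eqStep^[K] (node (num m) (num n)) =
      node (num (m - min K (min m n))) (num (n - min K (min m n))) := by
  induction K generalizing m n with
  | zero => simp
  | succ K ih =>
    rw [Function.iterate_succ_apply]
    cases m with
    | zero =>
      have : eqStep (node (num 0) (num n)) = node (num 0) (num n) := rfl
      rw [this, ih]; simp
    | succ m =>
      cases n with
      | zero =>
        have : eqStep (node (num (m + 1)) (num 0)) = node (num (m + 1)) (num 0) := rfl
        rw [this, ih]; simp
      | succ n =>
        have : eqStep (node (num (m + 1)) (num (n + 1))) = node (num m) (num n) := rfl
        rw [this, ih]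
        congr 2 <;> omega

/-- Both numerals are decreased together and the pair freezes when one is exhausted, so a bound on
one of them is enough. -/
theorem eqNum_isNil {K m n : ℕ} (h : m ≤ K) : (eqNum K (num m) (num n)).isNil = decide (m = n) := by
  rw [eqNum, eqStep_iterate]
  rcases lt_trichotomy m n with h' | rfl | h'
  · have h₁ : m - min K (min m n) = 0 := by omega
    obtain ⟨k, h₂⟩ : ∃ k, n - min K (min m n) = k + 1 := ⟨n - m - 1, by omega⟩
    rw [h₁, h₂]
    simpa [eqEnd, num, isNil, one] using h'.ne
  · have h₁ : m - min K (min m m) = 0 := by omega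
    rw [h₁]
    simp [eqEnd, num, isNil]
  · obtain ⟨k, h₂⟩ : ∃ k, m - min K (min m n) = k + 1 := ⟨m - n - 1, by omega⟩
    rw [h₂]
    simpa [eqEnd, num, isNil, one] using h'.ne'

/-- The state freezes at the end of the list or at the first hit, so surplus rounds do no harm. -/
def searchStep (p : Cell → Cell → Cell) (s : Cell) : Cell :=
  s.cdr.ifnil s ((p s.car s.cdr.car).ifnil s (node s.car s.cdr.cdr))

/-- The first entry `e` of the list `l` for which `p key e` holds. -/
def search (K : ℕ) (p : Cell → Cell → Cell) (key l : Cell) : Cell :=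
  ((searchStep p)^[K] (node key l)).cdr.car

theorem search_ofList {K : ℕ} (p : Cell → Cell → Cell) (key : Cell) {l : List Cell}
    (h : l.length ≤ K) :
    search K p key (ofList l) = (l.find? fun e => (p key e).isNil).getD nil := by
  induction l generalizing K with
  | nil =>
    have : searchStep p (node key (ofList [])) = node key (ofList []) := rfl
    rw [search, Function.iterate_fixed this]
    rfl
  | cons c l ih =>
    cases hp : p key c with
    | nil =>
      have : searchStep p (node key (ofList (c :: l))) = node key (ofList (c :: l)) := by
        simp [searchStep, ofList, hp]
      rw [search, Function.iterate_fixed this]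
      simp [hp, isNil, ofList]
    | node x y =>
      obtain ⟨K, rfl⟩ : ∃ K', K = K' + 1 := ⟨K - 1, by simp at h; omega⟩
      have : searchStep p (node key (ofList (c :: l))) = node key (ofList l) := by
        simp [searchStep, ofList, hp]
      rw [search, Function.iterate_succ_apply, this]
      have := ih (K := K) (by simpa using h)
      rw [search] at this
      rw [this]
      simp [hp, isNil]

/-! ### Hash-consing -/

/-- Comparison of a pair of identifiers with those of the children of an annotated cell. -/
def sameKids (K : ℕ) (key e : Cell) : Cell :=
  (eqNum K key.car e.cdr.car.car).ifnil (eqNum K key.cdr e.cdr.cdr.car) one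

/-- `E` is the outcome of a search, `nil` meaning that nothing was found. The flag `nil` marks a
successful annotation; the flag `one` comes with the annotated children of a missing cell. -/
def annFound (E A B : Cell) : Cell := E.ifnil (node one (node A B)) (node nil E)

/-- Failures below are passed on before any search is made, so a cell is reported missing only when
both its children are already in the table. -/
def annStep (K : ℕ) (T u v : Cell) : Cell :=
  u.car.ifnil (v.car.ifnil
    (annFound (search K (sameKids K) (node u.cdr.car v.cdr.car) T) u.cdr v.cdr) v) u

/-- The annotation of `d` with identifiers from the table `T` (after `nil`), or a cell missing
in the table (after `one`). -/
def annotate (K : ℕ) (T d : Cell) : Cell := fold (node nil nil) (annStep K T) d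

/-- The newest entry stands first and has the largest identifier, so `node nil T.car.car` is the
next one; for the empty table it is `1`, which leaves `0` to `nil`. -/
def addMissing (K : ℕ) (d T : Cell) : Cell :=
  (annotate K T d).car.ifnil T (node (node (node nil T.car.car) (annotate K T d).cdr) T)

def table (K : ℕ) (d : Cell) : Cell := (addMissing K d)^[K] nil

open Classical in
/-- The identifier of a cell; it is `0` for the cells not in the list. -/
noncomputable def idx : List Cell → Cell → ℕ
  | [], _ => 0
  | s :: S, c => if c = s then S.length + 1 else idx S c

/-- The annotated cell. -/
noncomputable def ann (S : List Cell) : Cell → Cell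
  | nil => nil
  | node l r => node (num (idx S (node l r))) (node (ann S l) (ann S r))

theorem idx_le (S : List Cell) (c : Cell) : idx S c ≤ S.length := by
  induction S with
  | nil => simp [idx]
  | cons s S ih =>
    simp only [idx, List.length_cons]
    split <;> omega

theorem idx_of_not_mem {S : List Cell} {c : Cell} (h : c ∉ S) : idx S c = 0 := by
  induction S with
  | nil => rfl
  | cons s S ih => simp_all [idx]

theorem idx_pos {S : List Cell} {c : Cell} (h : c ∈ S) : 0 < idx S c := by
  induction S with
  | nil => simp at h
  | cons s S ih =>
    simp only [idx]
    split
    · omega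
    · simp_all

theorem idx_inj {S : List Cell} {b c : Cell} (hb : b ∈ S) (hc : c ∈ S)
    (h : idx S b = idx S c) : b = c := by
  induction S with
  | nil => simp at hb
  | cons s S ih =>
    simp only [idx] at h
    have h₁ := idx_le S b
    have h₂ := idx_le S c
    split at h <;> split at h
    · simp_all
    · omega
    · omega
    · simp_all

/-- Membership in a list or being `nil`. -/
def In (S : List Cell) (c : Cell) : Prop := c = nil ∨ c ∈ S

/-- Listed cells have positive identifiers and `nil` has `0`, so an identifier determines a cell
also when `nil` is admitted. -/
theorem In.inj {S : List Cell} {b c : Cell} (hS : nil ∉ S) (hb : In S b) (hc : In S c)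
    (h : idx S b = idx S c) : b = c := by
  rcases hb with rfl | hb <;> rcases hc with rfl | hc
  · rfl
  · have := idx_pos hc; rw [idx_of_not_mem hS] at h; omega
  · have := idx_pos hb; rw [idx_of_not_mem hS] at h; omega
  · exact idx_inj hb hc h

/-- Lists of cells without repetitions that contain the children of their elements. -/
structure Closed (S : List Cell) : Prop where
  nodup : S.Nodup
  nil_notMem : nil ∉ S
  kids : ∀ l r, node l r ∈ S → In S l ∧ In S r

/-- `nil` fits the pattern by accident of coding: its annotation is `nil`, whose `car` is `nil`, the
numeral of its identifier `0`. -/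
theorem Closed.car_ann {S : List Cell} (h : Closed S) (c : Cell) :
    (ann S c).car = num (idx S c) := by
  cases c with
  | nil => rw [idx_of_not_mem h.nil_notMem]; rfl
  | node l r => rfl

theorem Closed.cons {S : List Cell} (h : Closed S) {l r : Cell} (hl : In S l) (hr : In S r)
    (hc : node l r ∉ S) : Closed (node l r :: S) where
  nodup := List.nodup_cons.2 ⟨hc, h.nodup⟩
  nil_notMem := by simpa using h.nil_notMem
  kids l' r' h' := by
    rcases List.mem_cons.1 h' with h' | h'
    · cases h'
      exact ⟨hl.imp_right (List.mem_cons_of_mem _), hr.imp_right (List.mem_cons_of_mem _)⟩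
    · obtain ⟨h₁, h₂⟩ := h.kids _ _ h'
      exact ⟨h₁.imp_right (List.mem_cons_of_mem _), h₂.imp_right (List.mem_cons_of_mem _)⟩

/-- Identifiers count from the tail of the list, so a new entry in front does not renumber the old
ones. -/
theorem Closed.ann_cons {S : List Cell} (h : Closed S) {b c : Cell} (hb : b ∉ S) (hb' : b ≠ nil)
    (hc : In S c) : ann (b :: S) c = ann S c := by
  induction c with
  | nil => rfl
  | node l r ihl ihr =>
    obtain ⟨hl, hr⟩ := h.kids l r (by simpa [In] using hc)
    have : node l r ≠ b := by
      rintro rfl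
      simp [In, hb] at hc
    simp [ann, ihl hl, ihr hr, idx, this]

theorem find?_map_getD {S : List Cell} {f : Cell → Cell} {q : Cell → Bool} {t : Cell}
    (h : ∀ c ∈ S, q (f c) = true ↔ c = t) :
    (t ∈ S → ((S.map f).find? q).getD nil = f t) ∧
      (t ∉ S → ((S.map f).find? q).getD nil = nil) := by
  induction S with
  | nil => simp
  | cons s S ih =>
    have ih := ih fun c hc => h c (List.mem_cons_of_mem _ hc)
    have hs := h s List.mem_cons_self
    by_cases e : s = t
    · subst e
      have : q (f s) = true := hs.2 rfl
      simp [this]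
    · have : q (f s) = false := by simpa using mt hs.1 e
      simpa [this, Ne.symm e, Function.comp_def] using ih

theorem isNil_ifnil (a b c : Cell) :
    (a.ifnil b c).isNil = if a.isNil then b.isNil else c.isNil := by
  cases a <;> rfl

theorem isNil_one : one.isNil = false := rfl

/-- By closure under children, a cell with a missing child is itself missing, so a failure below is
a failure above. When both children are present, their identifiers determine them, and the search by
pairs of identifiers finds exactly the entry for `node l r`. -/
theorem annotate_spec {S : List Cell} (h : Closed S) {K : ℕ} (hK : S.length ≤ K) (d : Cell) :
    (In S d ∧ annotate K (ofList (S.map (ann S))) d = node nil (ann S d)) ∨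
    (¬ In S d ∧ ∃ l r, annotate K (ofList (S.map (ann S))) d = node one (node (ann S l) (ann S r)) ∧
      node l r ∈ d.subs ∧ node l r ∉ S ∧ In S l ∧ In S r) := by
  induction d with
  | nil => exact .inl ⟨.inl rfl, rfl⟩
  | node l r ihl ihr =>
    have hunf : annotate K (ofList (S.map (ann S))) (node l r) = annStep K (ofList (S.map (ann S)))
      (annotate K (ofList (S.map (ann S))) l) (annotate K (ofList (S.map (ann S))) r) := rfl
    rw [hunf]
    rcases ihl with ⟨hl, el⟩ | ⟨hl, l', r', el, h₁, h₂, h₃, h₄⟩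
    · rcases ihr with ⟨hr, er⟩ | ⟨hr, l', r', er, h₁, h₂, h₃, h₄⟩
      · rw [el, er]
        simp only [annStep, car_node, cdr_node, ifnil_nil, h.car_ann]
        rw [search_ofList _ _ (by simpa using hK)]
        obtain ⟨f₁, f₂⟩ := find?_map_getD (S := S) (f := ann S)
          (q := fun e => (sameKids K (node (num (idx S l)) (num (idx S r))) e).isNil)
          (t := node l r) (by
            intro c hc
            cases c with
            | nil => exact absurd hc h.nil_notMem
            | node l' r' =>
              obtain ⟨hl', hr'⟩ := h.kids _ _ hc
              simp only [sameKids, ann, car_node, cdr_node, h.car_ann, isNil_ifnil,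
                isNil_one,
                eqNum_isNil ((idx_le S _).trans hK)]
              have e₁ : idx S l = idx S l' ↔ l' = l :=
                ⟨fun e => (hl.inj h.nil_notMem hl' e).symm, fun e => by rw [e]⟩
              have e₂ : idx S r = idx S r' ↔ r' = r :=
                ⟨fun e => (hr.inj h.nil_notMem hr' e).symm, fun e => by rw [e]⟩
              simp [e₁, e₂])
        by_cases hm : node l r ∈ S
        · left
          refine ⟨.inr hm, ?_⟩
          rw [f₁ hm]
          rfl
        · right
          refine ⟨by simpa [In] using hm, l, r, ?_, self_mem_subs _, hm, hl, hr⟩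
          rw [f₂ hm]
          rfl
      · right
        refine ⟨fun hc => hr (h.kids l r (by simpa [In] using hc)).2, l', r', ?_, ?_, h₂, h₃, h₄⟩
        · rw [el, er]; rfl
        · simp [subs, h₁]
    · right
      refine ⟨fun hc => hl (h.kids l r (by simpa [In] using hc)).1, l', r', ?_, ?_, h₂, h₃, h₄⟩
      · rw [el]; rfl
      · simp [subs, h₁]

/-- The inequality is strict because `nil` is a subtree that is never listed. The slack of one later
pays for address `0` of the heap. -/
theorem length_lt_of_subset {S : List Cell} (h : Closed S) {d : Cell}
    (hd : ∀ c ∈ S, c ∈ d.subs) : S.length < d.subs.card := by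
  classical
  rw [← List.toFinset_card_of_nodup h.nodup]
  refine Finset.card_lt_card (Finset.ssubset_iff_of_subset (fun c hc => hd c (by simpa using hc)) |>.2
    ⟨nil, nil_mem_subs d, by simpa using h.nil_notMem⟩)

/-- The number of the next cell in the table. -/
theorem next_table {S : List Cell} (h : Closed S) :
    node nil (ofList (S.map (ann S))).car.car = num (S.length + 1) := by
  cases S with
  | nil => rfl
  | cons s S => simp [ofList, h.car_ann, idx, num]

/-- Each round either finds `d` complete or adds one new subtree of `d`, so the length counts the
rounds until `d` is in the table. -/
theorem addMissing_iterate {K : ℕ} {d : Cell} (hK : d.subs.card ≤ K) (m : ℕ) :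
    ∃ S, Closed S ∧ (∀ c ∈ S, c ∈ d.subs) ∧ (In S d ∨ S.length = m) ∧
      (addMissing K d)^[m] nil = ofList (S.map (ann S)) := by
  induction m with
  | zero => exact ⟨[], ⟨List.nodup_nil, by simp, by simp⟩, by simp, .inr rfl, rfl⟩
  | succ m ih =>
    obtain ⟨S, hS, hd, hl, e⟩ := ih
    have hlen := length_lt_of_subset hS hd
    rw [Function.iterate_succ_apply', e]
    rcases annotate_spec hS (by omega : S.length ≤ K) d with ⟨hin, ea⟩ | ⟨hin, l, r, ea, h₁, h₂, h₃, h₄⟩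
    · exact ⟨S, hS, hd, .inl hin, by rw [addMissing, ea]; rfl⟩
    · refine ⟨node l r :: S, hS.cons h₃ h₄ h₂, ?_, ?_, ?_⟩
      · intro c hc
        rcases List.mem_cons.1 hc with rfl | hc
        · exact h₁
        · exact hd c hc
      · right
        simp [hl.resolve_left hin]
      · rw [addMissing, ea, next_table hS]
        simp only [car_node, one, ifnil_node, cdr_node, List.map_cons, ofList, ann]
        congr 1
        · rw [hS.ann_cons h₂ (by simp) h₃, hS.ann_cons h₂ (by simp) h₄]
          simp [idx]
        · congr 1
          refine List.map_congr_left fun c hc => ?_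
          rw [hS.ann_cons h₂ (by simp) (.inr hc)]

theorem table_spec {K : ℕ} {d : Cell} (hK : d.subs.card ≤ K) :
    ∃ S, Closed S ∧ S.length < d.subs.card ∧ In S d ∧
      table K d = ofList (S.map (ann S)) ∧ annotate K (table K d) d = node nil (ann S d) := by
  obtain ⟨S, hS, hd, hl, e⟩ := addMissing_iterate hK K
  have hlen := length_lt_of_subset hS hd
  -- After `K` rounds without `d` the list would have length `K`, but it is shorter than the number
  -- of subtrees, which is at most `K`.
  have hin := hl.resolve_right (by omega)
  refine ⟨S, hS, hlen, hin, e, ?_⟩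
  rw [table, e]
  rcases annotate_spec hS (by omega : S.length ≤ K) d with ⟨_, ea⟩ | ⟨h, _⟩
  · exact ea
  · exact absurd hin h

end Cell

-- Definability of hash-consing

namespace SDef
open Cell

variable {K : Cell → ℕ} {f g h : Cell → Cell → Cell}

theorem eqNum (hK : Clock K) (hf : SDef f) (hg : SDef g) :
    SDef fun d s => Cell.eqNum (K d) (f d s) (g d s) := by
  have h₁ : SDef fun _ s => eqStep s :=
    .ifnil (.car .arg) .arg (.ifnil (.cdr .arg) .arg (.node (.cdr (.car .arg)) (.cdr (.cdr .arg))))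
  have h₂ : SDef fun _ s => eqEnd s :=
    .ifnil (.car .arg) (.ifnil (.cdr .arg) (.const _) (.const _)) (.const _)
  exact h₂.comp ((hK _ h₁).comp (hf.node hg))

theorem search (hK : Clock K) {p : Cell → Cell → Cell → Cell}
    (hp : SDef fun d s => p d s.car s.cdr) (hf : SDef f) (hg : SDef g) :
    SDef fun d s => Cell.search (K d) (p d) (f d s) (g d s) := by
  have h₀ : SDef fun d s => p d s.car s.cdr.car :=
    hp.comp (.node (.car .arg) (.car (.cdr .arg)))
  have h₁ : SDef fun d s => searchStep (p d) s :=
    .ifnil (.cdr .arg) .arg (.ifnil h₀ .arg (.node (.car .arg) (.cdr (.cdr .arg))))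
  exact .car (.cdr ((hK _ h₁).comp (hf.node hg)))

theorem annotate (hK : Clock K) : SDef fun d s => Cell.annotate (K d) s d := by
  have h₁ : SDef fun d s => sameKids (K d) s.car s.cdr :=
    .ifnil (.eqNum hK (.car (.car .arg)) (.car (.car (.cdr (.cdr .arg)))))
      (.eqNum hK (.cdr (.car .arg)) (.car (.cdr (.cdr (.cdr .arg))))) (.const _)
  have u : SDef fun _ s => s.cdr.car := .car (.cdr .arg)
  have v : SDef fun _ s => s.cdr.cdr := .cdr (.cdr .arg)
  have h₂ : SDef fun d s => Cell.search (K d) (sameKids (K d))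
      (.node s.cdr.car.cdr.car s.cdr.cdr.cdr.car) s.car :=
    .search hK h₁ (.node (.car (.cdr u)) (.car (.cdr v))) (.car .arg)
  have h₃ : SDef fun d s => annStep (K d) s.car s.cdr.car s.cdr.cdr :=
    .ifnil (.car u) (.ifnil (.car v) (.ifnil h₂ (.node (.const _) (.node (.cdr u) (.cdr v)))
      (.node (.const _) h₂)) v) u
  -- The table is the safe argument and the recursion is over the normal `d`; the step receives the
  -- table together with the annotations of the two children.
  exact fold (.const _) h₃

theorem table (hK : Clock K) : SDef fun d _ => Cell.table (K d) d := by
  have h₁ : SDef fun d s => addMissing (K d) d s :=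
    .ifnil (.car (annotate hK)) .arg
      (.node (.node (.node (.const _) (.car (.car .arg))) (.cdr (annotate hK))) .arg)
  exact (hK _ h₁).comp (.const _)

end SDef

namespace Cell

/-! ### A stack machine on binary trees -/

/-- Case distinction on a numeral. -/
def sw (t : Cell) : List Cell → Cell
  | [] => nil
  | b :: bs => t.ifnil b (sw t.cdr bs)

/-- Machine states: instructions with environments, value stack, next identifier, and the stack
of memo tables, each paired with the code of the step function of its fold. -/
def mk (ts vs c fr : Cell) : Cell := node ts (node vs (node c fr))

/-! Instructions. A value is a cell `node i (node x y)` with identifier `i`. -/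

def iSeq (a b : Cell) : Cell := node (num 0) (node a b)
def iVar (i : ℕ) : Cell := node (num 1) (num i)
def iBind (a : Cell) : Cell := node (num 2) a
def iUnit : Cell := node (num 3) nil
def iPair : Cell := node (num 4) nil
def iFst : Cell := node (num 5) nil
def iSnd : Cell := node (num 6) nil
def iTag (t : Cell) : Cell := node (num 7) t
def iSwitch (a b : Cell) : Cell := node (num 8) (node a b)
def iSplit : Cell := node (num 9) nil
def iSwap : Cell := node (num 10) nil
def iNop : Cell := node (num 11) nil
def iEnter (b : Cell) : Cell := node (num 12) b
def iLeave : Cell := node (num 13) nil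
def iRec : Cell := node (num 14) nil
def iSave : Cell := node (num 15) nil

def opSeq (a e ts vs c fr : Cell) : Cell :=
  mk (node (node a.car e) (node (node a.cdr e) ts)) vs c fr
-- The environment is walked one entry per machine step: the instruction puts itself back with a
-- smaller index and a shorter environment.
def opVar (a e ts vs c fr : Cell) : Cell :=
  a.ifnil (mk ts (node e.car vs) c fr) (mk (node (node (node (num 1) a.cdr) e.cdr) ts) vs c fr)
def opBind (a e ts vs c fr : Cell) : Cell :=
  mk (node (node a (node vs.car e)) ts) vs.cdr c fr
-- The counter advances although the pushed `nil` carries no identifier, so that it always equals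
-- the length of the heap.
def opUnit (ts vs c fr : Cell) : Cell := mk ts (node nil vs) (node nil c) fr
def opPair (ts vs c fr : Cell) : Cell :=
  mk ts (node (node c (node vs.cdr.car vs.car)) vs.cdr.cdr) (node nil c) fr
def opFst (ts vs c fr : Cell) : Cell := mk ts (node vs.car.cdr.car vs.cdr) c fr
def opSnd (ts vs c fr : Cell) : Cell := mk ts (node vs.car.cdr.cdr vs.cdr) c fr
def opTag (a ts vs c fr : Cell) : Cell :=
  mk ts (node (node c (node a vs.car)) vs.cdr) (node nil c) fr
def opSwitch (a e ts vs c fr : Cell) : Cell :=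
  mk (node (node (vs.car.cdr.car.ifnil a.car a.cdr) e) ts) (node vs.car.cdr.cdr vs.cdr) c fr
def opSplit (ts vs c fr : Cell) : Cell :=
  mk ts (node vs.car.cdr.car (node vs.car.cdr.cdr vs.cdr)) c fr
def opSwap (ts vs c fr : Cell) : Cell :=
  mk ts (node vs.cdr.car (node vs.car vs.cdr.cdr)) c fr
def opEnter (a ts vs c fr : Cell) : Cell := mk ts vs c (node (node nil a) fr)
def opLeave (ts vs c fr : Cell) : Cell := mk ts vs c fr.cdr
-- On a miss the body of the fold, kept in the top frame, is run on the content of the vertex. The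
-- pending `iSave` has the vertex itself in place of an environment; this is how the identifier is
-- remembered until the result is known.
def opRec (hit e ts vs c fr : Cell) : Cell :=
  hit.ifnil
    (mk (node (node fr.car.cdr e) (node (node iSave vs.car) ts)) (node vs.car.cdr.cdr vs.cdr) c fr)
    (mk ts (node hit.cdr vs.cdr) c fr)
def opSave (e ts vs c fr : Cell) : Cell :=
  mk ts vs c (node (node (node (node e.car vs.car) fr.car.car) fr.car.cdr) fr.cdr)

/-- Comparison of an identifier with the key of a memo entry. -/
def memoKey (K : ℕ) (key e : Cell) : Cell := eqNum K key e.car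

def stTag (s : Cell) : Cell := s.car.car.car.car
def stArg (s : Cell) : Cell := s.car.car.car.cdr
def stEnv (s : Cell) : Cell := s.car.car.cdr
def stTasks (s : Cell) : Cell := s.car.cdr
def stVals (s : Cell) : Cell := s.cdr.car
def stNext (s : Cell) : Cell := s.cdr.cdr.car
def stFrames (s : Cell) : Cell := s.cdr.cdr.cdr
def stHit (K : ℕ) (s : Cell) : Cell :=
  search K (memoKey K) (stVals s).car.car (stFrames s).car.car

/-- One step of the machine. -/
def step (K : ℕ) (s : Cell) : Cell :=
  s.car.ifnil s (sw (stTag s) [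
    opSeq (stArg s) (stEnv s) (stTasks s) (stVals s) (stNext s) (stFrames s),
    opVar (stArg s) (stEnv s) (stTasks s) (stVals s) (stNext s) (stFrames s),
    opBind (stArg s) (stEnv s) (stTasks s) (stVals s) (stNext s) (stFrames s),
    opUnit (stTasks s) (stVals s) (stNext s) (stFrames s),
    opPair (stTasks s) (stVals s) (stNext s) (stFrames s),
    opFst (stTasks s) (stVals s) (stNext s) (stFrames s),
    opSnd (stTasks s) (stVals s) (stNext s) (stFrames s),
    opTag (stArg s) (stTasks s) (stVals s) (stNext s) (stFrames s),
    opSwitch (stArg s) (stEnv s) (stTasks s) (stVals s) (stNext s) (stFrames s),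
    opSplit (stTasks s) (stVals s) (stNext s) (stFrames s),
    opSwap (stTasks s) (stVals s) (stNext s) (stFrames s),
    mk (stTasks s) (stVals s) (stNext s) (stFrames s),
    opEnter (stArg s) (stTasks s) (stVals s) (stNext s) (stFrames s),
    opLeave (stTasks s) (stVals s) (stNext s) (stFrames s),
    opRec (stHit K s) (stEnv s) (stTasks s) (stVals s) (stNext s) (stFrames s),
    opSave (stEnv s) (stTasks s) (stVals s) (stNext s) (stFrames s)])

/-- `Steps K m s s'` : the machine goes from `s` to `s'` in at most `m` steps. -/
def Steps (K m : ℕ) (s s' : Cell) : Prop := ∃ k ≤ m, (step K)^[k] s = s'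

section
variable {K m m' : ℕ} {s s' s'' a b e ts vs c fr V W x y i : Cell}

theorem Steps.trans (h : Steps K m s s') (h' : Steps K m' s' s'') : Steps K (m + m') s s'' := by
  obtain ⟨k, hk, rfl⟩ := h
  obtain ⟨k', hk', rfl⟩ := h'
  exact ⟨k' + k, by omega, Function.iterate_add_apply _ _ _ _⟩

theorem Steps.mono (h : Steps K m s s') (hm : m ≤ m') : Steps K m' s s' :=
  let ⟨k, hk, e⟩ := h; ⟨k, hk.trans hm, e⟩

theorem Steps.of_step (h : step K s = s') : Steps K 1 s s' := ⟨1, le_rfl, h⟩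

theorem steps_seq : Steps K 1 (mk (node (node (iSeq a b) e) ts) vs c fr)
    (mk (node (node a e) (node (node b e) ts)) vs c fr) := .of_step rfl

theorem steps_bind : Steps K 1 (mk (node (node (iBind a) e) ts) (node V vs) c fr)
    (mk (node (node a (node V e)) ts) vs c fr) := .of_step rfl

theorem steps_unit : Steps K 1 (mk (node (node iUnit e) ts) vs c fr)
    (mk ts (node nil vs) (node nil c) fr) := .of_step rfl

theorem steps_pair : Steps K 1 (mk (node (node iPair e) ts) (node W (node V vs)) c fr)
    (mk ts (node (node c (node V W)) vs) (node nil c) fr) := .of_step rfl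

theorem steps_fst : Steps K 1 (mk (node (node iFst e) ts) (node (node i (node x y)) vs) c fr)
    (mk ts (node x vs) c fr) := .of_step rfl

theorem steps_snd : Steps K 1 (mk (node (node iSnd e) ts) (node (node i (node x y)) vs) c fr)
    (mk ts (node y vs) c fr) := .of_step rfl

theorem steps_tag : Steps K 1 (mk (node (node (iTag a) e) ts) (node V vs) c fr)
    (mk ts (node (node c (node a V)) vs) (node nil c) fr) := .of_step rfl

theorem steps_switchL :
    Steps K 1 (mk (node (node (iSwitch a b) e) ts) (node (node i (node nil y)) vs) c fr)
      (mk (node (node a e) ts) (node y vs) c fr) := .of_step rfl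

theorem steps_switchR :
    Steps K 1 (mk (node (node (iSwitch a b) e) ts) (node (node i (node (node x W) y)) vs) c fr)
      (mk (node (node b e) ts) (node y vs) c fr) := .of_step rfl

theorem steps_split : Steps K 1 (mk (node (node iSplit e) ts) (node (node i (node x y)) vs) c fr)
    (mk ts (node x (node y vs)) c fr) := .of_step rfl

theorem steps_swap : Steps K 1 (mk (node (node iSwap e) ts) (node x (node y vs)) c fr)
    (mk ts (node y (node x vs)) c fr) := .of_step rfl

theorem steps_nop : Steps K 1 (mk (node (node iNop e) ts) vs c fr) (mk ts vs c fr) := .of_step rfl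

theorem steps_enter : Steps K 1 (mk (node (node (iEnter a) e) ts) vs c fr)
    (mk ts vs c (node (node nil a) fr)) := .of_step rfl

theorem steps_leave : Steps K 1 (mk (node (node iLeave e) ts) vs c (node x fr))
    (mk ts vs c fr) := .of_step rfl

theorem steps_save :
    Steps K 1 (mk (node (node iSave (node i W)) ts) (node V vs) c (node (node x y) fr))
      (mk ts (node V vs) c (node (node (node (node i V) x) y) fr)) := .of_step rfl

theorem steps_recMiss (h : search K (memoKey K) i a = nil) :
    Steps K 1 (mk (node (node iRec e) ts) (node (node i (node x y)) vs) c (node (node a b) fr))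
      (mk (node (node b e) (node (node iSave (node i (node x y))) ts)) (node y vs) c
        (node (node a b) fr)) := by
  refine .of_step ?_
  have : step K (mk (node (node iRec e) ts) (node (node i (node x y)) vs) c
      (node (node a b) fr)) = opRec (search K (memoKey K) i a) e ts
        (node (node i (node x y)) vs) c (node (node a b) fr) := rfl
  rw [this, h]
  rfl

theorem steps_recHit (h : search K (memoKey K) i a = node x V) :
    Steps K 1 (mk (node (node iRec e) ts) (node (node i W) vs) c (node (node a b) fr))
      (mk ts (node V vs) c (node (node a b) fr)) := by
  refine .of_step ?_
  have : step K (mk (node (node iRec e) ts) (node (node i W) vs) c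
      (node (node a b) fr)) = opRec (search K (memoKey K) i a) e ts
        (node (node i W) vs) c (node (node a b) fr) := rfl
  rw [this, h]
  rfl

theorem steps_var {Θ : List Cell} {i : ℕ} (h : Θ[i]? = some V) :
    Steps K (i + 1) (mk (node (node (iVar i) (ofList Θ)) ts) vs c fr)
      (mk ts (node V vs) c fr) := by
  induction i generalizing Θ with
  | zero =>
    cases Θ with
    | nil => simp at h
    | cons W Θ =>
      simp at h
      subst h
      exact .of_step rfl
  | succ i ih =>
    cases Θ with
    | nil => simp at h
    | cons W Θ =>
      have h₁ : Steps K 1 (mk (node (node (iVar (i + 1)) (ofList (W :: Θ))) ts) vs c fr)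
        (mk (node (node (iVar i) (ofList Θ)) ts) vs c fr) := .of_step rfl
      exact (h₁.trans (ih (by simpa using h))).mono (by omega)

end

/-- A memo table as a list. -/
def memoList (mm : List (ℕ × Cell)) : Cell := ofList (mm.map fun p => node (num p.1) p.2)

theorem search_memoList {K u : ℕ} {mm : List (ℕ × Cell)} (hu : u ≤ K) (hm : mm.length ≤ K) :
    search K (memoKey K) (num u) (memoList mm) =
      ((mm.find? fun p => u = p.1).map fun p => node (num p.1) p.2).getD nil := by
  rw [memoList, search_ofList _ _ (by simpa using hm), List.find?_map]
  congr 3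
  funext p
  simp [memoKey, eqNum_isNil hu]

end Cell

-- Definability of the machine step

namespace SDef
open Cell

variable {K : Cell → ℕ}

theorem sw {t : Cell → Cell → Cell} (ht : SDef t) (bs : List (Cell → Cell → Cell))
    (hb : ∀ b ∈ bs, SDef b) : SDef fun d s => (t d s).sw (bs.map fun b => b d s) := by
  induction bs generalizing t with
  | nil => exact .const nil
  | cons b bs ih =>
    exact ht.ifnil (hb b List.mem_cons_self)
      (ih ht.cdr fun b' h => hb b' (List.mem_cons_of_mem _ h))

/-- All instructions rearrange the state by finitely many cell operations. Only the memo look-up is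
a loop, and it runs on the clock. -/
theorem step (hK : Clock K) : SDef fun d s => Cell.step (K d) s := by
  have ht : SDef fun _ s => stTag s := .car (.car (.car (.car .arg)))
  have ha : SDef fun _ s => stArg s := .cdr (.car (.car (.car .arg)))
  have he : SDef fun _ s => stEnv s := .cdr (.car (.car .arg))
  have hts : SDef fun _ s => stTasks s := .cdr (.car .arg)
  have hv : SDef fun _ s => stVals s := .car (.cdr .arg)
  have hc : SDef fun _ s => stNext s := .car (.cdr (.cdr .arg))
  have hfr : SDef fun _ s => stFrames s := .cdr (.cdr (.cdr .arg))
  have hk : SDef fun d s => memoKey (K d) s.car s.cdr :=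
    .eqNum hK (.car .arg) (.car (.cdr .arg))
  have hh : SDef fun d s => stHit (K d) s := .search hK hk hv.car.car hfr.car.car
  refine .ifnil (.car .arg) .arg (sw ht [
    fun _ s => opSeq (stArg s) (stEnv s) (stTasks s) (stVals s) (stNext s) (stFrames s),
    fun _ s => opVar (stArg s) (stEnv s) (stTasks s) (stVals s) (stNext s) (stFrames s),
    fun _ s => opBind (stArg s) (stEnv s) (stTasks s) (stVals s) (stNext s) (stFrames s),
    fun _ s => opUnit (stTasks s) (stVals s) (stNext s) (stFrames s),
    fun _ s => opPair (stTasks s) (stVals s) (stNext s) (stFrames s),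
    fun _ s => opFst (stTasks s) (stVals s) (stNext s) (stFrames s),
    fun _ s => opSnd (stTasks s) (stVals s) (stNext s) (stFrames s),
    fun _ s => opTag (stArg s) (stTasks s) (stVals s) (stNext s) (stFrames s),
    fun _ s => opSwitch (stArg s) (stEnv s) (stTasks s) (stVals s) (stNext s) (stFrames s),
    fun _ s => opSplit (stTasks s) (stVals s) (stNext s) (stFrames s),
    fun _ s => opSwap (stTasks s) (stVals s) (stNext s) (stFrames s),
    fun _ s => mk (stTasks s) (stVals s) (stNext s) (stFrames s),
    fun _ s => opEnter (stArg s) (stTasks s) (stVals s) (stNext s) (stFrames s),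
    fun _ s => opLeave (stTasks s) (stVals s) (stNext s) (stFrames s),
    fun d s => opRec (stHit (K d) s) (stEnv s) (stTasks s) (stVals s) (stNext s) (stFrames s),
    fun _ s => opSave (stEnv s) (stTasks s) (stVals s) (stNext s) (stFrames s)] ?_)
  simp only [List.forall_mem_cons, List.not_mem_nil, false_imp_iff, implies_true, and_true]
  have hmk {f₁ f₂ f₃ f₄ : Cell → Cell → Cell} (h₁ : SDef f₁) (h₂ : SDef f₂) (h₃ : SDef f₃)
      (h₄ : SDef f₄) : SDef fun d s => mk (f₁ d s) (f₂ d s) (f₃ d s) (f₄ d s) :=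
    h₁.node (h₂.node (h₃.node h₄))
  refine ⟨?_, ?_, ?_, ?_, ?_, ?_, ?_, ?_, ?_, ?_, ?_, ?_, ?_, ?_, ?_, ?_⟩
  · exact hmk (.node (.node ha.car he) (.node (.node ha.cdr he) hts)) hv hc hfr
  · exact .ifnil ha (hmk hts (.node he.car hv) hc hfr)
      (hmk (.node (.node (.node (.const _) ha.cdr) he.cdr) hts) hv hc hfr)
  · exact hmk (.node (.node ha (.node hv.car he)) hts) hv.cdr hc hfr
  · exact hmk hts (.node (.const _) hv) (.node (.const _) hc) hfr
  · exact hmk hts (.node (.node hc (.node hv.cdr.car hv.car)) hv.cdr.cdr) (.node (.const _) hc) hfr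
  · exact hmk hts (.node hv.car.cdr.car hv.cdr) hc hfr
  · exact hmk hts (.node hv.car.cdr.cdr hv.cdr) hc hfr
  · exact hmk hts (.node (.node hc (.node ha hv.car)) hv.cdr) (.node (.const _) hc) hfr
  · exact hmk (.node (.node (.ifnil hv.car.cdr.car ha.car ha.cdr) he) hts)
      (.node hv.car.cdr.cdr hv.cdr) hc hfr
  · exact hmk hts (.node hv.car.cdr.car (.node hv.car.cdr.cdr hv.cdr)) hc hfr
  · exact hmk hts (.node hv.cdr.car (.node hv.car hv.cdr.cdr)) hc hfr
  · exact hmk hts hv hc hfr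
  · exact hmk hts hv hc (.node (.node (.const _) ha) hfr)
  · exact hmk hts hv hc hfr.cdr
  · exact .ifnil hh (hmk (.node (.node hfr.car.cdr he) (.node (.node (.const _) hv.car) hts))
      (.node hv.car.cdr.cdr hv.cdr) hc hfr) (hmk hts (.node hh.cdr hv.cdr) hc hfr)
  · exact hmk hts hv hc
      (.node (.node (.node (.node he.car hv.car) hfr.car.car) hfr.car.cdr) hfr.cdr)

end SDef

open Cell

/-! ### The machine follows dynamic-programming evaluations -/

/-- Code for `Q (fold)`, the recursive calls being made by `iRec`. -/
def Poly.code : Poly → Cell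
  | .id => iRec
  | .const _ => iNop
  | .sum Q₁ Q₂ => iSwitch (iSeq Q₁.code (iTag nil)) (iSeq Q₂.code (iTag one))
  | .prod Q₁ Q₂ => iSeq iSplit (iSeq Q₁.code (iSeq iSwap (iSeq Q₂.code iPair)))

/-- Code for the terms of `S₁⁻`. -/
def Tm.code : Tm → Cell
  | .var i => iVar i
  | .lam e => e.code
  | .app e₀ e₁ => iSeq e₁.code (iBind e₀.code)
  | .unit => iUnit
  | .pair e₁ e₂ => iSeq e₁.code (iSeq e₂.code iPair)
  | .fst e => iSeq e.code iFst
  | .snd e => iSeq e.code iSnd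
  | .inl e => iSeq e.code (iTag nil)
  | .inr e => iSeq e.code (iTag one)
  | .case e₀ e₁ e₂ => iSeq e₀.code (iSwitch (iBind e₁.code) (iBind e₂.code))
  | .con _ e => iSeq e.code (iTag nil)
  | .des _ e => iSeq e.code iSnd
  | .fold P e₀ e₁ =>
    iSeq e₁.code (iSeq (iEnter (iSeq P.code (iBind e₀.code))) (iSeq iRec iLeave))
  | _ => nil

/-- The raw terms of `S₁⁻`, with variables of index less than `B`. -/
def Tm.Plain (B : ℕ) : Tm → Prop
  | .var i => i < B
  | .lam e => e.Plain B
  | .app e₀ e₁ => e₀.Plain B ∧ e₁.Plain B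
  | .unit => True
  | .pair e₁ e₂ => e₁.Plain B ∧ e₂.Plain B
  | .fst e => e.Plain B
  | .snd e => e.Plain B
  | .inl e => e.Plain B
  | .inr e => e.Plain B
  | .case e₀ e₁ e₂ => e₀.Plain B ∧ e₁.Plain B ∧ e₂.Plain B
  | .con _ e => e.Plain B
  | .des _ e => e.Plain B
  | .fold _ e₀ e₁ => e₀.Plain B ∧ e₁.Plain B
  | _ => False

theorem Tm.Plain.mono {B B' : ℕ} (h : B ≤ B') {e : Tm} (he : e.Plain B) : e.Plain B' := by
  induction e with
  | var i => exact Nat.lt_of_lt_of_le he h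
  | lam e ih => exact ih he
  | app _ _ ih₁ ih₂ => exact ⟨ih₁ he.1, ih₂ he.2⟩
  | unit => trivial
  | pair _ _ ih₁ ih₂ => exact ⟨ih₁ he.1, ih₂ he.2⟩
  | fst _ ih => exact ih he
  | snd _ ih => exact ih he
  | inl _ ih => exact ih he
  | inr _ ih => exact ih he
  | case _ _ _ ih₁ ih₂ ih₃ => exact ⟨ih₁ he.1, ih₂ he.2.1, ih₃ he.2.2⟩
  | con _ _ ih => exact ih he
  | des _ _ ih => exact ih he
  | fold _ _ _ ih₁ ih₂ => exact ⟨ih₁ he.1, ih₂ he.2⟩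
  | _ => exact he

theorem STyping.exists_plain {Γ e τ} (h : STyping Γ e τ) : ∃ B, e.Plain B := by
  induction h with
  | @var _ i => exact ⟨i + 1, Nat.lt_succ_self i⟩
  | lam _ _ ih => exact ih
  | app _ _ ih₁ ih₂ =>
    obtain ⟨B₁, h₁⟩ := ih₁
    obtain ⟨B₂, h₂⟩ := ih₂
    exact ⟨max B₁ B₂, h₁.mono (le_max_left _ _), h₂.mono (le_max_right _ _)⟩
  | unit => exact ⟨0, trivial⟩
  | pair _ _ ih₁ ih₂ =>
    obtain ⟨B₁, h₁⟩ := ih₁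
    obtain ⟨B₂, h₂⟩ := ih₂
    exact ⟨max B₁ B₂, h₁.mono (le_max_left _ _), h₂.mono (le_max_right _ _)⟩
  | fst _ ih => exact ih
  | snd _ ih => exact ih
  | inl _ _ ih => exact ih
  | inr _ _ ih => exact ih
  | case _ _ _ ih₁ ih₂ ih₃ =>
    obtain ⟨B₁, h₁⟩ := ih₁
    obtain ⟨B₂, h₂⟩ := ih₂
    obtain ⟨B₃, h₃⟩ := ih₃
    exact ⟨max B₁ (max B₂ B₃), h₁.mono (le_max_left _ _),
      h₂.mono ((le_max_left _ _).trans (le_max_right _ _)),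
      h₃.mono ((le_max_right _ _).trans (le_max_right _ _))⟩
  | con _ _ ih => exact ih
  | des _ ih => exact ih
  | fold _ _ ih₁ ih₂ =>
    obtain ⟨B₁, h₁⟩ := ih₁
    obtain ⟨B₂, h₂⟩ := ih₂
    exact ⟨max B₁ B₂, h₁.mono (le_max_left _ _), h₂.mono (le_max_right _ _)⟩

/-- `Annot H a V` : the value with root `a` in `H` is represented by `V`, the identifiers being
the addresses. -/
inductive Annot (H : Heap) : ℕ → Cell → Prop
  | unit {a V} : H[a]? = some .unit → Annot H a V
  | pair {a b c A B} : H[a]? = some (.pair b c) → Annot H b A → Annot H c B →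
      Annot H a (node (num a) (node A B))
  | inl {a b A} : H[a]? = some (.inl b) → Annot H b A → Annot H a (node (num a) (node nil A))
  | inr {a b A x y} : H[a]? = some (.inr b) → Annot H b A →
      Annot H a (node (num a) (node (node x y) A))
  | con {a P b A x} : H[a]? = some (.con P b) → Annot H b A → Annot H a (node (num a) (node x A))

namespace Annot

theorem mono {H H' : Heap} (h : H <+: H') {a V} (r : Annot H a V) : Annot H' a V := by
  induction r with
  | unit e => exact .unit (getElem?_of_prefix h e)
  | pair e _ _ i j => exact .pair (getElem?_of_prefix h e) i j
  | inl e _ i => exact .inl (getElem?_of_prefix h e) i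
  | inr e _ i => exact .inr (getElem?_of_prefix h e) i
  | con e _ i => exact .con (getElem?_of_prefix h e) i

theorem pair_inv {H : Heap} {a b c V} (e : H[a]? = some (.pair b c)) (r : Annot H a V) :
    ∃ A B, V = node (num a) (node A B) ∧ Annot H b A ∧ Annot H c B := by
  cases r <;> simp_all

theorem inl_inv {H : Heap} {a b V} (e : H[a]? = some (.inl b)) (r : Annot H a V) :
    ∃ A, V = node (num a) (node nil A) ∧ Annot H b A := by
  cases r <;> simp_all

theorem inr_inv {H : Heap} {a b V} (e : H[a]? = some (.inr b)) (r : Annot H a V) :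
    ∃ x y A, V = node (num a) (node (node x y) A) ∧ Annot H b A := by
  cases r <;> simp_all

theorem con_inv {H : Heap} {a b P V} (e : H[a]? = some (.con P b)) (r : Annot H a V) :
    ∃ x A, V = node (num a) (node x A) ∧ Annot H b A := by
  cases r <;> simp_all

variable {H : Heap} {a b : ℕ} {A B : Cell}

/-- A unit vertex may be represented by any cell, as neither the machine nor the reading inspects
it: created units are `nil`, those of the argument are annotated encodings. -/
theorem append_unit : Annot (H ++ [.unit]) H.length nil := .unit (by simp)

theorem append_pair (ha : Annot H a A) (hb : Annot H b B) :
    Annot (H ++ [.pair a b]) H.length (node (num H.length) (node A B)) :=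
  .pair (by simp) (ha.mono (List.prefix_append _ _)) (hb.mono (List.prefix_append _ _))

theorem append_inl (ha : Annot H a A) :
    Annot (H ++ [.inl a]) H.length (node (num H.length) (node nil A)) :=
  .inl (by simp) (ha.mono (List.prefix_append _ _))

theorem append_inr (ha : Annot H a A) :
    Annot (H ++ [.inr a]) H.length (node (num H.length) (node one A)) :=
  .inr (by simp) (ha.mono (List.prefix_append _ _))

theorem append_con (P : Poly) (ha : Annot H a A) :
    Annot (H ++ [.con P a]) H.length (node (num H.length) (node nil A)) :=
  .con (P := P) (by simp) (ha.mono (List.prefix_append _ _))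

end Annot

abbrev EnvAnnot (H : Heap) (θ : Env) (Θ : List Cell) : Prop := List.Forall₂ (Annot H) θ Θ

theorem EnvAnnot.mono {H H' : Heap} (h : H <+: H') {θ Θ} (r : EnvAnnot H θ Θ) :
    EnvAnnot H' θ Θ :=
  List.Forall₂.imp (fun _ _ => Annot.mono h) r

theorem EnvAnnot.get {H : Heap} {θ : Env} {Θ : List Cell} (r : EnvAnnot H θ Θ) {i a : ℕ}
    (h : θ[i]? = some a) : ∃ V, Θ[i]? = some V ∧ Annot H a V := by
  induction r generalizing i with
  | nil => simp at h
  | cons hr _ ih =>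
    cases i with
    | zero => simp at h; subst h; exact ⟨_, by simp, hr⟩
    | succ i => simp at h; simpa using ih h

/-- `mm` represents the memo table `M`. -/
def MemoRel (H : Heap) (M : Memo) (mm : List (ℕ × Cell)) : Prop :=
  (∀ u, M u = none → mm.find? (fun p => u = p.1) = none) ∧
  ∀ u r, M u = some r → (∃ P c, H[u]? = some (.con P c)) ∧
    ∃ V, mm.find? (fun p => u = p.1) = some (u, V) ∧ Annot H r V

theorem MemoRel.mono {H H' : Heap} (h : H <+: H') {M mm} (m : MemoRel H M mm) :
    MemoRel H' M mm :=
  ⟨m.1, fun u r e =>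
    let ⟨⟨P, c, h₁⟩, V, h₂, h₃⟩ := m.2 u r e
    ⟨⟨P, c, getElem?_of_prefix h h₁⟩, V, h₂, h₃.mono h⟩⟩

theorem MemoRel.empty (H : Heap) : MemoRel H (fun _ => none) [] :=
  ⟨fun _ _ => rfl, fun _ _ h => by simp at h⟩

theorem MemoRel.update {H : Heap} {M mm u P c r V} (m : MemoRel H M mm)
    (hu : H[u]? = some (.con P c)) (hr : Annot H r V) :
    MemoRel H (Function.update M u (some r)) ((u, V) :: mm) := by
  refine ⟨fun w hw => ?_, fun w r' hw => ?_⟩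
  · by_cases e : w = u
    · subst e; simp at hw
    · rw [Function.update_of_ne e] at hw
      simpa [e] using m.1 w hw
  · by_cases e : w = u
    · subst e
      simp only [Function.update_self, Option.some.injEq] at hw
      subst hw
      exact ⟨⟨_, _, hu⟩, V, by simp, hr⟩
    · rw [Function.update_of_ne e] at hw
      simpa [e] using m.2 w r' hw

theorem con_lt_length {H : Heap} {u : ℕ} {x : Node} (h : H[u]? = some x) : u < H.length :=
  (List.getElem?_eq_some_iff.1 h).1

theorem num_length_append (H : Heap) (x : Node) :
    num (H ++ [x]).length = node nil (num H.length) := by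
  simp [num]

variable {K B : ℕ}

mutual
-- Induction on the derivation, with task list, value stack and outer frames arbitrary so that
-- pieces can be chained. The counter stays equal to the length of the heap, so new identifiers are
-- new addresses. A derivation with `n` nodes adds at most `n` vertices and memo entries, whence
-- identifiers and table lengths stay within `K` and look-ups are exact. The factor `B` bounds the
-- machine steps per node: a variable needs its index plus one, any other node at most `7`.
theorem Eval.steps (hB : 7 ≤ B) {H θ e H' a n} : Eval H θ e H' a n → e.Plain B →
    ∀ {Θ}, EnvAnnot H θ Θ → H.length + n ≤ K →
    H <+: H' ∧ H'.length ≤ H.length + n ∧ ∃ V, Annot H' a V ∧ ∀ ts vs fr,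
      Steps K (B * n) (mk (node (node e.code (ofList Θ)) ts) vs (num H.length) fr)
        (mk ts (node V vs) (num H'.length) fr)
  | .var h, hp, Θ, hΘ, hK => by
    obtain ⟨V, h₁, h₂⟩ := hΘ.get h
    refine ⟨List.prefix_rfl, by omega, V, h₂, fun ts vs fr => (steps_var h₁).mono ?_⟩
    simp only [Tm.Plain] at hp
    omega
  | .app h₁ h₀, hp, Θ, hΘ, hK => by
    obtain ⟨p₁, l₁, V₁, a₁, s₁⟩ := h₁.steps hB hp.2 hΘ (by omega)
    obtain ⟨p₀, l₀, V₀, a₀, s₀⟩ := h₀.steps hB hp.1 (.cons a₁ (hΘ.mono p₁)) (by omega)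
    refine ⟨p₁.trans p₀, by omega, V₀, a₀, fun ts vs fr => ?_⟩
    refine (((steps_seq.trans (s₁ _ _ _)).trans steps_bind).trans (s₀ _ _ _)).mono ?_
    simp only [Nat.mul_add, Nat.mul_one]; omega
  | .unit, hp, Θ, hΘ, hK => by
    refine ⟨List.prefix_append _ _, by simp, _, .append_unit, fun ts vs fr => ?_⟩
    rw [num_length_append]
    exact steps_unit.mono (by omega)
  | .pair h₁ h₂, hp, Θ, hΘ, hK => by
    obtain ⟨p₁, l₁, V₁, a₁, s₁⟩ := h₁.steps hB hp.1 hΘ (by omega)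
    obtain ⟨p₂, l₂, V₂, a₂, s₂⟩ := h₂.steps hB hp.2 (hΘ.mono p₁) (by omega)
    refine ⟨(p₁.trans p₂).trans (List.prefix_append _ _), by simp; omega, _,
      .append_pair (a₁.mono p₂) a₂, fun ts vs fr => ?_⟩
    rw [num_length_append]
    refine ((((steps_seq.trans (s₁ _ _ _)).trans steps_seq).trans (s₂ _ _ _)).trans
      steps_pair).mono ?_
    simp only [Nat.mul_add, Nat.mul_one]; omega
  | .fst h e, hp, Θ, hΘ, hK => by
    obtain ⟨p, l, V, a, s⟩ := h.steps hB hp hΘ (by omega)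
    obtain ⟨A, C, rfl, hA, hC⟩ := a.pair_inv e
    refine ⟨p, by omega, A, hA, fun ts vs fr => ?_⟩
    refine ((steps_seq.trans (s _ _ _)).trans steps_fst).mono ?_
    simp only [Nat.mul_add, Nat.mul_one]; omega
  | .snd h e, hp, Θ, hΘ, hK => by
    obtain ⟨p, l, V, a, s⟩ := h.steps hB hp hΘ (by omega)
    obtain ⟨A, C, rfl, hA, hC⟩ := a.pair_inv e
    refine ⟨p, by omega, C, hC, fun ts vs fr => ?_⟩
    refine ((steps_seq.trans (s _ _ _)).trans steps_snd).mono ?_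
    simp only [Nat.mul_add, Nat.mul_one]; omega
  | .inl h, hp, Θ, hΘ, hK => by
    obtain ⟨p, l, V, a, s⟩ := h.steps hB hp hΘ (by omega)
    refine ⟨p.trans (List.prefix_append _ _), by simp; omega, _, a.append_inl, fun ts vs fr => ?_⟩
    rw [num_length_append]
    refine ((steps_seq.trans (s _ _ _)).trans steps_tag).mono ?_
    simp only [Nat.mul_add, Nat.mul_one]; omega
  | .inr h, hp, Θ, hΘ, hK => by
    obtain ⟨p, l, V, a, s⟩ := h.steps hB hp hΘ (by omega)
    refine ⟨p.trans (List.prefix_append _ _), by simp; omega, _, a.append_inr, fun ts vs fr => ?_⟩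
    rw [num_length_append]
    refine ((steps_seq.trans (s _ _ _)).trans steps_tag).mono ?_
    simp only [Nat.mul_add, Nat.mul_one]; omega
  | .caseL h₀ e h₁, hp, Θ, hΘ, hK => by
    obtain ⟨p₀, l₀, V₀, a₀, s₀⟩ := h₀.steps hB hp.1 hΘ (by omega)
    obtain ⟨A, rfl, hA⟩ := a₀.inl_inv e
    obtain ⟨p₁, l₁, V₁, a₁, s₁⟩ := h₁.steps hB hp.2.1 (.cons hA (hΘ.mono p₀)) (by omega)
    refine ⟨p₀.trans p₁, by omega, V₁, a₁, fun ts vs fr => ?_⟩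
    refine ((((steps_seq.trans (s₀ _ _ _)).trans steps_switchL).trans steps_bind).trans
      (s₁ _ _ _)).mono ?_
    simp only [Nat.mul_add, Nat.mul_one]; omega
  | .caseR h₀ e h₁, hp, Θ, hΘ, hK => by
    obtain ⟨p₀, l₀, V₀, a₀, s₀⟩ := h₀.steps hB hp.1 hΘ (by omega)
    obtain ⟨_, _, A, rfl, hA⟩ := a₀.inr_inv e
    obtain ⟨p₁, l₁, V₁, a₁, s₁⟩ := h₁.steps hB hp.2.2 (.cons hA (hΘ.mono p₀)) (by omega)
    refine ⟨p₀.trans p₁, by omega, V₁, a₁, fun ts vs fr => ?_⟩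
    refine ((((steps_seq.trans (s₀ _ _ _)).trans steps_switchR).trans steps_bind).trans
      (s₁ _ _ _)).mono ?_
    simp only [Nat.mul_add, Nat.mul_one]; omega
  | .con h, hp, Θ, hΘ, hK => by
    obtain ⟨p, l, V, a, s⟩ := h.steps hB hp hΘ (by omega)
    refine ⟨p.trans (List.prefix_append _ _), by simp; omega, _, a.append_con _,
      fun ts vs fr => ?_⟩
    rw [num_length_append]
    refine ((steps_seq.trans (s _ _ _)).trans steps_tag).mono ?_
    simp only [Nat.mul_add, Nat.mul_one]; omega
  | .des h e, hp, Θ, hΘ, hK => by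
    obtain ⟨p, l, V, a, s⟩ := h.steps hB hp hΘ (by omega)
    obtain ⟨_, A, rfl, hA⟩ := a.con_inv e
    refine ⟨p, by omega, A, hA, fun ts vs fr => ?_⟩
    refine ((steps_seq.trans (s _ _ _)).trans steps_snd).mono ?_
    simp only [Nat.mul_add, Nat.mul_one]; omega
  | .fold h₁ h₀, hp, Θ, hΘ, hK => by
    obtain ⟨p₁, l₁, V₁, a₁, s₁⟩ := h₁.steps hB hp.2 hΘ (by omega)
    obtain ⟨p₀, V₀, mm, l₀, a₀, -, s₀⟩ :=
      h₀.steps hB hp.1 (hΘ.mono p₁) a₁ (.empty _) (by simp; omega)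
    simp only [List.length_nil] at l₀
    refine ⟨p₁.trans p₀, by omega, V₀, a₀, fun ts vs fr => ?_⟩
    refine ((((((steps_seq.trans (s₁ _ _ _)).trans steps_seq).trans steps_enter).trans
      steps_seq).trans (s₀ _ _ _)).trans steps_leave).mono ?_
    simp only [Nat.mul_add, Nat.mul_one]; omega
theorem FoldAt.steps (hB : 7 ≤ B) {P e₀ θ H M u H' M' r n} : FoldAt P e₀ θ H M u H' M' r n →
    e₀.Plain B → ∀ {Θ U mm}, EnvAnnot H θ Θ → Annot H u U → MemoRel H M mm →
    H.length + mm.length + n ≤ K →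
    H <+: H' ∧ ∃ V mm', H'.length + mm'.length ≤ H.length + mm.length + n ∧ Annot H' r V ∧
      MemoRel H' M' mm' ∧ ∀ ts vs fr,
      Steps K (B * n) (mk (node (node iRec (ofList Θ)) ts) (node U vs) (num H.length)
          (node (node (memoList mm) (iSeq P.code (iBind e₀.code))) fr))
        (mk ts (node V vs) (num H'.length)
          (node (node (memoList mm') (iSeq P.code (iBind e₀.code))) fr))
  | .lookup h, hp, Θ, U, mm, hΘ, hU, hM, hK => by
    -- That memoized vertices are constructors is part of `MemoRel` because only then must the
    -- representing cell carry the address; a unit would be unconstrained.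
    obtain ⟨⟨P, c, hu⟩, V, hf, hV⟩ := hM.2 _ _ h
    obtain ⟨_, A, rfl, hA⟩ := hU.con_inv hu
    have := con_lt_length hu
    have hs := search_memoList (K := K) (u := u) (mm := mm) (by omega) (by omega)
    rw [hf] at hs
    exact ⟨List.prefix_rfl, V, mm, by omega, hV, hM, fun ts vs fr =>
      (steps_recHit hs).mono (by omega)⟩
  | .step h e h₁ h₂, hp, Θ, U, mm, hΘ, hU, hM, hK => by
    obtain ⟨x, A, rfl, hA⟩ := hU.con_inv e
    have := con_lt_length e
    obtain ⟨p₁, V₁, mm₁, l₁, a₁, hM₁, s₁⟩ := h₁.steps hB hp hΘ hA hM (by omega)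
    obtain ⟨p₂, l₂, V₂, a₂, s₂⟩ := h₂.steps hB hp (.cons a₁ (hΘ.mono p₁)) (by omega)
    refine ⟨p₁.trans p₂, V₂, _, ?_, a₂,
      (hM₁.mono p₂).update (getElem?_of_prefix (p₁.trans p₂) e) a₂, fun ts vs fr => ?_⟩
    · simp only [List.length_cons]; omega
    · have hs := search_memoList (K := K) (u := u) (mm := mm) (by omega) (by omega)
      rw [hM.1 _ h] at hs
      refine ((((((steps_recMiss hs).trans steps_seq).trans (s₁ _ _ _)).trans steps_bind).trans
        (s₂ _ _ _)).trans steps_save).mono ?_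
      simp only [Nat.mul_add, Nat.mul_one]; omega
theorem MapAt.steps (hB : 7 ≤ B) {Q P e₀ θ H M c H' M' c' n} : MapAt Q P e₀ θ H M c H' M' c' n →
    e₀.Plain B → ∀ {Θ U mm}, EnvAnnot H θ Θ → Annot H c U → MemoRel H M mm →
    H.length + mm.length + n ≤ K →
    H <+: H' ∧ ∃ V mm', H'.length + mm'.length ≤ H.length + mm.length + n ∧ Annot H' c' V ∧
      MemoRel H' M' mm' ∧ ∀ ts vs fr,
      Steps K (B * n) (mk (node (node Q.code (ofList Θ)) ts) (node U vs) (num H.length)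
          (node (node (memoList mm) (iSeq P.code (iBind e₀.code))) fr))
        (mk ts (node V vs) (num H'.length)
          (node (node (memoList mm') (iSeq P.code (iBind e₀.code))) fr))
  | .id h, hp, Θ, U, mm, hΘ, hU, hM, hK => by
    obtain ⟨p, V, mm', l, a, hM', s⟩ := h.steps hB hp hΘ hU hM (by omega)
    exact ⟨p, V, mm', by omega, a, hM', fun ts vs fr =>
      (s ts vs fr).mono (Nat.mul_le_mul_left _ (Nat.le_succ _))⟩
  | .const, hp, Θ, U, mm, hΘ, hU, hM, hK =>
    ⟨List.prefix_rfl, U, mm, by omega, hU, hM, fun ts vs fr => steps_nop.mono (by omega)⟩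
  | .inl e h, hp, Θ, U, mm, hΘ, hU, hM, hK => by
    obtain ⟨A, rfl, hA⟩ := hU.inl_inv e
    obtain ⟨p, V, mm', l, a, hM', s⟩ := h.steps hB hp hΘ hA hM (by omega)
    refine ⟨p.trans (List.prefix_append _ _), _, mm', by simp; omega, a.append_inl,
      hM'.mono (List.prefix_append _ _), fun ts vs fr => ?_⟩
    rw [num_length_append]
    refine (((steps_switchL.trans steps_seq).trans (s _ _ _)).trans steps_tag).mono ?_
    simp only [Nat.mul_add, Nat.mul_one]; omega
  | .inr e h, hp, Θ, U, mm, hΘ, hU, hM, hK => by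
    obtain ⟨_, _, A, rfl, hA⟩ := hU.inr_inv e
    obtain ⟨p, V, mm', l, a, hM', s⟩ := h.steps hB hp hΘ hA hM (by omega)
    refine ⟨p.trans (List.prefix_append _ _), _, mm', by simp; omega, a.append_inr,
      hM'.mono (List.prefix_append _ _), fun ts vs fr => ?_⟩
    rw [num_length_append]
    refine (((steps_switchR.trans steps_seq).trans (s _ _ _)).trans steps_tag).mono ?_
    simp only [Nat.mul_add, Nat.mul_one]; omega
  | .pair e h₁ h₂, hp, Θ, U, mm, hΘ, hU, hM, hK => by
    obtain ⟨A, C, rfl, hA, hC⟩ := hU.pair_inv e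
    obtain ⟨p₁, V₁, mm₁, l₁, a₁, hM₁, s₁⟩ := h₁.steps hB hp hΘ hA hM (by omega)
    obtain ⟨p₂, V₂, mm₂, l₂, a₂, hM₂, s₂⟩ :=
      h₂.steps hB hp (hΘ.mono p₁) (hC.mono p₁) hM₁ (by omega)
    refine ⟨(p₁.trans p₂).trans (List.prefix_append _ _), _, mm₂, by simp; omega,
      .append_pair (a₁.mono p₂) a₂, hM₂.mono (List.prefix_append _ _), fun ts vs fr => ?_⟩
    rw [num_length_append]
    refine ((((((((steps_seq.trans steps_split).trans steps_seq).trans (s₁ _ _ _)).trans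
      -- This is the case that requires `7`: four sequencings, a split, a swap and a pairing.
      steps_seq).trans steps_swap).trans steps_seq).trans (s₂ _ _ _)).trans steps_pair).mono ?_
    simp only [Nat.mul_add, Nat.mul_one]; omega
end

/-! ### The initial heap -/

mutual
/-- An injective numbering of base types. -/
def Base.label : Base → ℕ
  | .unit => 0
  | .mu P => P.label + 1
/-- An injective numbering of polynomial functors. -/
def Poly.label : Poly → ℕ
  | .id => 0
  | .const N => 3 * N.label + 1
  | .sum P Q => 3 * Nat.pair P.label Q.label + 2
  | .prod P Q => 3 * Nat.pair P.label Q.label + 3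
end

mutual
theorem Base.label_inj : ∀ N N' : Base, N.label = N'.label → N = N'
  | .unit, .unit, _ => rfl
  | .unit, .mu _, h => by simp [Base.label] at h
  | .mu _, .unit, h => by simp [Base.label] at h
  | .mu P, .mu P', h => by
    simp only [Base.label, Nat.add_right_cancel_iff] at h
    rw [Poly.label_inj P P' h]
theorem Poly.label_inj : ∀ P P' : Poly, P.label = P'.label → P = P'
  | .id, P', h => by cases P' <;> simp [Poly.label] at h ⊢
  | .const N, P', h => by
    cases P' with
    | const N' => rw [Base.label_inj N N' (by simp only [Poly.label] at h; omega)]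
    | _ => simp only [Poly.label] at h; omega
  | .sum P Q, P', h => by
    cases P' with
    | sum P' Q' =>
      have h : Nat.pair P.label Q.label = Nat.pair P'.label Q'.label := by
        simp only [Poly.label] at h; omega
      rw [Nat.pair_eq_pair] at h
      rw [Poly.label_inj P P' h.1, Poly.label_inj Q Q' h.2]
    | _ => simp only [Poly.label] at h; omega
  | .prod P Q, P', h => by
    cases P' with
    | prod P' Q' =>
      have h : Nat.pair P.label Q.label = Nat.pair P'.label Q'.label := by
        simp only [Poly.label] at h; omega
      rw [Nat.pair_eq_pair] at h
      rw [Poly.label_inj P P' h.1, Poly.label_inj Q Q' h.2]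
    | _ => simp only [Poly.label] at h; omega
end

/-- An injective encoding of trees as binary trees. -/
def Tree.enc : Tree → Cell
  | .unit => node one nil
  | .pair a b => node a.enc b.enc
  | .inl a => node nil a.enc
  | .inr a => node one a.enc
  | .con P a => node (num (P.label + 2)) a.enc

theorem Tree.enc_ne_nil (t : Tree) : t.enc ≠ nil := by
  cases t <;> simp [Tree.enc]

/-- It keeps pairs, whose encodings start with an encoding, apart from the tagged trees, which start
with a numeral. -/
theorem Tree.enc_ne_num (t : Tree) (n : ℕ) : t.enc ≠ num n := by
  induction t generalizing n with
  | unit => cases n <;> simp [Tree.enc, num, one]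
  | pair a b iha ihb => cases n <;> simp [Tree.enc, num, a.enc_ne_nil]
  | inl a ih => cases n <;> simp [Tree.enc, num, ih]
  | inr a ih => cases n <;> simp [Tree.enc, num, one]
  | con P a ih => cases n <;> simp [Tree.enc, num]

/-- The tags are `0` for left, `1` for right and at least `2` for constructors; the unit shares the
tag `1` but is followed by `nil`, which encodes nothing. Injectivity makes an identifier stand for
one tree only, so that `heapOf` is well defined. -/
theorem Tree.enc_inj (t u : Tree) (h : t.enc = u.enc) : t = u := by
  have h₁ (t : Tree) : t.enc ≠ one := t.enc_ne_num 1
  have h₂ (t : Tree) : one ≠ t.enc := (h₁ t).symm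
  have h₃ (t : Tree) : nil ≠ t.enc := t.enc_ne_nil.symm
  have h₄ (t : Tree) (n : ℕ) : num n ≠ t.enc := (t.enc_ne_num n).symm
  have h₅ : nil ≠ one := by simp [one]
  have h₆ (n : ℕ) : num (n + 2) ≠ one := by simp [num, one]
  have h₇ (n : ℕ) : num (n + 2) ≠ nil := by simp [num]
  induction t generalizing u with
  | unit =>
    cases u <;> simp [Tree.enc, h₂, h₃, h₅.symm, (h₆ _).symm] at h ⊢
  | pair a b iha ihb =>
    cases u <;> simp [Tree.enc, h₁, Tree.enc_ne_nil, Tree.enc_ne_num] at h ⊢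
    exact ⟨iha _ h.1, ihb _ h.2⟩
  | inl a ih =>
    cases u <;> simp [Tree.enc, h₃, h₅, (h₇ _).symm] at h ⊢
    exact ih _ h
  | inr a ih =>
    cases u <;> simp [Tree.enc, h₂, Tree.enc_ne_nil, h₅.symm, (h₆ _).symm] at h ⊢
    exact ih _ h
  | con P a ih =>
    cases u <;> simp [Tree.enc, h₄, h₆, h₇] at h ⊢
    have := num_injective h.1
    exact ⟨Poly.label_inj _ _ (by omega), ih _ h.2⟩

/-- The vertex for the tree `t`, the addresses being the identifiers. -/
noncomputable def nodeOf (S : List Cell) : Tree → Node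
  | .unit => .unit
  | .pair a b => .pair (idx S a.enc) (idx S b.enc)
  | .inl a => .inl (idx S a.enc)
  | .inr a => .inr (idx S a.enc)
  | .con P a => .con P (idx S a.enc)

open Classical in
/-- The heap of the trees with encodings in `S`. -/
noncomputable def heapOf (S : List Cell) : Heap :=
  (List.range (S.length + 1)).map fun i =>
    if h : ∃ t : Tree, t.enc ∈ S ∧ idx S t.enc = i then nodeOf S h.choose else .unit

/-- Identifiers of listed cells start at `1`. Address `0` and the addresses of cells that encode no
tree, such as tags, hold unreferenced units. -/
theorem heapOf_length (S : List Cell) : (heapOf S).length = S.length + 1 := by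
  simp [heapOf]

theorem heapOf_getElem? {S : List Cell} {t : Tree} (h : t.enc ∈ S) :
    (heapOf S)[idx S t.enc]? = some (nodeOf S t) := by
  have hlt : idx S t.enc < S.length + 1 := Nat.lt_succ_of_le (idx_le _ _)
  have hex : ∃ u : Tree, u.enc ∈ S ∧ idx S u.enc = idx S t.enc := ⟨t, h, rfl⟩
  have : hex.choose = t := Tree.enc_inj _ _ (idx_inj hex.choose_spec.1 h hex.choose_spec.2)
  simp [heapOf, List.getElem?_range hlt, dif_pos hex, this]

theorem mem_of_in {S : List Cell} {t : Tree} (h : In S t.enc) : t.enc ∈ S :=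
  h.resolve_left t.enc_ne_nil

theorem heapOf_rep {S : List Cell} (hS : Closed S) (t : Tree) (h : t.enc ∈ S) :
    Rep (heapOf S) (idx S t.enc) t := by
  have e := heapOf_getElem? h
  induction t with
  | unit => exact .unit e
  | pair a b iha ihb =>
    obtain ⟨h₁, h₂⟩ := hS.kids _ _ h
    exact .pair e (iha (mem_of_in h₁) (heapOf_getElem? (mem_of_in h₁)))
      (ihb (mem_of_in h₂) (heapOf_getElem? (mem_of_in h₂)))
  | inl a ih =>
    have h₂ := mem_of_in (hS.kids _ _ h).2
    exact .inl e (ih h₂ (heapOf_getElem? h₂))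
  | inr a ih =>
    have h₂ := mem_of_in (hS.kids _ _ h).2
    exact .inr e (ih h₂ (heapOf_getElem? h₂))
  | con P a ih =>
    have h₂ := mem_of_in (hS.kids _ _ h).2
    exact .con e (ih h₂ (heapOf_getElem? h₂))

/-- The annotation of the left tag is `nil` and that of the right tag is a node, which is all the
machine tests; constructor tags may be any cell. -/
theorem heapOf_annot {S : List Cell} (hS : Closed S) (t : Tree) (h : t.enc ∈ S) :
    Annot (heapOf S) (idx S t.enc) (ann S t.enc) := by
  have e := heapOf_getElem? h
  induction t with
  | unit => exact .unit e
  | pair a b iha ihb =>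
    obtain ⟨h₁, h₂⟩ := hS.kids _ _ h
    exact .pair e (iha (mem_of_in h₁) (heapOf_getElem? (mem_of_in h₁)))
      (ihb (mem_of_in h₂) (heapOf_getElem? (mem_of_in h₂)))
  | inl a ih =>
    have h₂ := mem_of_in (hS.kids _ _ h).2
    exact .inl e (ih h₂ (heapOf_getElem? h₂))
  | inr a ih =>
    have h₂ := mem_of_in (hS.kids _ _ h).2
    exact .inr e (ih h₂ (heapOf_getElem? h₂))
  | con P a ih =>
    have h₂ := mem_of_in (hS.kids _ _ h).2
    exact .con e (ih h₂ (heapOf_getElem? h₂))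

/-! ### The simulation -/

/-- The result of running the code `prog` on the value encoded by `d`. -/
def simulate (prog : Cell) (K : ℕ) (d : Cell) : Cell :=
  ((step K)^[K] (mk (node (node prog (node (annotate K (table K d) d).cdr nil)) nil) nil
    (node nil (table K d).car.car) nil)).cdr.car.car

theorem SDef.simulate (prog : Cell) {K : Cell → ℕ} (hK : Clock K) :
    SDef fun d _ => StructRec.simulate prog (K d) d := by
  have h₁ : SDef fun d _ => Cell.table (K d) d := SDef.table hK
  have h₂ : SDef fun d _ => Cell.annotate (K d) (Cell.table (K d) d) d := (SDef.annotate hK).comp h₁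
  exact .car (.car (.cdr ((hK _ (SDef.step hK)).comp
    (.node (.node (.node (.const prog) (.node h₂.cdr (.const nil))) (.const nil))
      (.node (.const nil) (.node (.node (.const nil) h₁.car.car) (.const nil)))))))

theorem Cell.step_halted (K : ℕ) (vs c fr : Cell) : step K (mk nil vs c fr) = mk nil vs c fr := rfl

theorem Cell.Steps.run {K m : ℕ} {s vs c fr : Cell} (h : Steps K m s (mk nil vs c fr)) (hm : m ≤ K) :
    (step K)^[K] s = mk nil vs c fr := by
  obtain ⟨k, hk, e⟩ := h
  obtain ⟨j, rfl⟩ : ∃ j, K = j + k := ⟨K - k, by omega⟩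
  rw [Function.iterate_add_apply, e, Function.iterate_fixed (step_halted _ _ _ _)]

theorem eval_monotone (q : Polynomial ℕ) : Monotone fun k => q.eval k := by
  intro a b h
  simp only [Polynomial.eval_eq_sum, Polynomial.sum]
  exact Finset.sum_le_sum fun i _ => Nat.mul_le_mul_left _ (Nat.pow_le_pow_left h i)

/-- The machine computes the value of a term of polynomial cost. -/
theorem simulate_spec {e : Tm} {B K : ℕ} {γ : SGround} {q : Polynomial ℕ} {t : Tree}
    (hB : 7 ≤ B) (he : e.Plain B) (ht : TreeTy t γ)
    (hcost : ∀ (H : Heap) (a : ℕ), HasType H a γ →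
      ∃ (H' : Heap) (v n : ℕ), Eval H [a] e H' v n ∧ n ≤ q.eval (size H a))
    (hK₁ : t.enc.tree.csize ≤ K)
    (hK₂ : t.enc.tree.csize + 1 + B * q.eval (t.enc.tree.csize) ≤ K) :
    ∃ H a, Annot H a (simulate e.code K t.enc) ∧ Rep H a (e.den [t]) := by
  set k := t.enc.tree.csize with hk
  have hcard := t.enc.card_subs_le_csize
  obtain ⟨S, hS, hlen, hin, hT, hA⟩ := table_spec (hcard.trans hK₁)
  have hmem := mem_of_in hin
  have hrep := heapOf_rep hS t hmem
  -- The cost hypothesis is applied to the hash-consed heap and not to the graph given as argument;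
  -- its size is bounded by the clock parameter `k`.
  obtain ⟨H', v, n, hev, hn⟩ := hcost _ _ (hrep.hasType ht)
  have hsize : size (heapOf S) (idx S t.enc) ≤ k := by
    have := size_le_length (heapOf S) (idx S t.enc)
    rw [heapOf_length] at this
    omega
  have hn' : B * n ≤ B * q.eval k := Nat.mul_le_mul_left _ (hn.trans (eval_monotone q hsize))
  -- The time bound `B * n` thereby also bounds the growth of the heap and of the memo tables.
  have hnB : n ≤ B * n := Nat.le_mul_of_pos_left _ (by omega)
  obtain ⟨-, -, V, hV, hs⟩ := hev.steps (K := K) hB he (Θ := [ann S t.enc])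
    (.cons (heapOf_annot hS t hmem) .nil) (by rw [heapOf_length]; omega)
  refine ⟨H', v, ?_, (hev.sound (.cons hrep .nil)).2⟩
  have := (hs nil nil nil).run (by omega)
  -- The counter computed from the head of the table is the length of the initial heap.
  rw [heapOf_length, ← next_table hS] at this
  rw [simulate, hA, hT]
  simp only [cdr_node]
  simp only [ofList] at this
  rw [this]
  exact hV

/-! ### Encoding terms -/

/-- The closed term for a binary tree. -/
def Cell.quote : Cell → Tm
  | .nil => nilTm
  | .node l r => nodeTm l.quote r.quote

theorem Cell.quote_typing (Γ : List RGround) (c : Cell) : RTyping Γ c.quote (.ground cellS) := by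
  induction c with
  | nil => exact nilTm_typing Γ
  | node l r ihl ihr => exact nodeTm_typing ihl ihr

theorem Cell.quote_den (ρ : List Tree) (c : Cell) : c.quote.den ρ = c.tree := by
  induction c with
  | nil => rfl
  | node l r ihl ihr => rw [quote, nodeTm_den, ihl, ihr]; rfl

theorem Poly.Inhab.ok_rApp {P : Poly} (h : P.Inhab) {γ : RGround} (hγ : γ.Ok) :
    RGround.Ok (P.rApp γ) := by
  induction P using Poly.rec (motive_1 := fun _ => True) with
  | id => exact hγ
  | const N => exact h
  | sum P Q ihP ihQ => exact ⟨ihP h.1, ihQ h.2⟩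
  | prod P Q ihP ihQ => exact ⟨ihP h.1, ihQ h.2⟩
  | _ => trivial

theorem Poly.Inhab.ok_app {P : Poly} (h : P.Inhab) {γ : SGround} (hγ : γ.Ok) :
    SGround.Ok (P.app (fun N => N) γ) := by
  induction P using Poly.rec (motive_1 := fun _ => True) with
  | id => exact hγ
  | const N => exact h
  | sum P Q ihP ihQ => exact ⟨ihP h.1, ihQ h.2⟩
  | prod P Q ihP ihQ => exact ⟨ihP h.1, ihQ h.2⟩
  | _ => trivial

mutual
/-- The term encoding the normal variable `0` of base type. -/
def Base.encTm : Base → Tm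
  | .unit => (Tree.enc .unit).quote
  | .mu P => .fold P (.lam (nodeTm (num (P.label + 2)).quote P.encTm)) (.var 0)
/-- The term encoding the variable `0`, in which the recursive components are encoded already. -/
def Poly.encTm : Poly → Tm
  | .id => .var 0
  | .const N => N.encTm
  | .sum P Q => .case (.var 0) (nodeTm nilTm P.encTm) (nodeTm one.quote Q.encTm)
  | .prod P Q => nodeTm (.app (.lam P.encTm) (.fst (.var 0))) (.app (.lam Q.encTm) (.snd (.var 0)))
end

mutual
theorem Base.encTm_typing : ∀ {N : Base}, N.Inhab → ∀ Γ : List RGround,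
    RTyping (.base (.norm N) :: Γ) N.encTm (.ground cellS)
  | .unit, _, _ => quote_typing _ _
  | .mu _, h, _ => .fold (γ := cellS) (.lam (h.1.ok_rApp cellS_ok)
      (nodeTm_typing (quote_typing _ _) (Poly.encTm_typing h.1 _))) (.var rfl)
theorem Poly.encTm_typing : ∀ {P : Poly}, P.Inhab → ∀ Γ : List RGround,
    RTyping (P.rApp cellS :: Γ) P.encTm (.ground cellS)
  | .id, _, _ => .var rfl
  | .const _, h, Γ => Base.encTm_typing h Γ
  | .sum P Q, h, _ => .case (γ₁ := P.rApp cellS) (γ₂ := Q.rApp cellS) (.inr trivial) (.var rfl)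
      (nodeTm_typing (nilTm_typing _) (Poly.encTm_typing h.1 _))
      (nodeTm_typing (quote_typing _ _) (Poly.encTm_typing h.2 _))
  | .prod P Q, h, _ => nodeTm_typing
      (.app (.lam (h.1.ok_rApp cellS_ok) (Poly.encTm_typing h.1 _))
        (.fst (γ₂ := Q.rApp cellS) (.var rfl)))
      (.app (.lam (h.2.ok_rApp cellS_ok) (Poly.encTm_typing h.2 _))
        (.snd (γ₁ := P.rApp cellS) (.var rfl)))
end

/-- The second claim handles the encoding halfway through a functor `Q` inside the fold over `P`.
The environment `ρ'` is that of the fold and `ρ` that at the current place; the encoding depends on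
neither. -/
theorem encTm_den (t : Tree) :
    (∀ N ρ, TreeTy t (.base N) → N.encTm.den (t :: ρ) = t.enc.tree) ∧
    ∀ (P Q : Poly) ρ ρ', TreeTy t (Q.app (fun N => N) (.base (.mu P))) →
      Q.encTm.den (t.mapFold P (fun s =>
        (nodeTm (num (P.label + 2)).quote P.encTm).den (s :: ρ')) Q :: ρ) = t.enc.tree := by
  induction t with
  | unit =>
    have h (N ρ) (h : TreeTy .unit (.base N)) : N.encTm.den (.unit :: ρ) =
        (Tree.enc .unit).tree := by
      cases h
      exact quote_den _ _
    refine ⟨h, fun P Q ρ ρ' ht => ?_⟩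
    cases Q <;> simp only [Poly.app] at ht
    · cases ht
    · exact h _ _ ht
    · cases ht
    · cases ht
  | pair a b iha ihb =>
    refine ⟨fun N ρ ht => (nomatch ht), fun P Q ρ ρ' ht => ?_⟩
    cases Q <;> simp only [Poly.app] at ht <;> cases ht
    rename_i h₁ h₂
    simp only [Tree.mapFold, Poly.encTm, nodeTm_den, Tree.enc, Cell.tree]
    exact congrArg₂ (fun x y => Tree.con cellP (.inr (.pair x y)))
      (iha.2 _ _ _ _ h₁) (ihb.2 _ _ _ _ h₂)
  | inl a ih =>
    refine ⟨fun N ρ ht => (nomatch ht), fun P Q ρ ρ' ht => ?_⟩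
    cases Q <;> simp only [Poly.app] at ht <;> cases ht
    rename_i h₁
    exact congrArg (fun x => Tree.con cellP (.inr (.pair nil.tree x))) (ih.2 _ _ _ _ h₁)
  | inr a ih =>
    refine ⟨fun N ρ ht => (nomatch ht), fun P Q ρ ρ' ht => ?_⟩
    cases Q <;> simp only [Poly.app] at ht <;> cases ht
    rename_i h₁
    exact congrArg (fun x => Tree.con cellP (.inr (.pair one.tree x))) (ih.2 _ _ _ _ h₁)
  | con P' a ih =>
    have key (P ρ ρ') (ht : TreeTy (.con P' a) (.base (.mu P))) :
        (nodeTm (num (P.label + 2)).quote P.encTm).den ((a.mapFold P (fun s =>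
        (nodeTm (num (P.label + 2)).quote P.encTm).den (s :: ρ')) P) :: ρ) =
          (Tree.enc (.con P' a)).tree := by
      cases ht
      rename_i h
      rw [nodeTm_den, quote_den, ih.2 _ _ _ _ h]
      rfl
    have h (N ρ) (h : TreeTy (.con P' a) (.base N)) : N.encTm.den (.con P' a :: ρ) =
        (Tree.enc (.con P' a)).tree := by
      cases N with
      | unit => cases h
      | mu P => exact key P (.con P' a :: ρ) (.con P' a :: ρ) h
    refine ⟨h, fun P Q ρ ρ' ht => ?_⟩
    cases Q <;> simp only [Poly.app] at ht
    · exact key P ρ' ρ' ht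
    · exact h _ _ ht
    · cases ht
    · cases ht

/-- The term encoding the normal variable `0` of ground type. -/
def Ground.encTm : SGround → Tm
  | .base N => N.encTm
  | .sum γ₁ γ₂ =>
    .case (.var 0) (nodeTm nilTm (Ground.encTm γ₁)) (nodeTm one.quote (Ground.encTm γ₂))
  | .prod γ₁ γ₂ => nodeTm (.app (.lam (Ground.encTm γ₁)) (.fst (.var 0)))
      (.app (.lam (Ground.encTm γ₂)) (.snd (.var 0)))

theorem SGround.Ok.toR {γ : SGround} (h : γ.Ok) : γ.toR.Ok := by
  induction γ with
  | base N => exact h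
  | sum γ₁ γ₂ ih₁ ih₂ => exact ⟨ih₁ h.1, ih₂ h.2⟩
  | prod γ₁ γ₂ ih₁ ih₂ => exact ⟨ih₁ h.1, ih₂ h.2⟩

theorem Ground.encTm_typing {γ : SGround} (h : γ.Ok) (Γ : List RGround) :
    RTyping (γ.toR :: Γ) (Ground.encTm γ) (.ground cellS) := by
  induction γ generalizing Γ with
  | base N => exact Base.encTm_typing h Γ
  | sum γ₁ γ₂ ih₁ ih₂ =>
    exact .case (γ₁ := SGround.toR γ₁) (γ₂ := SGround.toR γ₂) (.inr trivial) (.var rfl)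
      (nodeTm_typing (nilTm_typing _) (ih₁ h.1 _)) (nodeTm_typing (quote_typing _ _) (ih₂ h.2 _))
  | prod γ₁ γ₂ ih₁ ih₂ =>
    have h₁ : SGround.Ok γ₁ := h.1
    have h₂ : SGround.Ok γ₂ := h.2
    exact nodeTm_typing
      (.app (.lam h₁.toR (ih₁ h₁ _)) (.fst (γ₂ := SGround.toR γ₂) (.var rfl)))
      (.app (.lam h₂.toR (ih₂ h₂ _)) (.snd (γ₁ := SGround.toR γ₁) (.var rfl)))

theorem Ground.encTm_den {γ : SGround} {t : Tree} (h : TreeTy t γ) (ρ : List Tree) :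
    (Ground.encTm γ).den (t :: ρ) = t.enc.tree := by
  induction h generalizing ρ with
  | unit => exact quote_den _ _
  | pair _ _ ih₁ ih₂ =>
    exact congrArg₂ (fun x y => Tree.con cellP (.inr (.pair x y))) (ih₁ _) (ih₂ _)
  | inl _ ih => exact congrArg (fun x => Tree.con cellP (.inr (.pair nil.tree x))) (ih _)
  | inr _ ih => exact congrArg (fun x => Tree.con cellP (.inr (.pair one.tree x))) (ih _)
  | con h _ => exact (StructRec.encTm_den _).1 _ _ (.con h)

/-! ### Component types -/

mutual
/-- The types of the components of values of a base type. -/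
def Base.tys : Base → List SGround
  | .unit => [.base .unit]
  | .mu P => .base (.mu P) :: P.tys (.mu P)
/-- The types of the components of values of type `P(N)`, apart from those of type `N`. -/
def Poly.tys : Poly → Base → List SGround
  | .id, _ => []
  | .const M, _ => M.tys
  | .sum P Q, N => (Poly.sum P Q).app (fun N => N) (.base N) :: (P.tys N ++ Q.tys N)
  | .prod P Q, N => (Poly.prod P Q).app (fun N => N) (.base N) :: (P.tys N ++ Q.tys N)
end

def Ground.tys : SGround → List SGround
  | .base N => N.tys
  | .sum γ₁ γ₂ => .sum γ₁ γ₂ :: (Ground.tys γ₁ ++ Ground.tys γ₂)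
  | .prod γ₁ γ₂ => .prod γ₁ γ₂ :: (Ground.tys γ₁ ++ Ground.tys γ₂)

/-- The immediate component types of `γ` belong to `L`. -/
def Ground.KidsIn (L : List SGround) : SGround → Prop
  | .base .unit => True
  | .base (.mu P) => P.app (fun N => N) (.base (.mu P)) ∈ L
  | .sum γ₁ γ₂ => γ₁ ∈ L ∧ γ₂ ∈ L
  | .prod γ₁ γ₂ => γ₁ ∈ L ∧ γ₂ ∈ L

theorem Base.mem_tys (N : Base) : .base N ∈ N.tys := by
  cases N <;> simp [Base.tys]

theorem Poly.mem_tys (P : Poly) (N : Base) {L : List SGround} (hN : .base N ∈ L)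
    (h : P.tys N ⊆ L) : P.app (fun N => N) (.base N) ∈ L := by
  cases P with
  | id => exact hN
  | const M => exact h M.mem_tys
  | sum P Q => exact h (by simp [Poly.tys])
  | prod P Q => exact h (by simp [Poly.tys])

theorem Ground.mem_tys (γ : SGround) : γ ∈ Ground.tys γ := by
  cases γ with
  | base N => exact N.mem_tys
  | sum => simp [Ground.tys]
  | prod => simp [Ground.tys]

mutual
-- Components of `P(μP)` lead back to `μP`, which stands elsewhere in the list; hence membership is
-- stated for an ambient list `L` containing the one considered.
theorem Base.tys_closed {L : List SGround} : ∀ {N : Base}, N.tys ⊆ L →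
    ∀ γ ∈ N.tys, Ground.KidsIn L γ
  | .unit, _, γ, hγ => by
    simp only [Base.tys, List.mem_singleton] at hγ
    subst hγ
    trivial
  | .mu P, h, γ, hγ => by
    simp only [Base.tys, List.cons_subset] at h
    rcases List.mem_cons.1 hγ with rfl | hγ
    · exact P.mem_tys _ h.1 h.2
    · exact Poly.tys_closed h.1 h.2 γ hγ
theorem Poly.tys_closed {L : List SGround} : ∀ {P : Poly} {N : Base}, .base N ∈ L → P.tys N ⊆ L →
    ∀ γ ∈ P.tys N, Ground.KidsIn L γ
  | .id, _, _, _, γ, hγ => by simp [Poly.tys] at hγ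
  | .const _, _, _, h, γ, hγ => Base.tys_closed h γ hγ
  | .sum P Q, N, hN, h, γ, hγ => by
    simp only [Poly.tys, List.cons_subset, List.append_subset] at h
    simp only [Poly.tys, List.mem_cons, List.mem_append] at hγ
    rcases hγ with rfl | hγ | hγ
    · exact ⟨P.mem_tys _ hN h.2.1, Q.mem_tys _ hN h.2.2⟩
    · exact Poly.tys_closed hN h.2.1 γ hγ
    · exact Poly.tys_closed hN h.2.2 γ hγ
  | .prod P Q, N, hN, h, γ, hγ => by
    simp only [Poly.tys, List.cons_subset, List.append_subset] at h
    simp only [Poly.tys, List.mem_cons, List.mem_append] at hγ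
    rcases hγ with rfl | hγ | hγ
    · exact ⟨P.mem_tys _ hN h.2.1, Q.mem_tys _ hN h.2.2⟩
    · exact Poly.tys_closed hN h.2.1 γ hγ
    · exact Poly.tys_closed hN h.2.2 γ hγ
end

theorem Ground.tys_closed {L : List SGround} {δ : SGround} (h : Ground.tys δ ⊆ L) :
    ∀ γ ∈ Ground.tys δ, Ground.KidsIn L γ := by
  induction δ with
  | base N => exact Base.tys_closed h
  | sum γ₁ γ₂ ih₁ ih₂ =>
    intro γ hγ
    simp only [Ground.tys, List.cons_subset, List.append_subset] at h
    simp only [Ground.tys, List.mem_cons, List.mem_append] at hγ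
    rcases hγ with rfl | hγ | hγ
    · exact ⟨h.2.1 (Ground.mem_tys _), h.2.2 (Ground.mem_tys _)⟩
    · exact ih₁ h.2.1 γ hγ
    · exact ih₂ h.2.2 γ hγ
  | prod γ₁ γ₂ ih₁ ih₂ =>
    intro γ hγ
    simp only [Ground.tys, List.cons_subset, List.append_subset] at h
    simp only [Ground.tys, List.mem_cons, List.mem_append] at hγ
    rcases hγ with rfl | hγ | hγ
    · exact ⟨h.2.1 (Ground.mem_tys _), h.2.2 (Ground.mem_tys _)⟩
    · exact ih₁ h.2.1 γ hγ
    · exact ih₂ h.2.2 γ hγ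

mutual
theorem Base.tys_ok : ∀ {N : Base}, N.Inhab → ∀ γ ∈ N.tys, SGround.Ok γ
  | .unit, _, γ, hγ => by
    simp only [Base.tys, List.mem_singleton] at hγ
    subst hγ
    trivial
  | .mu P, h, γ, hγ => by
    rcases List.mem_cons.1 hγ with rfl | hγ
    · exact h
    · exact Poly.tys_ok h.1 h γ hγ
theorem Poly.tys_ok : ∀ {P : Poly} {N : Base}, P.Inhab → N.Inhab → ∀ γ ∈ P.tys N, SGround.Ok γ
  | .id, _, _, _, γ, hγ => by simp [Poly.tys] at hγ
  | .const _, _, h, _, γ, hγ => Base.tys_ok h γ hγ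
  | .sum P Q, N, h, hN, γ, hγ => by
    simp only [Poly.tys, List.mem_cons, List.mem_append] at hγ
    rcases hγ with rfl | hγ | hγ
    · exact Poly.Inhab.ok_app h hN
    · exact Poly.tys_ok h.1 hN γ hγ
    · exact Poly.tys_ok h.2 hN γ hγ
  | .prod P Q, N, h, hN, γ, hγ => by
    simp only [Poly.tys, List.mem_cons, List.mem_append] at hγ
    rcases hγ with rfl | hγ | hγ
    · exact Poly.Inhab.ok_app h hN
    · exact Poly.tys_ok h.1 hN γ hγ
    · exact Poly.tys_ok h.2 hN γ hγ
end

theorem Ground.tys_ok {δ : SGround} (h : δ.Ok) : ∀ γ ∈ Ground.tys δ, SGround.Ok γ := by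
  induction δ with
  | base N => exact Base.tys_ok h
  | sum γ₁ γ₂ ih₁ ih₂ =>
    intro γ hγ
    simp only [Ground.tys, List.mem_cons, List.mem_append] at hγ
    rcases hγ with rfl | hγ | hγ
    · exact h
    · exact ih₁ h.1 γ hγ
    · exact ih₂ h.2 γ hγ
  | prod γ₁ γ₂ ih₁ ih₂ =>
    intro γ hγ
    simp only [Ground.tys, List.mem_cons, List.mem_append] at hγ
    rcases hγ with rfl | hγ | hγ
    · exact h
    · exact ih₁ h.1 γ hγ
    · exact ih₂ h.2 γ hγ

/-! ### Safe types and default values -/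

/-- The safe version of an `S₁⁻` type. -/
def SGround.toS (γ : SGround) : RGround := γ.toR.toSafe

theorem SGround.Ok.toS {γ : SGround} (h : γ.Ok) : γ.toS.Ok := by
  induction γ with
  | base N => exact h
  | sum γ₁ γ₂ ih₁ ih₂ => exact ⟨ih₁ h.1, ih₂ h.2⟩
  | prod γ₁ γ₂ ih₁ ih₂ => exact ⟨ih₁ h.1, ih₂ h.2⟩

theorem SGround.toS_isSafe (γ : SGround) : γ.toS.IsSafe := by
  induction γ with
  | base N => trivial
  | sum γ₁ γ₂ ih₁ ih₂ => exact ⟨ih₁, ih₂⟩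
  | prod γ₁ γ₂ ih₁ ih₂ => exact ⟨ih₁, ih₂⟩

theorem SGround.toNorm_toS (γ : SGround) : γ.toS.toNorm = γ.toR := by
  induction γ with
  | base N => rfl
  | sum γ₁ γ₂ ih₁ ih₂ => exact congrArg₂ Ground.sum ih₁ ih₂
  | prod γ₁ γ₂ ih₁ ih₂ => exact congrArg₂ Ground.prod ih₁ ih₂

theorem SGround.toR_isNormal (γ : SGround) : γ.toR.IsNormal := by
  induction γ with
  | base N => trivial
  | sum γ₁ γ₂ ih₁ ih₂ => exact ⟨ih₁, ih₂⟩
  | prod γ₁ γ₂ ih₁ ih₂ => exact ⟨ih₁, ih₂⟩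

theorem SGround.under_toS (γ : SGround) : γ.toS.under = γ := by
  simp [SGround.toS]

theorem Poly.toS_app (P : Poly) (γ : SGround) :
    SGround.toS (P.app (fun N => N) γ) = (P.rApp γ.toR).toSafe := by
  unfold SGround.toS
  congr 1
  induction P using Poly.rec (motive_1 := fun _ => True) with
  | id => rfl
  | const N => rfl
  | sum P Q ihP ihQ => exact congrArg₂ Ground.sum ihP ihQ
  | prod P Q ihP ihQ => exact congrArg₂ Ground.prod ihP ihQ
  | _ => trivial

mutual
-- The reading has to return something at every type and every cell, including cells that represent
-- no value of that type. This is where the exclusion of empty types enters: a value can be built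
-- from `P ∅`, so the recursive positions, of arbitrary type `δ`, are never reached.
theorem Base.exists_default : ∀ {N : Base}, N.Inhab →
    ∃ e, ∀ Γ, RTyping Γ e (.ground (.base (.safe N)))
  | .unit, _ => ⟨.toSafe .unit, fun _ => .toSafe .unit⟩
  | .mu P, h => by
    obtain ⟨e, he⟩ := Poly.exists_default h.1 h.2 (show SGround.Ok (.base (.mu P)) from h)
    refine ⟨.conS P e, fun Γ => .conS h ?_⟩
    have := he Γ
    rwa [Poly.toS_app] at this
theorem Poly.exists_default : ∀ {P : Poly}, P.Inhab → P.Base0 → ∀ {δ : SGround}, δ.Ok →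
    ∃ e, ∀ Γ, RTyping Γ e (.ground (SGround.toS (P.app (fun N => N) δ)))
  | .id, _, h, _, _ => h.elim
  | .const _, h, _, _, _ => Base.exists_default h
  | .sum P Q, h, h', δ, hδ => by
    rcases h' with h' | h'
    · obtain ⟨e, he⟩ := Poly.exists_default h.1 h' hδ
      exact ⟨.inl e, fun Γ => .inl (SGround.Ok.toS (Poly.Inhab.ok_app h.2 hδ)) (he Γ)⟩
    · obtain ⟨e, he⟩ := Poly.exists_default h.2 h' hδ
      exact ⟨.inr e, fun Γ => .inr (SGround.Ok.toS (Poly.Inhab.ok_app h.1 hδ)) (he Γ)⟩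
  | .prod P Q, h, h', δ, hδ => by
    obtain ⟨e₁, h₁⟩ := Poly.exists_default h.1 h'.1 hδ
    obtain ⟨e₂, h₂⟩ := Poly.exists_default h.2 h'.2 hδ
    exact ⟨.pair e₁ e₂, fun Γ => .pair (h₁ Γ) (h₂ Γ)⟩
end

theorem SGround.Ok.exists_default {γ : SGround} (h : γ.Ok) :
    ∃ e, ∀ Γ, RTyping Γ e (.ground γ.toS) := by
  induction γ with
  | base N => exact Base.exists_default h
  | sum γ₁ γ₂ ih₁ ih₂ =>
    obtain ⟨e, he⟩ := ih₁ h.1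
    exact ⟨.inl e, fun Γ => .inl (SGround.Ok.toS h.2) (he Γ)⟩
  | prod γ₁ γ₂ ih₁ ih₂ =>
    obtain ⟨e₁, h₁⟩ := ih₁ h.1
    obtain ⟨e₂, h₂⟩ := ih₂ h.2
    exact ⟨.pair e₁ e₂, fun Γ => .pair (h₁ Γ) (h₂ Γ)⟩

/-! ### Tuples -/

/-- The type of tuples with one safe component for each type in the list. -/
def tupTy : List SGround → RGround
  | [] => .base (.safe .unit)
  | γ :: L => .prod γ.toS (tupTy L)

def tupTm (c : SGround → Tm) : List SGround → Tm
  | [] => .toSafe .unit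
  | γ :: L => .pair (c γ) (tupTm c L)

open Classical in
noncomputable def projTm : List SGround → SGround → Tm → Tm
  | [], _, e => e
  | δ :: L, γ, e => if δ = γ then .fst e else projTm L γ (.snd e)

open Classical in
noncomputable def Tree.proj : List SGround → SGround → Tree → Tree
  | [], _, t => t
  | δ :: L, γ, t => if δ = γ then t.fst else Tree.proj L γ t.snd

theorem projTm_den (L : List SGround) (γ : SGround) (e : Tm) (ρ : List Tree) :
    (projTm L γ e).den ρ = (e.den ρ).proj L γ := by
  induction L generalizing e with
  | nil => rfl
  | cons δ L ih =>
    simp only [projTm, Tree.proj]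
    split
    · rfl
    · rw [ih]; rfl

theorem proj_tupTm {L : List SGround} {γ : SGround} (h : γ ∈ L) (c : SGround → Tm)
    (ρ : List Tree) : ((tupTm c L).den ρ).proj L γ = (c γ).den ρ := by
  induction L with
  | nil => simp at h
  | cons δ L ih =>
    simp only [tupTm, Tm.den, Tree.proj, Tree.fst, Tree.snd]
    split
    · subst_vars; rfl
    · rename_i hne
      exact ih ((List.mem_cons.1 h).resolve_left (Ne.symm hne))

theorem projTm_typing {L : List SGround} {γ : SGround} (h : γ ∈ L) {Γ : List RGround} {e : Tm}
    (he : RTyping Γ e (.ground (tupTy L))) : RTyping Γ (projTm L γ e) (.ground γ.toS) := by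
  induction L generalizing e with
  | nil => simp at h
  | cons δ L ih =>
    simp only [projTm]
    split
    · subst_vars; exact .fst he
    · rename_i hne
      exact ih ((List.mem_cons.1 h).resolve_left (Ne.symm hne)) (.snd he)

theorem tupTm_typing {L : List SGround} {Γ : List RGround} {c : SGround → Tm}
    (h : ∀ γ ∈ L, RTyping Γ (c γ) (.ground γ.toS)) :
    RTyping Γ (tupTm c L) (.ground (tupTy L)) := by
  induction L with
  | nil => exact .toSafe .unit
  | cons δ L ih =>
    exact .pair (h δ List.mem_cons_self) (ih fun γ hγ => h γ (List.mem_cons_of_mem _ hγ))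

/-- The typing rule gives a fold a type of the form `γ.toSafe`; tuples of safe types have this form
already. -/
theorem tupTy_toSafe (L : List SGround) : (tupTy L).toSafe = tupTy L := by
  have h (γ : SGround) : γ.toS.toSafe = γ.toS := by
    induction γ with
    | base N => rfl
    | sum γ₁ γ₂ ih₁ ih₂ => exact congrArg₂ Ground.sum ih₁ ih₂
    | prod γ₁ γ₂ ih₁ ih₂ => exact congrArg₂ Ground.prod ih₁ ih₂
  induction L with
  | nil => rfl
  | cons γ L ih => exact congrArg₂ Ground.prod (h γ) ih

theorem tupTy_isSafe (L : List SGround) : (tupTy L).IsSafe := by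
  induction L with
  | nil => trivial
  | cons γ L ih => exact ⟨γ.toS_isSafe, ih⟩

theorem tupTy_ok {L : List SGround} (h : ∀ γ ∈ L, SGround.Ok γ) : (tupTy L).Ok := by
  induction L with
  | nil => trivial
  | cons γ L ih =>
    exact ⟨(h γ List.mem_cons_self).toS, ih fun γ hγ => h γ (List.mem_cons_of_mem _ hγ)⟩

/-! ### Reading values back -/

abbrev bitTy : RGround := .sum (.base (.safe .unit)) (.base (.safe .unit))

/-- The type of the results at the cells of a representation: whether the cell is `nil`, the
readings of the cell as a value, and those as the content of a value. -/
abbrev readTy (L : List SGround) : RGround := .prod bitTy (.prod (tupTy L) (tupTy L))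

/-- The reading of the cell `node l r` as the content of a value of type `γ`, the results at `l`
and `r` being the components of the variable `0`. -/
noncomputable def contentTm (L : List SGround) : SGround → Tm
  | .base .unit => .toSafe .unit
  | .base (.mu P) => .conS P (projTm L (P.app (fun N => N) (.base (.mu P)))
      (.fst (.snd (.snd (.var 0)))))
  | .sum γ₁ γ₂ => .case (.fst (.fst (.var 0)))
      (.inl (projTm L γ₁ (.fst (.snd (.snd (.var 1))))))
      (.inr (projTm L γ₂ (.fst (.snd (.snd (.var 1))))))
  | .prod γ₁ γ₂ => .pair (projTm L γ₁ (.fst (.snd (.fst (.var 0)))))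
      (projTm L γ₂ (.fst (.snd (.snd (.var 0)))))

/-- The step function of the reading. -/
noncomputable def readStepTm (L : List SGround) (dflt : SGround → Tm) : Tm :=
  .case (.var 0)
    (.pair (.inl (.toSafe .unit)) (.pair (tupTm dflt L) (tupTm dflt L)))
    -- In a value `node i c` the left part is only the identifier, so the reading as a value is the
    -- content reading already found at the right part.
    (.pair (.inr (.toSafe .unit)) (.pair (.snd (.snd (.snd (.var 0)))) (tupTm (contentTm L) L)))

/-- A fold sees only the results at the two children and not the type at which a cell will be
needed. It therefore computes the readings at all component types, both as a value and as a content.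
-/
noncomputable def readTm (L : List SGround) (dflt : SGround → Tm) : Tm :=
  .fold cellP (.lam (readStepTm L dflt)) (.var 0)

section
variable {L : List SGround} {dflt : SGround → Tm}

theorem contentTm_typing (hk : ∀ γ ∈ L, Ground.KidsIn L γ) (hok : ∀ γ ∈ L, SGround.Ok γ)
    (Γ : List RGround) {γ : SGround} (hγ : γ ∈ L) :
    RTyping (.prod (readTy L) (readTy L) :: Γ) (contentTm L γ) (.ground γ.toS) := by
  have h := hk γ hγ
  have ho := hok γ hγ
  match γ with
  | .base .unit => exact .toSafe .unit
  | .base (.mu P) =>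
    refine .conS ho ?_
    have := projTm_typing (Γ := .prod (readTy L) (readTy L) :: Γ)
      (e := .fst (.snd (.snd (.var 0)))) h
      (.fst (γ₂ := tupTy L) (.snd (γ₁ := bitTy) (.snd (γ₁ := readTy L) (.var rfl))))
    rwa [Poly.toS_app] at this
  | .sum γ₁ γ₂ =>
    refine .case (γ₁ := .base (.safe .unit)) (γ₂ := .base (.safe .unit))
      (.inr (SGround.toS_isSafe _))
      (.fst (γ₂ := .prod (tupTy L) (tupTy L)) (.fst (γ₂ := readTy L) (.var rfl)))
      (.inl (SGround.Ok.toS ho.2) (projTm_typing h.1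
        (.fst (γ₂ := tupTy L) (.snd (γ₁ := bitTy) (.snd (γ₁ := readTy L) (.var rfl))))))
      (.inr (SGround.Ok.toS ho.1) (projTm_typing h.2
        (.fst (γ₂ := tupTy L) (.snd (γ₁ := bitTy) (.snd (γ₁ := readTy L) (.var rfl))))))
  | .prod γ₁ γ₂ =>
    exact .pair
      (projTm_typing h.1
        (.fst (γ₂ := tupTy L) (.snd (γ₁ := bitTy) (.fst (γ₂ := readTy L) (.var rfl)))))
      (projTm_typing h.2
        (.fst (γ₂ := tupTy L) (.snd (γ₁ := bitTy) (.snd (γ₁ := readTy L) (.var rfl)))))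

theorem readStepTm_typing (hk : ∀ γ ∈ L, Ground.KidsIn L γ) (hok : ∀ γ ∈ L, SGround.Ok γ)
    (hd : ∀ γ ∈ L, ∀ Γ, RTyping Γ (dflt γ) (.ground γ.toS)) (Γ : List RGround) :
    RTyping Γ (.lam (readStepTm L dflt)) (.arr (cellP.rApp (readTy L)) (readTy L)) := by
  have hr : RGround.Ok (readTy L) := ⟨⟨trivial, trivial⟩, tupTy_ok hok, tupTy_ok hok⟩
  refine .lam ⟨trivial, hr, hr⟩ ?_
  refine .case (γ₁ := .base (.norm .unit)) (γ₂ := .prod (readTy L) (readTy L))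
    (.inr ⟨⟨trivial, trivial⟩, tupTy_isSafe L, tupTy_isSafe L⟩) (.var rfl) ?_ ?_
  · exact .pair (.inl trivial (.toSafe .unit))
      (.pair (tupTm_typing fun γ hγ => hd γ hγ _) (tupTm_typing fun γ hγ => hd γ hγ _))
  · exact .pair (.inr trivial (.toSafe .unit))
      (.pair (.snd (γ₁ := tupTy L) (.snd (γ₁ := bitTy) (.snd (γ₁ := readTy L) (.var rfl))))
        (tupTm_typing fun γ hγ => contentTm_typing hk hok _ hγ))

theorem readTm_typing (hk : ∀ γ ∈ L, Ground.KidsIn L γ) (hok : ∀ γ ∈ L, SGround.Ok γ)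
    (hd : ∀ γ ∈ L, ∀ Γ, RTyping Γ (dflt γ) (.ground γ.toS)) (Γ : List RGround) :
    RTyping (cellN :: Γ) (readTm L dflt) (.ground (readTy L)) := by
  have hs : (readTy L).toSafe = readTy L :=
    congrArg₂ Ground.prod rfl (congrArg₂ Ground.prod (tupTy_toSafe L) (tupTy_toSafe L))
  have := RTyping.fold (Γ := cellN :: Γ) (P := cellP) (e₀ := readStepTm L dflt) (e₁ := .var 0)
    (γ := readTy L)
  rw [hs] at this
  exact this (readStepTm_typing hk hok hd _) (.var rfl)

theorem TreeTy.eq_unit {t : Tree} (h : TreeTy t (.base .unit)) : t = .unit := by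
  cases h; rfl

theorem tree_typed (c : Cell) : TreeTy c.tree (.base (.mu cellP)) := by
  induction c with
  | nil => exact .con (.inl .unit)
  | node l r ihl ihr => exact .con (.inr (.pair ihl ihr))

/-- The result of the reading at the cell `c`. -/
noncomputable def readRes (L : List SGround) (dflt : SGround → Tm) (ρ : List Tree) (c : Cell) :
    Tree :=
  c.tree.mapFold cellP (fun t => (readStepTm L dflt).den (t :: ρ)) .id

theorem readRes_node (ρ : List Tree) (l r : Cell) : readRes L dflt ρ (node l r) =
    .pair (.inr .unit) (.pair (readRes L dflt ρ r).snd.snd ((tupTm (contentTm L) L).den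
      (.pair (readRes L dflt ρ l) (readRes L dflt ρ r) ::
        .inr (.pair (readRes L dflt ρ l) (readRes L dflt ρ r)) :: ρ))) := rfl

theorem readRes_ty (hk : ∀ γ ∈ L, Ground.KidsIn L γ) (hok : ∀ γ ∈ L, SGround.Ok γ)
    (hd : ∀ γ ∈ L, ∀ Γ, RTyping Γ (dflt γ) (.ground γ.toS)) {Γ : List RGround} {ρ : List Tree}
    (hρ : EnvTy Γ ρ) (c : Cell) : TreeTy (readRes L dflt ρ c) (RGround.under (readTy L)) := by
  have := (readStepTm_typing hk hok hd Γ).denTy ρ hρ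
  simp only [Poly.under_rApp] at this
  exact TreeTy.mapFold (Q := .id) this (tree_typed c)

theorem proj_ty {t : Tree} {γ : SGround} (hγ : γ ∈ L) (ht : TreeTy t (tupTy L).under) :
    TreeTy (t.proj L γ) γ := by
  induction L generalizing t with
  | nil => simp at hγ
  | cons δ L ih =>
    simp only [tupTy, RGround.under_prod, SGround.under_toS] at ht
    cases ht
    simp only [Tree.proj, Tree.fst, Tree.snd]
    split
    · subst_vars; assumption
    · rename_i hne
      exact ih ((List.mem_cons.1 hγ).resolve_left (Ne.symm hne)) (by assumption)

/-- The term `readTm` reads represented values back. -/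
theorem readRes_spec (hk : ∀ γ ∈ L, Ground.KidsIn L γ) (hok : ∀ γ ∈ L, SGround.Ok γ)
    (hd : ∀ γ ∈ L, ∀ Γ, RTyping Γ (dflt γ) (.ground γ.toS)) {Γ : List RGround} {ρ : List Tree}
    (hρ : EnvTy Γ ρ) {H : Heap} {a : ℕ} {V : Cell}
    (hV : Annot H a V) {t : Tree} {γ : SGround} (ht : Rep H a t)
    (hty : TreeTy t γ) (hγ : γ ∈ L) :
    (readRes L dflt ρ V).snd.fst.proj L γ = t := by
  induction hV generalizing t γ with
  | @unit a V e =>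
    cases ht.unit_inv e
    cases hty
    have h := readRes_ty hk hok hd hρ V
    generalize readRes L dflt ρ V = r at h
    simp only [RGround.under_prod] at h
    cases h
    rename_i h
    cases h
    rename_i h _
    -- The cell is arbitrary here, but any result of type `unit` is the right one.
    exact (proj_ty hγ h).eq_unit
  | pair e _ _ ih₁ ih₂ =>
    obtain ⟨t₁, t₂, rfl, r₁, r₂⟩ := ht.pair_inv e
    cases hty with
    | pair h₁ h₂ =>
      obtain ⟨k₁, k₂⟩ := hk _ hγ
      simp only [readRes_node, Tree.snd, Tree.fst, proj_tupTm hγ, contentTm, Tm.den, projTm_den]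
      exact congrArg₂ Tree.pair (ih₁ r₁ h₁ k₁) (ih₂ r₂ h₂ k₂)
  | inl e _ ih =>
    obtain ⟨t₁, rfl, r₁⟩ := ht.inl_inv e
    cases hty with
    | inl h₁ =>
      obtain ⟨k₁, -⟩ := hk _ hγ
      simp only [readRes_node, Tree.snd, Tree.fst, proj_tupTm hγ, contentTm, Tm.den, projTm_den]
      exact congrArg Tree.inl (ih r₁ h₁ k₁)
  | inr e _ ih =>
    obtain ⟨t₁, rfl, r₁⟩ := ht.inr_inv e
    cases hty with
    | inr h₁ =>
      obtain ⟨-, k₁⟩ := hk _ hγ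
      simp only [readRes_node, Tree.snd, Tree.fst, proj_tupTm hγ, contentTm, Tm.den, projTm_den]
      exact congrArg Tree.inr (ih r₁ h₁ k₁)
  | con e _ ih =>
    obtain ⟨t₁, rfl, r₁⟩ := ht.con_inv e
    cases hty with
    | con h₁ =>
      simp only [readRes_node, Tree.snd, Tree.fst, proj_tupTm hγ, contentTm, Tm.den, projTm_den]
      exact congrArg (Tree.con _) (ih r₁ h₁ (hk _ hγ))

end

/-! ### Completeness -/

/-- The types of `S₁⁻` contain no empty data types. -/
def Ty.Ok : Ty Base → Prop
  | .ground γ => SGround.Ok γ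
  | .arr γ₁ γ₀ => SGround.Ok γ₁ ∧ SGround.Ok γ₀

theorem STyping.ok {Γ e τ} (h : STyping Γ e τ) (hΓ : ∀ γ ∈ Γ, SGround.Ok γ) : Ty.Ok τ := by
  induction h with
  | var e => exact hΓ _ (List.mem_of_getElem? e)
  | lam h₁ _ ih => exact ⟨h₁, ih (by simpa using ⟨h₁, hΓ⟩)⟩
  | app _ _ ih₀ _ => exact (ih₀ hΓ).2
  | unit => trivial
  | pair _ _ ih₁ ih₂ => exact ⟨ih₁ hΓ, ih₂ hΓ⟩
  | fst _ ih => exact (ih hΓ).1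
  | snd _ ih => exact (ih hΓ).2
  | inl h _ ih => exact ⟨ih hΓ, h⟩
  | inr h _ ih => exact ⟨h, ih hΓ⟩
  | case _ _ _ ih₀ ih₁ _ => exact ih₁ (by simpa using ⟨(ih₀ hΓ).1, hΓ⟩)
  | con h _ _ => exact h
  | des _ ih =>
    have := ih hΓ
    exact Poly.Inhab.ok_app (And.left this) this
  | fold _ _ ih₀ _ => exact (ih₀ hΓ).2

/-- Type preservation for the denotations of `S₁⁻` terms, in environments that may have more
entries than the context. -/
def SDenTy (Γ : List SGround) (e : Tm) : Ty Base → Prop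
  | .ground γ => ∀ ρ ρ', List.Forall₂ (fun γ t => TreeTy t γ) Γ ρ → TreeTy (e.den (ρ ++ ρ')) γ
  | .arr γ₁ γ₀ => ∀ ρ ρ', List.Forall₂ (fun γ t => TreeTy t γ) Γ ρ → ∀ t, TreeTy t γ₁ →
      TreeTy (e.den (t :: (ρ ++ ρ'))) γ₀

theorem STyping.sDenTy {Γ e τ} (h : STyping Γ e τ) : SDenTy Γ e τ := by
  induction h with
  | @var Γ i γ e =>
    intro ρ ρ' hρ
    simp only [Tm.den]
    induction hρ generalizing i with
    | nil => simp at e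
    | cons hr _ ih =>
      cases i with
      | zero => simp at e; subst e; simpa using hr
      | succ i => simp at e; simpa using ih e
  | lam _ _ ih => exact fun ρ ρ' hρ t ht => ih (t :: ρ) ρ' (.cons ht hρ)
  | app _ _ ih₀ ih₁ => exact fun ρ ρ' hρ => ih₀ ρ ρ' hρ _ (ih₁ ρ ρ' hρ)
  | unit => exact fun ρ ρ' hρ => .unit
  | pair _ _ ih₁ ih₂ => exact fun ρ ρ' hρ => .pair (ih₁ ρ ρ' hρ) (ih₂ ρ ρ' hρ)
  | fst _ ih =>
    intro ρ ρ' hρ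
    have := ih ρ ρ' hρ
    simp only [Tm.den]
    generalize Tm.den _ (ρ ++ ρ') = t at this
    cases this; assumption
  | snd _ ih =>
    intro ρ ρ' hρ
    have := ih ρ ρ' hρ
    simp only [Tm.den]
    generalize Tm.den _ (ρ ++ ρ') = t at this
    cases this; assumption
  | inl _ _ ih => exact fun ρ ρ' hρ => .inl (ih ρ ρ' hρ)
  | inr _ _ ih => exact fun ρ ρ' hρ => .inr (ih ρ ρ' hρ)
  | case _ _ _ ih₀ ih₁ ih₂ =>
    intro ρ ρ' hρ
    have := ih₀ ρ ρ' hρ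
    simp only [Tm.den]
    generalize Tm.den _ (ρ ++ ρ') = t at this
    cases this with
    | inl h => exact ih₁ (_ :: ρ) ρ' (.cons h hρ)
    | inr h => exact ih₂ (_ :: ρ) ρ' (.cons h hρ)
  | con _ _ ih => exact fun ρ ρ' hρ => .con (ih ρ ρ' hρ)
  | des _ ih =>
    intro ρ ρ' hρ
    have := ih ρ ρ' hρ
    simp only [Tm.den, sMu] at this ⊢
    generalize Tm.den _ (ρ ++ ρ') = t at this
    cases this; assumption
  | fold _ _ ih₀ ih₁ =>
    intro ρ ρ' hρ
    exact TreeTy.mapFold (Q := .id) (ih₀ ρ ρ' hρ) (ih₁ ρ ρ' hρ)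

/-- The term encodes its argument, runs the machine on the encoding and reads the result back, with
`toNorm` after each stage so that the next one can recurse over its outcome. -/
theorem rs11Computable_of_dpPolyCost (γ₁ γ₀ : SGround) (f : Tm) (hf : STyping [] f (.arr γ₁ γ₀))
    (hcost : DPPolyCost γ₁ f) : RS11Computable γ₁ γ₀ f := by
  obtain ⟨q, hq⟩ := hcost
  obtain ⟨hok₁, hok₀⟩ : SGround.Ok γ₁ ∧ SGround.Ok γ₀ := hf.ok (by simp)
  obtain ⟨B, hB⟩ := hf.exists_plain
  obtain ⟨B', hB₁, hB₂⟩ : ∃ B', 7 ≤ B' ∧ (Tm.app f (.var 0)).Plain B' :=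
    ⟨B + 7, by omega, hB.mono (by omega), by simp [Tm.Plain]⟩
  -- The summands pay for the initial heap and for `B'` machine steps per derivation node.
  have hK : Clock fun d => d.tree.csize + 1 + B' * q.eval d.tree.csize :=
    (Clock.csize.add (.const 1)).add ((Clock.const B').mul (Clock.csize.eval q))
  obtain ⟨m, hmty, hmden⟩ := SDef.simulate (Tm.app f (.var 0)).code hK
  have hdef : ∀ γ : SGround, ∃ e, SGround.Ok γ → ∀ Γ, RTyping Γ e (.ground γ.toS) := by
    intro γ
    by_cases h : SGround.Ok γ
    · obtain ⟨e, he⟩ := h.exists_default; exact ⟨e, fun _ => he⟩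
    · exact ⟨.unit, fun h' => absurd h' h⟩
  choose dflt hdflt using hdef
  set L := Ground.tys γ₀ with hL
  have hγ₀ : γ₀ ∈ L := Ground.mem_tys γ₀
  have hk := Ground.tys_closed (L := L) (δ := γ₀) (List.Subset.refl _)
  have hLok := Ground.tys_ok hok₀
  have hd : ∀ γ ∈ L, ∀ Γ, RTyping Γ (dflt γ) (.ground γ.toS) := fun γ hγ => hdflt γ (hLok γ hγ)
  -- The simulation ignores its safe argument, so `nil` is passed; what remains free is normal, as
  -- `toNorm` demands.
  let run : Tm := .toNorm (.app (.lam (m 0)) nilTm)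
  let read : Tm := .toNorm (projTm L γ₀ (.fst (.snd (readTm L dflt))))
  let f' : Tm := .lam (.app (.lam (.app (.lam read) run)) (.toNorm (Ground.encTm γ₁)))
  -- Besides the empty context, the typing is needed with the argument in the context, where
  -- termination of the application is shown.
  have hty : ∀ Δ : List RGround, (∀ γ ∈ Δ, RGround.IsNormal γ) →
      RTyping Δ f' (.arr γ₁.toR γ₀.toR) := by
    intro Δ hΔ
    have hnorm : ∀ γ ∈ cellN :: cellN :: γ₁.toR :: Δ, RGround.IsNormal γ := by
      simpa using ⟨trivial, γ₁.toR_isNormal, hΔ⟩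
    have henc : RTyping (γ₁.toR :: Δ) (.toNorm (Ground.encTm γ₁)) (.ground cellN) :=
      .toNorm (γ := cellS) (fun i γ _ h => hnorm γ
        (List.mem_cons_of_mem _ (List.mem_cons_of_mem _ (List.mem_of_getElem? h))))
        (Ground.encTm_typing hok₁ Δ)
    have hrun : RTyping (cellN :: γ₁.toR :: Δ) run (.ground cellN) :=
      .toNorm (γ := cellS) (fun i γ _ h => hnorm γ
        (List.mem_cons_of_mem _ (List.mem_of_getElem? h)))
        (.app (.lam cellS_ok (hmty (cellN :: γ₁.toR :: Δ) 0 rfl)) (nilTm_typing _))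
    have hread : RTyping (cellN :: cellN :: γ₁.toR :: Δ) read (.ground γ₀.toR) := by
      rw [← γ₀.toNorm_toS]
      exact .toNorm (fun i γ _ h => hnorm γ (List.mem_of_getElem? h)) (projTm_typing hγ₀
        (.fst (γ₂ := tupTy L) (.snd (γ₁ := bitTy) (readTm_typing hk hLok hd _))))
    exact .lam hok₁.toR (.app (.lam cellN_ok (.app (.lam cellN_ok hread) hrun)) henc)
  refine ⟨f', hty [] (by simp), fun H a ha => ?_⟩
  obtain ⟨t, ht, htγ⟩ := ha.exists_rep
  obtain ⟨H₁, v₁, n₁, hev₁, -⟩ := hq H a ha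
  have r₁ := (hev₁.sound (.cons ht .nil)).2
  have happ : RTyping [γ₁.toR] (.app f' (.var 0)) (.ground γ₀.toR) :=
    .app (hty _ (by simpa using γ₁.toR_isNormal)) (.var rfl)
  have htR : TreeTy t γ₁.toR.under := by simpa using htγ
  obtain ⟨H₂, v₂, n₂, hev₂⟩ := happ.tyTerminates H [a] [t] (.cons htR .nil) (.cons ht .nil)
  have r₂ := (hev₂.sound (.cons ht .nil)).2
  refine ⟨H₁, v₁, n₁, H₂, v₂, n₂, hev₁, hev₂, bisim_of_rep r₁ ?_⟩
  obtain ⟨H₃, v₃, hV, r₃⟩ := simulate_spec (K := t.enc.tree.csize + 1 +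
    B' * q.eval t.enc.tree.csize) hB₁ hB₂ htγ hq (by omega) le_rfl
  set V := simulate (Tm.app f (.var 0)).code (t.enc.tree.csize + 1 +
    B' * q.eval t.enc.tree.csize) t.enc with hVdef
  -- The closed `f` is evaluated in an environment that already holds the argument, so its
  -- denotation is typed in an environment with a surplus entry.
  have htyf : TreeTy ((Tm.app f (.var 0)).den [t]) γ₀ := hf.sDenTy [] [t] .nil t htγ
  have hfin := readRes_spec hk hLok hd (Γ := [cellN, cellN, γ₁.toR, γ₁.toR])
    (ρ := [V.tree, t.enc.tree, t, t])
    (.cons (tree_typed _) (.cons (tree_typed _) (.cons htR (.cons htR .nil)))) hV r₃ htyf hγ₀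
  have hden : (Tm.app f' (.var 0)).den [t] =
      (readRes L dflt [V.tree, t.enc.tree, t, t] V).snd.fst.proj L γ₀ := by
    have e₁ : (Ground.encTm γ₁).den [t, t] = t.enc.tree := Ground.encTm_den htγ [t]
    have e₂ : (m 0).den [nil.tree, t.enc.tree, t, t] = V.tree :=
      hmden [t.enc.tree, t, t] 0 t.enc nil rfl
    have e₃ : (Tm.app f' (.var 0)).den [t] = read.den
        ((m 0).den [nil.tree, (Ground.encTm γ₁).den [t, t], t, t] ::
          (Ground.encTm γ₁).den [t, t] :: [t, t]) := rfl
    rw [e₃, e₁, e₂]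
    exact projTm_den L γ₀ _ _
  rwa [hden, hfin] at r₂

end StructRec

/-- `RS₁.₁⁻` completeness: each DP-polynomial-cost `S₁⁻` function is `RS₁.₁⁻`-computable. -/
theorem theoremt (γ₁ γ₀ : StructRec.SGround) (f : StructRec.Tm)
    (hf : StructRec.STyping [] f (.arr γ₁ γ₀)) (hcost : StructRec.DPPolyCost γ₁ f) :
    StructRec.RS11Computable γ₁ γ₀ f := StructRec.rs11Computable_of_dpPolyCost γ₁ γ₀ f hf hcost
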